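/- **Notation.** All matrices are real $q\times q$ with $q\ge 1$. For symmetric positive-definite $A$, $\mathrm{uchol}(A)$ is the upper-triangular $R$ with positive diagonal and $R'R=A$. $\mathrm{Wishart}_q(h,S)$ is defined for symmetric positive-definite $S$ and either real $h>q-1$ (usual density) or a positive integer $h<q$ (law of $\sum_{l=1}^h x_lx_l'$, $x_l$ i.i.d. $N_q(0,S)$). $\mathrm{MatrixBeta}_q(n/2,k/2)$ is the law of $(R')^{-1}A_1R^{-1}$ with $A_1\sim\mathrm{Wishart}_q(n,I)$, $A_2\sim\mathrm{Wishart}_q(k,I)$ independent and $R=\mathrm{uchol}(A_1+A_2)$. **The two processes.** Let $T\ge 0$, $0<\lambda<1$, $n>q-1$, let $k$ be a positive integer less than $q$ or a real number greater than $q-1$, and let $D_0^U$ be symmetric positive definite. In both models $y_t\mid\Phi_t\sim\mathrm{Wishart}_q(k,(k\Phi_t)^{-1})$ for $t=1,\dots,T$ (conditionally on $\Phi_{0:t},y_{1:t-1}$). The information set $\mathcal D_t$ consists of the prior and $y_{1:t}$. Put $P_{t}=\mathrm{uchol}((kD_{t})^{-1})$ and let $U_{t}=(u_{ij,t})$ be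 the upper-triangular matrix with positive diagonal such that $\Phi_{t}=(U_{t}P_{t})'U_{t}P_{t}$ (for each model with its own $\Phi_t$ and $D_t$). * Uhlig extended (UE): $\Phi_0^U\sim\mathrm{Wishart}_q(n+k,(kD_0^U)^{-1})$, $D_t=\lambda D_{t-1}+y_t$, and $\Phi_t^U=(U_{t-1}P_{t-1})'\Psi_tU_{t-1}P_{t-1}/\lambda$ with $\Psi_t\sim\mathrm{MatrixBeta}_q(n/2,k/2)$ independent of the past. * Beta-Bartlett (BB), with hyperparameters $\beta,b,k,k_0,D_0^B$: $\Phi_0^B\sim\mathrm{Wishart}_q(k_0,(kD_0^B)^{-1})$, $D_t=bD_{t-1}+y_t$, $k_t=\beta k_{t-1}+k$, and $\Phi_t^B=(\tilde U_tP_{t-1})'\tilde U_tP_{t-1}/b$, where $\tilde u_{ij,t}=u_{ij,t-1}$ for $i\ne j$ and $\tilde u_{ii,t}=\sqrt{\eta_{i,t}}\,u_{ii,t-1}$ with $\eta_{i,t}\sim\mathrm{Beta}((\beta k_{t-1}-i+1)/2,(1-\beta)k_{t-1}/2)$ independent of each other and of the past. Assume the matching condition $k_0=n+k$, $\beta=n/(n+k)$,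 $b=\lambda$, $D_0^B=D_0^U$. **Theorem.** 1. For $1\le t\le T$, in each process the conditional law of $\Phi_t$ given $(\Phi_{t-1},\mathcal D_{t-1})$ is the law given by its state evolution, with $\Phi_{t-1}$ and $D_{t-1}$ held fixed. 2. For every common value of $\Phi_{t-1}$ and of $D_{t-1}$ (symmetric positive definite), with $P_{t-1}$, $U_{t-1}$ as above, all the expectations below are finite and $$E(\Phi_t^U\mid\Phi_{t-1},\mathcal D_{t-1})-E(\Phi_t^B\mid\Phi_{t-1},\mathcal D_{t-1})=\frac1\lambda P_{t-1}'\Big[\frac n{n+k}U_{t-1}'U_{t-1}-E(\tilde U_t'\tilde U_t\mid\Phi_{t-1},\mathcal D_{t-1})\Big]P_{t-1},$$ $$E[(\tilde U_t'\tilde U_t)_{ij}\mid\Phi_{t-1},\mathcal D_{t-1}]=\sum_{l=1}^{i\wedge j-1}u_{li,t-1}u_{lj,t-1}+\delta_{ij}\frac{(n-i+1)u_{ii,t-1}^2}{n-i+1+k}+(1-\delta_{ij})\,g(i,j),$$ $$g(i,j)=\frac{\Gamma\big(\frac{n-i\wedge j+2}2\big)\Gamma\big(\frac{n-i\wedge j+k+1}2\big)}{\Gamma\big(\frac{n-i\wedge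 j+1}2\big)\Gamma\big(\frac{n-i\wedge j+k+2}2\big)}\,u_{i\wedge j,i\wedge j,t-1}\,u_{i\wedge j,i\vee j,t-1}.$$ 3. If $U_{t-1}$ is diagonal, then for every $i\in\{2,\dots,q\}$, $E[(\tilde U_t'\tilde U_t)_{ii}\mid\Phi_{t-1},\mathcal D_{t-1}]=\frac{(n-i+1)u_{ii,t-1}^2}{n-i+1+k}\ne\frac{n\,u_{ii,t-1}^2}{n+k}$, and the $(i,i)$ entries of $E(\Phi_t^U\mid\Phi_{t-1},\mathcal D_{t-1})$ and $E(\Phi_t^B\mid\Phi_{t-1},\mathcal D_{t-1})$ differ. 4. If $q\ge 2$, then for every common value of $\Phi_{t-1}$ and of $D_{t-1}$ the matrices $E(\Phi_t^U\mid\Phi_{t-1},\mathcal D_{t-1})$ and $E(\Phi_t^B\mid\Phi_{t-1},\mathcal D_{t-1})$ are different; hence the state transition laws of UE and BB differ. 5. If $q\ge 2$ and $T\ge 1$, the joint smoothed posteriors of the two processes, i.e. the conditional laws of $\Phi^U_{0:T}$ and of $\Phi^B_{0:T}$ given $y_{1:T}$, are different for almost every data value $y_{1:T}$, both under the marginal law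 of the data in UE and under that in BB. -/

import Mathlib

open MeasureTheory ProbabilityTheory Matrix

noncomputable section

namespace VolatilityProcess

/-- Real `q × q` matrices. -/
abbrev Mat (q : ℕ) : Type := Matrix (Fin q) (Fin q) ℝ

/-- The Borel σ-algebra, entrywise. -/
instance instMeasurableSpaceMat (q : ℕ) : MeasurableSpace (Mat q) :=
  inferInstanceAs (MeasurableSpace (Fin q → Fin q → ℝ))

instance instStandardBorelSpaceMat (q : ℕ) : StandardBorelSpace (Mat q) :=
  inferInstanceAs (StandardBorelSpace (Fin q → Fin q → ℝ))

/-! ### Cholesky factors -/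

/-- `R` is an upper-triangular Cholesky factor of `A`: it is upper triangular with positive
diagonal and `A = R' R`. -/
def IsCholesky {q : ℕ} (A R : Mat q) : Prop :=
  (∀ i j, j < i → R i j = 0) ∧ (∀ i, 0 < R i i) ∧ Rᵀ * R = A

open Classical in
/-- The upper-triangular Cholesky factor of a symmetric positive-definite matrix
(zero for a matrix that has no such factor). -/
def uchol {q : ℕ} (A : Mat q) : Mat q :=
  if h : ∃ R, IsCholesky A R then h.choose else 0

/-! ### Wishart and matrix beta distributions -/

/-- The multivariate gamma function `Γ_q(a) = π^{q(q-1)/4} ∏_{j=1}^q Γ(a - (j-1)/2)`. -/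
def multivariateGamma (q : ℕ) (a : ℝ) : ℝ :=
  Real.pi ^ ((q : ℝ) * ((q : ℝ) - 1) / 4) * ∏ j : Fin q, Real.Gamma (a - (j : ℝ) / 2)

/-- The symmetric matrix with prescribed entries on and above the diagonal. -/
def symOfUpper {q : ℕ} (v : {p : Fin q × Fin q // p.1 ≤ p.2} → ℝ) : Mat q :=
  Matrix.of fun i j => if h : i ≤ j then v ⟨(i, j), h⟩ else v ⟨(j, i), (not_le.mp h).le⟩

/-- Lebesgue measure `∏_{i ≤ j} da_{ij}` on the symmetric matrices. -/
def symLebesgue (q : ℕ) : Measure (Mat q) :=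
  (volume : Measure ({p : Fin q × Fin q // p.1 ≤ p.2} → ℝ)).map symOfUpper

open Classical in
/-- The density of the Wishart distribution with `h > q - 1` degrees of freedom and scale matrix
`S`, with respect to `symLebesgue q`. It is supported on the positive-definite matrices. -/
def wishartDensity {q : ℕ} (h : ℝ) (S A : Mat q) : ℝ :=
  if A.PosDef then
    (2 : ℝ) ^ (-(h * q / 2)) * S.det ^ (-(h / 2)) * (multivariateGamma q (h / 2))⁻¹ *
      A.det ^ ((h - q - 1) / 2) * Real.exp (-(1 / 2) * (S⁻¹ * A).trace)
  else 0

/-- The law of `∑_{l=1}^m x_l x_l'`, where `x_1, …, x_m` are independent `N_q(0, S)` vectors. -/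
def wishartGaussian {q : ℕ} (m : ℕ) (S : Mat q) : Measure (Mat q) :=
  (Measure.pi fun _ : Fin m => multivariateGaussian (0 : EuclideanSpace ℝ (Fin q)) S).map
    fun x => ∑ l, Matrix.vecMulVec (x l : Fin q → ℝ) (x l : Fin q → ℝ)

open Classical in
/-- The `Wishart_q(h, S)` distribution, for `S` symmetric positive definite and `h` either a real
number greater than `q - 1` (given by its density) or a positive integer less than `q`
(the singular case, given by Gaussian outer products). -/
def wishart {q : ℕ} (h : ℝ) (S : Mat q) : Measure (Mat q) :=
  if (q : ℝ) - 1 < h then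
    (symLebesgue q).withDensity fun A => ENNReal.ofReal (wishartDensity h S A)
  else wishartGaussian ⌊h⌋₊ S

/-- The `MatrixBeta_q(a, b)` distribution: the law of `(T')⁻¹ A₁ T⁻¹`, where `T = uchol (A₁ + A₂)`
and `A₁ ~ Wishart_q(2a, I)`, `A₂ ~ Wishart_q(2b, I)` are independent. (A common scale matrix other
than `I` gives the same law.) -/
def matrixBeta (q : ℕ) (a b : ℝ) : Measure (Mat q) :=
  ((wishart (2 * a) (1 : Mat q)).prod (wishart (2 * b) (1 : Mat q))).map
    fun A => ((uchol (A.1 + A.2))ᵀ)⁻¹ * A.1 * (uchol (A.1 + A.2))⁻¹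

/-! ### State evolutions -/

/-- The matrix `P_t = uchol((k D_t)⁻¹)`, the Cholesky factor of the scale matrix of the filtered
distribution at time `t`. -/
def scaleFactor {q : ℕ} (k : ℝ) (D : Mat q) : Mat q := uchol ((k • D)⁻¹)

/-- The factor `U` of the Bartlett decomposition `Φ = (U P)' (U P)`: it is upper triangular with
positive diagonal and `U' U = (P⁻¹)' Φ P⁻¹`. -/
def bartlettFactor {q : ℕ} (P Φ : Mat q) : Mat q := uchol ((P⁻¹)ᵀ * Φ * P⁻¹)

/-- Uhlig extended state evolution: the conditional law of `Φ_t = (U P)' Ψ (U P) / lam` with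
`Ψ ~ MatrixBeta_q(n/2, k/2)`, given `Φ_{t-1} = (U P)' (U P)`, where `P` is determined by
`D = D_{t-1}`. -/
def ueTransition {q : ℕ} (lam n k : ℝ) (D Φ : Mat q) : Measure (Mat q) :=
  (matrixBeta q (n / 2) (k / 2)).map fun Ψ =>
    lam⁻¹ • ((bartlettFactor (scaleFactor k D) Φ * scaleFactor k D)ᵀ * Ψ *
      (bartlettFactor (scaleFactor k D) Φ * scaleFactor k D))

/-- Degrees of freedom of the beta-Bartlett process: `k_0` is given, `k_t = β k_{t-1} + k`. -/
def bbDof (β k k₀ : ℝ) : ℕ → ℝ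
  | 0 => k₀
  | t + 1 => β * bbDof β k k₀ t + k

/-- The law of `(η_1, …, η_q)`, independent with
`η_i ~ Beta((β κ - i + 1)/2, (1 - β) κ / 2)`, where `κ = k_{t-1}`.
The index `i : Fin q` stands for `i + 1` in `{1, …, q}`. -/
def bbNoise (q : ℕ) (β κ : ℝ) : Measure (Fin q → ℝ) :=
  Measure.pi fun i : Fin q =>
    betaMeasure ((β * κ - ((i : ℝ) + 1) + 1) / 2) ((1 - β) * κ / 2)

/-- The matrix `Ũ` with `ũ_ij = u_ij` for `i ≠ j` and `ũ_ii = √η_i u_ii`. -/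
def bbFactor {q : ℕ} (U : Mat q) (η : Fin q → ℝ) : Mat q :=
  Matrix.of fun i j => if i = j then √(η i) * U i i else U i j

/-- Beta-Bartlett state evolution: the conditional law of `Φ_t = (Ũ P)' (Ũ P) / b`, given
`Φ_{t-1} = (U P)' (U P)`, where `P` is determined by `D = D_{t-1}` and `κ = k_{t-1}`. -/
def bbTransition {q : ℕ} (β b k κ : ℝ) (D Φ : Mat q) : Measure (Mat q) :=
  (bbNoise q β κ).map fun η =>
    b⁻¹ • ((bbFactor (bartlettFactor (scaleFactor k D) Φ) η * scaleFactor k D)ᵀ *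
      (bbFactor (bartlettFactor (scaleFactor k D) Φ) η * scaleFactor k D))

/-! ### The processes -/

/-- `D_t = c D_{t-1} + y_t`, started at `D₀` (only `y_1, …, y_t` are used). -/
def scaleMatrix {q : ℕ} (c : ℝ) (D₀ : Mat q) (y : ℕ → Mat q) : ℕ → Mat q
  | 0 => D₀
  | t + 1 => c • scaleMatrix c D₀ y t + y (t + 1)

/-- The states `(Φ_0, …, Φ_t)`. -/
def states {Ω : Type*} {q : ℕ} (Φ : ℕ → Ω → Mat q) (t : ℕ) (ω : Ω) : Fin (t + 1) → Mat q :=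
  fun s => Φ (s : ℕ) ω

/-- The data `(y_1, …, y_t)`. -/
def data {Ω : Type*} {q : ℕ} (y : ℕ → Ω → Mat q) (t : ℕ) (ω : Ω) : Fin t → Mat q :=
  fun s => y ((s : ℕ) + 1) ω

/-- States `Φ_0, …, Φ_T` and observations `y_1, …, y_T` form a state-space model with initial law
`init`, state evolution given by `trans t D_t Φ_t` (the conditional law of `Φ_{t+1}` given the past
up to time `t`), where `D_t = c D_{t-1} + y_t`, and observations
`y_t | Φ_t ~ Wishart_q(k, (k Φ_t)⁻¹)`. -/
structure IsStateSpaceModel {Ω : Type*} [MeasurableSpace Ω] (μ : Measure Ω) [IsProbabilityMeasure μ]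
    {q : ℕ} (T : ℕ) (k c : ℝ) (D₀ : Mat q) (init : Measure (Mat q))
    (trans : ℕ → Mat q → Mat q → Measure (Mat q)) (Φ y : ℕ → Ω → Mat q) : Prop where
  measurable_state : ∀ t, Measurable (Φ t)
  measurable_obs : ∀ t, Measurable (y t)
  law_init : μ.map (Φ 0) = init
  law_state : ∀ t < T, ∀ᵐ ω ∂μ,
    condDistrib (Φ (t + 1)) (fun ω' => (states Φ t ω', data y t ω')) μ
        (states Φ t ω, data y t ω) =
      trans t (scaleMatrix c D₀ (fun s => y s ω) t) (Φ t ω)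
  law_obs : ∀ t < T, ∀ᵐ ω ∂μ,
    condDistrib (y (t + 1)) (fun ω' => (states Φ (t + 1) ω', data y t ω')) μ
        (states Φ (t + 1) ω, data y t ω) =
      wishart k ((k • Φ (t + 1) ω)⁻¹)

/-- The Uhlig extended process with hyperparameters `lam`, `n`, `k`, `D₀`, up to time `T`. -/
def IsUhligExtended {Ω : Type*} [MeasurableSpace Ω] (μ : Measure Ω) [IsProbabilityMeasure μ]
    {q : ℕ} (T : ℕ) (lam n k : ℝ) (D₀ : Mat q) (Φ y : ℕ → Ω → Mat q) : Prop :=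
  IsStateSpaceModel μ T k lam D₀ (wishart (n + k) ((k • D₀)⁻¹))
    (fun _ D Φ' => ueTransition lam n k D Φ') Φ y

/-- The beta-Bartlett process with hyperparameters `β`, `b`, `k`, `k₀`, `D₀`, up to time `T`. -/
def IsBetaBartlett {Ω : Type*} [MeasurableSpace Ω] (μ : Measure Ω) [IsProbabilityMeasure μ]
    {q : ℕ} (T : ℕ) (β b k k₀ : ℝ) (D₀ : Mat q) (Φ y : ℕ → Ω → Mat q) : Prop :=
  IsStateSpaceModel μ T k b D₀ (wishart k₀ ((k • D₀)⁻¹))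
    (fun t D Φ' => bbTransition β b k (bbDof β k k₀ t) D Φ') Φ y

/-- A version of the joint (smoothed) posterior of `Φ_0, …, Φ_T` given `y_1, …, y_T`: the regular
conditional distribution of the states given the data. -/
def smoothedPosterior {Ω : Type*} [MeasurableSpace Ω] (μ : Measure Ω) [IsProbabilityMeasure μ]
    {q : ℕ} (T : ℕ) (Φ y : ℕ → Ω → Mat q) (yobs : Fin T → Mat q) :
    Measure (Fin (T + 1) → Mat q) :=
  condDistrib (states Φ T) (data y T) μ yobs

/-! ### The conditional mean of `Ũ' Ũ` -/

/-- The `(i, j)` entry of the claimed mean of `Ũ' Ũ`, for `U = (u_ij)`: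
`∑_{l=1}^{i∧j-1} u_li u_lj + δ_ij (n-i+1) u_ii² / (n-i+1+k) + (1-δ_ij) g(i,j)`, where
`g(i,j) = Γ((n-i∧j+2)/2) Γ((n-i∧j+k+1)/2) / (Γ((n-i∧j+1)/2) Γ((n-i∧j+k+2)/2))
  u_{i∧j,i∧j} u_{i∧j,i∨j}`.
The index `i : Fin q` stands for `i + 1` in `{1, …, q}`. -/
def gramMean {q : ℕ} (n k : ℝ) (U : Mat q) : Mat q := Matrix.of fun i j =>
  (∑ l ∈ Finset.Iio (min i j), U l i * U l j) +
    if i = j then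
      (n - ((i : ℝ) + 1) + 1) * U i i ^ 2 / (n - ((i : ℝ) + 1) + 1 + k)
    else
      Real.Gamma ((n - (((min i j : Fin q) : ℝ) + 1) + 2) / 2) *
          Real.Gamma ((n - (((min i j : Fin q) : ℝ) + 1) + k + 1) / 2) /
        (Real.Gamma ((n - (((min i j : Fin q) : ℝ) + 1) + 1) / 2) *
          Real.Gamma ((n - (((min i j : Fin q) : ℝ) + 1) + k + 2) / 2)) *
        (U (min i j) (min i j) * U (min i j) (max i j))

end VolatilityProcess

end

open VolatilityProcess

/-! ### Measurability of matrix operations -/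

namespace VolatilityProcess

/-! Under the matching condition n + k is the fixed point of the recursion for the degrees of
freedom, so the beta noise is η_i ~ Beta((n - i)/2, k/2) at every time (i counted from 0), and
everything reduces to comparing two explicit means.

For UE the mean of Ψ is n/(n+k) times the identity (`integral_entry_matrixBeta`). The reason is that
A₁ has conditional mean n/(n+k) S given S = A₁ + A₂. This is proved with Laplace transforms
(`map_withDensity_quadENN`): tilting by exp(t tr(ΘS)) keeps A₁ and A₂ independent Wishart matrices
with a common new scale, so the tilted means of v'A₁v and v'A₂v are always in the ratio n : k, and a
transform known near zero determines a finite measure (`ext_of_laplace_nhds`). Singular k has no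
Lebesgue density, so all Wishart laws are handled through their density relative to Wishart(h, I)
(`wishart_eq_withDensity`); in the regular case the normalising constant and the first moment come
from peeling off one row at a time (`lintegral_detExp`, `lintegral_wishart_one_zero_zero`).

For BB the entries of Ũ'Ũ are explicit (`gram_bbFactor`): only E η_i and E √η_i enter, and both are
beta moments. The difference G of the two Gram means is never zero when q ≥ 2 (`gramDiff_ne_zero`).
Its entry in position (0, 1) vanishes only if u_01 = 0, because E √η_0 > E η_0 = n/(n+k); but then
its entry in position (1, 1) is (n/(n+k) - (n-1)/(n-1+k)) u_11², which is positive. The difference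
of the state means is λ⁻¹P'GP with P invertible, so it is nonzero too.

For the smoothed posteriors it is enough to look at (Φ_{T-1}, Φ_T). By Bayes' formula
(`hasCondDistrib_bayesKernel`) its posterior is the filtered law of Φ_{T-1} followed by the
transition, reweighted by the likelihood of y_T. The likelihood is positive and finite with respect
to Wishart(k, I), also for singular k, so the reweighting can be undone (`eq_of_bayesKernel_eq`).
Equal posteriors would thus give equal filtered laws and then equal transition laws at almost every
state, while D_{T-1} is the same function of the data in both models; this contradicts the first
half. The same positive likelihood makes the two data laws mutually absolutely continuous
(`map_data_absolutelyContinuous`), so exceptional null sets can be carried from one model to the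
other. -/

instance instBorelSpaceMat (q : ℕ) : BorelSpace (Mat q) :=
  inferInstanceAs (BorelSpace (Fin q → Fin q → ℝ))

theorem measurable_entry {q : ℕ} (i j : Fin q) : Measurable fun A : Mat q => A i j :=
  (measurable_pi_apply j).comp (measurable_pi_apply i)

theorem measurable_mat {α : Type*} [MeasurableSpace α] {q : ℕ} {f : α → Mat q}
    (h : ∀ i j, Measurable fun x => f x i j) : Measurable f :=
  measurable_pi_lambda _ fun i => measurable_pi_lambda _ fun j => h i j

theorem measurable_mat_inv {q : ℕ} : Measurable fun A : Mat q => A⁻¹ := by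
  have : (fun A : Mat q => A⁻¹) = fun A => (A.det)⁻¹ • A.adjugate := by
    -- The identity also holds at singular matrices, where both sides are zero by convention, so no
    -- case distinction is needed.
    ext1 A; rw [Matrix.inv_def, Ring.inverse_eq_inv']
  rw [this]
  refine measurable_mat fun i j => ?_
  have h1 : Measurable fun A : Mat q => A.det := (continuous_id.matrix_det).measurable
  have h2 : Measurable fun A : Mat q => A.adjugate := (continuous_id.matrix_adjugate).measurable
  exact h1.inv.mul ((measurable_entry i j).comp h2)

/-! ### Cholesky factors -/

namespace IsCholesky

variable {q : ℕ} {A R R' : Mat q}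

theorem transpose_mul_self (h : IsCholesky A R) : Rᵀ * R = A := h.2.2

theorem det_pos (h : IsCholesky A R) : 0 < R.det := by
  rw [Matrix.det_of_isUpperTriangular (fun i j hij => h.1 i j hij)]
  exact Finset.prod_pos fun i _ => h.2.1 i

theorem isUnit_det (h : IsCholesky A R) : IsUnit R.det := h.det_pos.ne'.isUnit

theorem posDef (h : IsCholesky A R) : A.PosDef := by
  rw [← h.2.2, ← Matrix.conjTranspose_eq_transpose_of_trivial]
  exact Matrix.PosDef.conjTranspose_mul_self R
    (Matrix.mulVec_injective_of_isUnit ((Matrix.isUnit_iff_isUnit_det R).2 h.isUnit_det))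

/-- Row by row from the top. In the (i, j) entry of R'R the terms from earlier rows agree by
induction and those from later rows vanish since R_li = 0 for l > i; what remains is R_ii R_ij =
R'_ii R'_ij. Taking j = i and using positivity fixes the diagonal, and cancelling it fixes the row.
-/
theorem unique (h : IsCholesky A R) (h' : IsCholesky A R') : R = R' := by
  have key : ∀ n : ℕ, ∀ i : Fin q, (i : ℕ) = n → ∀ j, R i j = R' i j := by
    intro n
    induction n using Nat.strong_induction_on with
    | _ n ih =>
      intro i hi
      have hrow : ∀ j, R i i * R i j = R' i i * R' i j := by
        intro j
        have e : ∑ l, (R l i * R l j - R' l i * R' l j) = 0 := by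
          have := congrFun (congrFun (h.2.2.trans h'.2.2.symm) i) j
          simp only [Matrix.mul_apply, Matrix.transpose_apply] at this
          rw [Finset.sum_sub_distrib, this, sub_self]
        rw [Finset.sum_eq_single i] at e
        · linarith
        · intro l _ hl
          rcases lt_or_gt_of_ne hl with hl | hl
          · rw [ih l (hi ▸ hl) l rfl, ih l (hi ▸ hl) l rfl, sub_self]
          · rw [h.1 l i hl, h'.1 l i hl]; simp
        · simp
      have hd : R i i = R' i i := by
        have := hrow i
        have h1 := h.2.1 i
        have h2 := h'.2.1 i
        nlinarith
      intro j
      have := hrow j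
      rw [hd] at this
      exact mul_left_cancel₀ (h'.2.1 i).ne' this
  ext i j
  exact key i i rfl j

end IsCholesky

theorem exists_isCholesky {q : ℕ} {A : Mat q} (hA : A.PosDef) : ∃ R, IsCholesky A R := by
  set N : Mat q := LDL.lowerInv hA with hN
  have hNu : IsUnit N := isUnit_of_invertible N
  have hND : LDL.diag hA = N * A * Nᴴ := LDL.diag_eq_lowerInv_conj hA
  have hDpos : (LDL.diag hA).PosDef := by
    rw [hND]
    exact hA.mul_mul_conjTranspose_same (Matrix.vecMul_injective_of_isUnit hNu)
  set d := LDL.diagEntries hA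
  have hd : ∀ i, 0 < d i := (Matrix.posDef_diagonal_iff).1 hDpos
  have hLDL : LDL.lower hA * LDL.diag hA * (LDL.lower hA)ᴴ = A := LDL.lower_conj_diag hA
  set M : Mat q := LDL.lower hA with hM
  have hMN : M = N⁻¹ := rfl
  have hNt : BlockTriangular N OrderDual.toDual := fun i j hij => LDL.lowerInv_triangular hA hij
  have hMt : BlockTriangular M OrderDual.toDual := by
    rw [hMN]; exact Matrix.blockTriangular_inv_of_blockTriangular hNt
  have hMd : M.det ≠ 0 := by
    have : IsUnit M.det := by
      rw [hMN]; exact Matrix.isUnit_nonsing_inv_det N ((Matrix.isUnit_iff_isUnit_det N).1 hNu)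
    exact this.ne_zero
  have hMii : ∀ i, M i i ≠ 0 := by
    rw [Matrix.det_of_isLowerTriangular M hMt] at hMd
    intro i
    exact Finset.prod_ne_zero_iff.1 hMd i (Finset.mem_univ i)
  -- This is √D M' from A = M D M'. Of the diagonal of M only nonvanishing has been established, so
  -- each row is multiplied by the sign of M_ii: the diagonal becomes positive, and the signs square
  -- to one in the product.
  refine ⟨Matrix.of fun i j => SignType.sign (M i i) * √(d i) * M j i, ?_, ?_, ?_⟩
  · intro i j hij
    simp only [Matrix.of_apply]
    rw [hMt (show OrderDual.toDual i < OrderDual.toDual j from hij), mul_zero]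
  · intro i
    simp only [Matrix.of_apply]
    rw [mul_right_comm, sign_mul_self]
    exact mul_pos (abs_pos.2 (hMii i)) (Real.sqrt_pos.2 (hd i))
  · rw [← hLDL]
    ext i j
    have hs : ∀ l, ((SignType.sign (M l l) : SignType) : ℝ) * (SignType.sign (M l l) : SignType) = 1 := by
      intro l
      rcases lt_or_gt_of_ne (hMii l) with h | h <;> simp [h]
    rw [LDL.diag, Matrix.mul_apply, Matrix.mul_apply]
    simp only [Matrix.transpose_apply, Matrix.of_apply,
      Matrix.conjTranspose_apply, star_trivial, Matrix.mul_diagonal]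
    refine Finset.sum_congr rfl fun l _ => ?_
    have := Real.mul_self_sqrt (hd l).le
    calc _ = (((SignType.sign (M l l) : SignType) : ℝ) * (SignType.sign (M l l) : SignType)) *
        (√(d l) * √(d l)) * (M i l * M j l) := by ring
      _ = _ := by rw [hs, this]; ring

theorem uchol_spec {q : ℕ} {A : Mat q} (hA : A.PosDef) : IsCholesky A (uchol A) := by
  unfold uchol
  rw [dif_pos (exists_isCholesky hA)]
  exact (exists_isCholesky hA).choose_spec

theorem uchol_of_not_posDef {q : ℕ} {A : Mat q} (hA : ¬ A.PosDef) : uchol A = 0 := by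
  unfold uchol
  rw [dif_neg]
  rintro ⟨R, hR⟩
  exact hA hR.posDef

/-- Upper-triangular matrices with positive diagonal. -/
def upperPos (q : ℕ) : Set (Mat q) := {R | (∀ i j, j < i → R i j = 0) ∧ ∀ i, 0 < R i i}

theorem measurableSet_upperPos (q : ℕ) : MeasurableSet (upperPos q) := by
  have : upperPos q = (⋂ i, ⋂ j, ⋂ _ : j < i, {R : Mat q | R i j = 0}) ∩
      ⋂ i, {R : Mat q | 0 < R i i} := by
    ext R; simp [upperPos]
  rw [this]
  refine MeasurableSet.inter ?_ ?_
  · exact MeasurableSet.iInter fun i => MeasurableSet.iInter fun j => MeasurableSet.iInter fun _ =>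
      (measurable_entry i j) (measurableSet_singleton 0)
  · exact MeasurableSet.iInter fun i => (measurable_entry i i) measurableSet_Ioi

theorem isCholesky_of_mem_upperPos {q : ℕ} {R : Mat q} (h : R ∈ upperPos q) :
    IsCholesky (Rᵀ * R) R := ⟨h.1, h.2, rfl⟩

/-- By the Lusin–Souslin theorem an injective measurable map on a standard Borel space is a
measurable embedding, and injectivity is the uniqueness of the Cholesky factor. The range is the
positive-definite cone and the inverse is `uchol`, so both become measurable without explicit
formulas. -/
theorem measurableEmbedding_gram (q : ℕ) :
    MeasurableEmbedding fun R : upperPos q => (R : Mat q)ᵀ * (R : Mat q) := by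
  have : StandardBorelSpace (upperPos q) := (measurableSet_upperPos q).standardBorel
  refine Measurable.measurableEmbedding ?_ ?_
  · have : Continuous fun R : Mat q => Rᵀ * R := by fun_prop
    exact this.measurable.comp measurable_subtype_coe
  · intro R R' h
    have h1 := isCholesky_of_mem_upperPos R.2
    have h2 := isCholesky_of_mem_upperPos R'.2
    dsimp only at h
    rw [h] at h1
    exact Subtype.ext (h1.unique h2)

theorem range_gram (q : ℕ) :
    Set.range (fun R : upperPos q => (R : Mat q)ᵀ * (R : Mat q)) = {A | A.PosDef} := by
  ext A
  constructor
  · rintro ⟨R, rfl⟩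
    exact (isCholesky_of_mem_upperPos R.2).posDef
  · intro hA
    exact ⟨⟨uchol A, (uchol_spec hA).1, (uchol_spec hA).2.1⟩, (uchol_spec hA).2.2⟩

theorem measurableSet_posDef (q : ℕ) : MeasurableSet {A : Mat q | A.PosDef} := by
  rw [← range_gram]
  exact (measurableEmbedding_gram q).measurableSet_range

theorem measurable_uchol {q : ℕ} : Measurable (uchol : Mat q → Mat q) := by
  have h := (measurableEmbedding_gram q).measurable_extend
    (g := fun R : upperPos q => (R : Mat q)) (g' := fun _ => 0) measurable_subtype_coe
    measurable_const
  convert h using 1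
  ext1 A
  by_cases hA : A.PosDef
  · have hR : (⟨uchol A, (uchol_spec hA).1, (uchol_spec hA).2.1⟩ : upperPos q).1ᵀ *
      (⟨uchol A, (uchol_spec hA).1, (uchol_spec hA).2.1⟩ : upperPos q).1 = A := (uchol_spec hA).2.2
    conv_rhs => rw [← hR]
    rw [(measurableEmbedding_gram q).injective.extend_apply]
  · rw [uchol_of_not_posDef hA, Function.extend_apply']
    rintro ⟨R, hR⟩
    exact hA (hR ▸ (isCholesky_of_mem_upperPos R.2).posDef)

theorem isClosed_posSemidef (q : ℕ) : IsClosed {A : Mat q | A.PosSemidef} := by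
  simp only [Matrix.posSemidef_iff_dotProduct_mulVec, Set.ofPred_and, Set.ofPred_forall,
    Matrix.IsHermitian, Matrix.conjTranspose_eq_transpose_of_trivial]
  refine IsClosed.inter (isClosed_eq (by fun_prop) continuous_id) (isClosed_iInter fun x => ?_)
  exact isClosed_le continuous_const (by fun_prop)

theorem measurableSet_posSemidef (q : ℕ) : MeasurableSet {A : Mat q | A.PosSemidef} :=
  (isClosed_posSemidef q).measurableSet

end VolatilityProcess

namespace VolatilityProcess

/-! ### Lebesgue measure on symmetric matrices and congruences -/

/-- Coordinates on the space of symmetric matrices. -/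
abbrev UpperCoord (q : ℕ) : Type := {p : Fin q × Fin q // p.1 ≤ p.2} → ℝ

/-- The entries on and above the diagonal. -/
def upperOf {q : ℕ} (A : Mat q) : UpperCoord q := fun p => A p.1.1 p.1.2

theorem symOfUpper_apply_of_le {q : ℕ} (v : UpperCoord q) {i j : Fin q} (h : i ≤ j) :
    symOfUpper v i j = v ⟨(i, j), h⟩ := by
  simp [symOfUpper, h]

theorem symOfUpper_apply_comm {q : ℕ} (v : UpperCoord q) (i j : Fin q) :
    symOfUpper v i j = symOfUpper v j i := by
  rcases lt_trichotomy i j with h | h | h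
  · simp [symOfUpper, h.le, not_le.2 h]
  · rw [h]
  · simp [symOfUpper, h.le, not_le.2 h]

theorem symOfUpper_transpose {q : ℕ} (v : UpperCoord q) : (symOfUpper v)ᵀ = symOfUpper v := by
  ext i j; exact symOfUpper_apply_comm v j i

theorem upperOf_symOfUpper {q : ℕ} (v : UpperCoord q) : upperOf (symOfUpper v) = v := by
  ext p; exact symOfUpper_apply_of_le v p.2

theorem symOfUpper_upperOf {q : ℕ} {A : Mat q} (hA : Aᵀ = A) : symOfUpper (upperOf A) = A := by
  ext i j
  rcases le_total i j with h | h
  · rw [symOfUpper_apply_of_le _ h]; rfl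
  · rw [symOfUpper_apply_comm, symOfUpper_apply_of_le _ h]
    exact congrFun (congrFun hA i) j

theorem measurable_symOfUpper {q : ℕ} : Measurable (symOfUpper : UpperCoord q → Mat q) := by
  refine measurable_mat fun i j => ?_
  rcases le_total i j with h | h
  · simp only [symOfUpper_apply_of_le _ h]; exact measurable_pi_apply _
  · simp only [symOfUpper_apply_comm _ i j, symOfUpper_apply_of_le _ h]; exact measurable_pi_apply _

/-- `A ↦ L A L'` in coordinates. -/
def congruence {q : ℕ} (L : Mat q) : UpperCoord q →ₗ[ℝ] UpperCoord q where
  toFun v := upperOf (L * symOfUpper v * Lᵀ)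
  map_add' v w := by
    have : symOfUpper (v + w) = symOfUpper v + symOfUpper w := by
      ext i j
      rcases le_total i j with h | h
      · simp [symOfUpper_apply_of_le _ h]
      · simp [symOfUpper_apply_comm _ i j, symOfUpper_apply_of_le _ h]
    rw [this, mul_add, add_mul]; rfl
  map_smul' c v := by
    have : symOfUpper (c • v) = c • symOfUpper v := by
      ext i j
      rcases le_total i j with h | h
      · simp [symOfUpper_apply_of_le _ h]
      · simp [symOfUpper_apply_comm _ i j, symOfUpper_apply_of_le _ h]
    rw [this, Matrix.mul_smul, Matrix.smul_mul]; rfl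

theorem congruence_apply {q : ℕ} (L : Mat q) (v : UpperCoord q) :
    congruence L v = upperOf (L * symOfUpper v * Lᵀ) := rfl

theorem symOfUpper_congruence {q : ℕ} (L : Mat q) (v : UpperCoord q) :
    symOfUpper (congruence L v) = L * symOfUpper v * Lᵀ := by
  rw [congruence_apply, symOfUpper_upperOf]
  simp [Matrix.transpose_mul, symOfUpper_transpose, Matrix.mul_assoc]

theorem congruence_mul {q : ℕ} (L M : Mat q) :
    congruence (L * M) = congruence L ∘ₗ congruence M := by
  refine LinearMap.ext fun v => ?_
  rw [LinearMap.comp_apply, congruence_apply L, symOfUpper_congruence, congruence_apply]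
  simp [Matrix.transpose_mul, Matrix.mul_assoc]

theorem det_congruence_mul {q : ℕ} (L M : Mat q) :
    LinearMap.det (congruence (L * M)) =
      LinearMap.det (congruence L) * LinearMap.det (congruence M) := by
  rw [congruence_mul, LinearMap.det_comp]

theorem det_congruence_one {q : ℕ} : LinearMap.det (congruence (1 : Mat q)) = 1 := by
  have : congruence (1 : Mat q) = LinearMap.id := by
    refine LinearMap.ext fun v => ?_
    simp [congruence_apply, upperOf_symOfUpper]
  rw [this, LinearMap.det_id]

/-- The index i is the first coordinate of q - i pairs and the second coordinate of i + 1 pairs,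
hence contributes q + 1 factors in all. -/
theorem prod_upper {q : ℕ} (d : Fin q → ℝ) :
    ∏ p : {p : Fin q × Fin q // p.1 ≤ p.2}, d p.1.1 * d p.1.2 = (∏ i, d i) ^ (q + 1) := by
  have h1 : ∏ p : {p : Fin q × Fin q // p.1 ≤ p.2}, d p.1.1 * d p.1.2 =
      ∏ p : Fin q × Fin q, if p.1 ≤ p.2 then d p.1 * d p.2 else 1 := by
    rw [← Finset.prod_filter]
    exact (Finset.prod_subtype _ (by simp) (fun p : Fin q × Fin q => d p.1 * d p.2)).symm
  have h2 : ∀ p : Fin q × Fin q, (if p.1 ≤ p.2 then d p.1 * d p.2 else 1) =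
      (if p.1 ≤ p.2 then d p.1 else 1) * (if p.1 ≤ p.2 then d p.2 else 1) := by
    intro p; split_ifs <;> simp
  rw [h1, Finset.prod_congr rfl fun p _ => h2 p, Finset.prod_mul_distrib,
    Fintype.prod_prod_type, Fintype.prod_prod_type_right, ← Finset.prod_pow,
    ← Finset.prod_mul_distrib]
  refine Finset.prod_congr rfl fun i _ => ?_
  simp only [Finset.prod_ite, Finset.prod_const, one_pow, mul_one]
  rw [← pow_add]
  congr 1
  have e1 : (Finset.univ.filter fun j : Fin q => i ≤ j) = Finset.Ici i := by ext; simp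
  have e2 : (Finset.univ.filter fun j : Fin q => j ≤ i) = Finset.Iic i := by ext; simp
  rw [e1, e2, Fin.card_Ici, Fin.card_Iic]
  omega

theorem det_congruence_diagonal {q : ℕ} (d : Fin q → ℝ) :
    LinearMap.det (congruence (Matrix.diagonal d)) = (∏ i, d i) ^ (q + 1) := by
  have : congruence (Matrix.diagonal d) =
      Matrix.toLin' (Matrix.diagonal fun p : {p : Fin q × Fin q // p.1 ≤ p.2} =>
        d p.1.1 * d p.1.2) := by
    refine LinearMap.ext fun v => ?_
    ext p
    rw [congruence_apply, Matrix.toLin'_apply, Matrix.mulVec_diagonal]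
    simp only [upperOf, Matrix.diagonal_transpose, Matrix.mul_diagonal, Matrix.diagonal_mul,
      symOfUpper_apply_of_le _ p.2]
    ring
  rw [this, LinearMap.det_toLin', Matrix.det_diagonal, prod_upper]

theorem det_congruence_ne_zero {q : ℕ} {L : Mat q} (hL : IsUnit L.det) :
    LinearMap.det (congruence L) ≠ 0 := by
  have := det_congruence_mul L L⁻¹
  rw [Matrix.mul_nonsing_inv _ hL, det_congruence_one] at this
  intro h
  rw [h, zero_mul] at this
  exact one_ne_zero this

/-- If D is diagonal with 2 in position i and 1 elsewhere, then D T = T² D for the transvection T.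
By multiplicativity the determinant x attached to T satisfies x = x², and x ≠ 0, so x = 1; no
ordering of the coordinates is needed. -/
theorem det_congruence_transvection {q : ℕ} {i j : Fin q} (hij : i ≠ j) (c : ℝ) :
    LinearMap.det (congruence (Matrix.transvection i j c)) = 1 := by
  set d : Fin q → ℝ := fun l => if l = i then 2 else 1 with hd
  have hd0 : ∀ l, d l ≠ 0 := by intro l; simp only [hd]; split_ifs <;> norm_num
  have hconj : Matrix.diagonal d * Matrix.transvection i j c =
      Matrix.transvection i j c * Matrix.transvection i j c * Matrix.diagonal d := by
    rw [Matrix.transvection_mul_transvection_same _ _ hij]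
    ext a b
    simp only [Matrix.transvection, Matrix.add_apply,
      Matrix.diagonal_mul, Matrix.mul_diagonal, Matrix.single_apply]
    by_cases hab : a = b
    · subst hab
      have h : ¬ (i = a ∧ j = a) := fun h => hij (h.1.trans h.2.symm)
      simp [h]
    · rw [Matrix.one_apply_ne hab]
      by_cases h : i = a ∧ j = b
      · obtain ⟨rfl, rfl⟩ := h
        simp [hd, hij.symm]; ring
      · simp [h]
  have h := congrArg (fun M => LinearMap.det (congruence M)) hconj
  simp only [det_congruence_mul] at h
  have h1 : LinearMap.det (congruence (Matrix.transvection i j c)) ≠ 0 :=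
    det_congruence_ne_zero (by rw [Matrix.det_transvection_of_ne _ _ hij]; exact isUnit_one)
  have h2 : LinearMap.det (congruence (Matrix.diagonal d)) ≠ 0 :=
    det_congruence_ne_zero (by
      rw [Matrix.det_diagonal]; exact (Finset.prod_ne_zero_iff.2 fun l _ => hd0 l).isUnit)
  have h3 : LinearMap.det (congruence (Matrix.diagonal d)) *
      LinearMap.det (congruence (Matrix.transvection i j c)) * 1 =
      LinearMap.det (congruence (Matrix.diagonal d)) *
      LinearMap.det (congruence (Matrix.transvection i j c)) *
      LinearMap.det (congruence (Matrix.transvection i j c)) := by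
    rw [mul_one]; linarith
  exact (mul_left_cancel₀ (mul_ne_zero h2 h1) h3).symm

/-- Both sides are multiplicative in L and agree on diagonal matrices and on transvections, and
these generate all invertible matrices. -/
theorem det_congruence {q : ℕ} {L : Mat q} (hL : L.det ≠ 0) :
    LinearMap.det (congruence L) = L.det ^ (q + 1) := by
  refine Matrix.diagonal_transvection_induction_of_det_ne_zero
    (fun M : Mat q => LinearMap.det (congruence M) = M.det ^ (q + 1)) L hL ?_ ?_ ?_
  · intro D _
    rw [det_congruence_diagonal, Matrix.det_diagonal]
  · intro t
    rw [Matrix.TransvectionStruct.det, one_pow]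
    exact det_congruence_transvection t.hij t.c
  · intro A B _ _ hA hB
    rw [det_congruence_mul, hA, hB, Matrix.det_mul, mul_pow]

theorem map_congruence_symLebesgue {q : ℕ} {L : Mat q} (hL : L.det ≠ 0) :
    (symLebesgue q).map (fun A => L * A * Lᵀ) =
      ENNReal.ofReal (|L.det| ^ (q + 1))⁻¹ • symLebesgue q := by
  have hm : Measurable fun A : Mat q => L * A * Lᵀ :=
    (by fun_prop : Continuous fun A : Mat q => L * A * Lᵀ).measurable
  have hc : Measurable (congruence L) :=
    (LinearMap.continuous_of_finiteDimensional (congruence L)).measurable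
  have hcomp : (fun A : Mat q => L * A * Lᵀ) ∘ symOfUpper = symOfUpper ∘ congruence L := by
    ext1 v; exact (symOfUpper_congruence L v).symm
  have hdet : LinearMap.det (congruence L) ≠ 0 := det_congruence_ne_zero hL.isUnit
  rw [symLebesgue, Measure.map_map hm measurable_symOfUpper, hcomp,
    ← Measure.map_map measurable_symOfUpper hc,
    Measure.map_linearMap_addHaar_eq_smul_addHaar volume hdet, Measure.map_smul,
    det_congruence hL, abs_inv, abs_pow]

end VolatilityProcess

namespace VolatilityProcess

open scoped ENNReal

/-! ### Peeling off the first row of a symmetric matrix -/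

/-- The symmetric matrix with first row `(a, b)` and lower right block `C`. -/
def bordered {q : ℕ} (a : ℝ) (b : Fin q → ℝ) (C : Mat q) : Mat (q + 1) :=
  Matrix.of (Fin.cons (Fin.cons a b : Fin (q + 1) → ℝ)
    (fun i => (Fin.cons (b i) (C i) : Fin (q + 1) → ℝ)))

section bordered

variable {q : ℕ} (a : ℝ) (b : Fin q → ℝ) (C : Mat q) (i j : Fin q)

@[simp] theorem bordered_zero_zero : bordered a b C 0 0 = a := rfl
@[simp] theorem bordered_zero_succ : bordered a b C 0 j.succ = b j := rfl
@[simp] theorem bordered_succ_zero : bordered a b C i.succ 0 = b i := rfl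
@[simp] theorem bordered_succ_succ : bordered a b C i.succ j.succ = C i j := rfl

theorem trace_bordered : (bordered a b C).trace = a + C.trace := by
  simp [Matrix.trace, Fin.sum_univ_succ]

theorem det_bordered (ha : a ≠ 0) :
    (bordered a b C).det = a * (C - a⁻¹ • vecMulVec b b).det := by
  -- The first row and column are moved to the last block because the Schur complement formula used
  -- below eliminates the lower right block.
  let e : Fin q ⊕ Unit ≃ Fin (q + 1) :=
    (Equiv.optionEquivSumPUnit (Fin q)).symm.trans (finSuccEquiv q).symm
  have he1 : ∀ i, e (Sum.inl i) = i.succ := fun i => by simp [e]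
  have he2 : ∀ u, e (Sum.inr u) = 0 := fun u => by simp [e]
  rw [← Matrix.det_submatrix_equiv_self e]
  have hb : (bordered a b C).submatrix e e =
      fromBlocks C (replicateCol Unit b) (replicateRow Unit b) (Matrix.diagonal fun _ => a) := by
    ext x y
    rcases x with x | x <;> rcases y with y | y <;> simp [he1, he2]
  have hu : IsUnit (Matrix.diagonal fun _ : Unit => a) := by
    rw [Matrix.isUnit_iff_isUnit_det]; simpa using ha
  let _ := hu.invertible
  rw [hb, Matrix.det_fromBlocks₂₂, Matrix.invOf_eq_nonsing_inv]
  congr 1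
  · simp
  · congr 2
    ext x y
    simp [Matrix.mul_apply, vecMulVec_apply, Ring.inverse_eq_inv']
    ring

/-- Completing the square in t; the remainder is the quadratic form of the Schur complement. -/
theorem dotProduct_bordered (ha : a ≠ 0) (t : ℝ) (w : Fin q → ℝ) :
    (Fin.cons t w : Fin (q + 1) → ℝ) ⬝ᵥ (bordered a b C *ᵥ (Fin.cons t w : Fin (q + 1) → ℝ)) =
      a * (t + a⁻¹ * (b ⬝ᵥ w)) ^ 2 + w ⬝ᵥ ((C - a⁻¹ • vecMulVec b b) *ᵥ w) := by
  have h1 : (Fin.cons t w : Fin (q + 1) → ℝ) ⬝ᵥ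
      (bordered a b C *ᵥ (Fin.cons t w : Fin (q + 1) → ℝ)) =
      a * t ^ 2 + 2 * t * (b ⬝ᵥ w) + w ⬝ᵥ (C *ᵥ w) := by
    have : ∀ i : Fin q, (bordered a b C *ᵥ (Fin.cons t w : Fin (q + 1) → ℝ)) i.succ =
        b i * t + (C *ᵥ w) i := fun i => by
      simp [Matrix.mulVec, dotProduct, Fin.sum_univ_succ]
    rw [dotProduct, Fin.sum_univ_succ]
    simp only [this, Fin.cons_zero, Fin.cons_succ, mul_add, Finset.sum_add_distrib]
    have h0 : (bordered a b C *ᵥ (Fin.cons t w : Fin (q + 1) → ℝ)) 0 = a * t + b ⬝ᵥ w := by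
      simp [Matrix.mulVec, dotProduct, Fin.sum_univ_succ]
    rw [h0]
    have h2 : ∑ i, w i * (b i * t) = t * (b ⬝ᵥ w) := by
      rw [dotProduct, Finset.mul_sum]; exact Finset.sum_congr rfl fun i _ => by ring
    rw [h2, dotProduct, dotProduct]; ring
  rw [h1, Matrix.sub_mulVec, dotProduct_sub, Matrix.smul_mulVec, dotProduct_smul,
    vecMulVec_mulVec]
  have : w ⬝ᵥ (MulOpposite.op (b ⬝ᵥ w) • b) = (b ⬝ᵥ w) ^ 2 := by
    rw [dotProduct_smul, dotProduct_comm w b]; simp [sq]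
  rw [this, smul_eq_mul]
  field_simp
  ring

theorem posDef_bordered_iff :
    (bordered a b C).PosDef ↔ 0 < a ∧ (C - a⁻¹ • vecMulVec b b).PosDef := by
  have hsym : (bordered a b C).IsHermitian ↔ (C - a⁻¹ • vecMulVec b b).IsHermitian := by
    have hv : (a⁻¹ • vecMulVec b b).IsHermitian := by
      ext i j; simp [vecMulVec_apply, mul_comm]
    constructor
    · intro h
      refine Matrix.IsHermitian.sub ?_ hv
      ext i j
      simpa using congrFun (congrFun h i.succ) j.succ
    · intro h
      have hC : C.IsHermitian := by simpa using h.add hv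
      ext i j
      refine Fin.cases ?_ (fun i => ?_) i <;> refine Fin.cases ?_ (fun j => ?_) j
      · simp
      · simp
      · simp
      · simpa using congrFun (congrFun hC i) j
  constructor
  · intro h
    have ha : 0 < a := by simpa using h.diag_pos (i := 0)
    refine ⟨ha, Matrix.PosDef.of_dotProduct_mulVec_pos (hsym.1 h.isHermitian) fun w hw => ?_⟩
    -- This first coordinate makes the completed square vanish, which leaves the Schur complement
    -- alone.
    have := h.dotProduct_mulVec_pos (x := (Fin.cons (-(a⁻¹ * (b ⬝ᵥ w))) w : Fin (q + 1) → ℝ))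
      (fun h0 => hw (by ext i; simpa using congrFun h0 i.succ))
    rw [star_trivial, dotProduct_bordered _ _ _ ha.ne'] at this
    simpa using this
  · rintro ⟨ha, h⟩
    refine Matrix.PosDef.of_dotProduct_mulVec_pos (hsym.2 h.isHermitian) fun x hx => ?_
    obtain ⟨t, w, rfl⟩ : ∃ t w, x = (Fin.cons t w : Fin (q + 1) → ℝ) :=
      ⟨x 0, Fin.tail x, (Fin.cons_self_tail x).symm⟩
    rw [star_trivial, dotProduct_bordered _ _ _ ha.ne']
    by_cases hw : w = 0
    · subst hw
      have ht : t ≠ 0 := by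
        rintro rfl
        exact hx (by ext i; refine Fin.cases ?_ (fun i => ?_) i <;> simp)
      simp only [dotProduct_zero, mul_zero, add_zero, Matrix.mulVec_zero]
      positivity
    · have := h.dotProduct_mulVec_pos hw
      rw [star_trivial] at this
      positivity

end bordered

/-- Index set of the upper triangle, first row split off. -/
noncomputable def upperIndexSucc (q : ℕ) :
    Unit ⊕ (Fin q ⊕ {p : Fin q × Fin q // p.1 ≤ p.2}) ≃
      {p : Fin (q + 1) × Fin (q + 1) // p.1 ≤ p.2} :=
  Equiv.ofBijective
    (Sum.elim (fun _ => ⟨(0, 0), le_rfl⟩)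
      (Sum.elim (fun j => ⟨(0, j.succ), Fin.zero_le _⟩)
        (fun p => ⟨(p.1.1.succ, p.1.2.succ), Fin.succ_le_succ_iff.2 p.2⟩))) (by
    constructor
    · rintro (_ | i | ⟨⟨i, j⟩, hp⟩) (_ | i' | ⟨⟨i', j'⟩, hp'⟩) h <;>
        simp_all [Fin.ext_iff]
    · rintro ⟨⟨i, j⟩, h⟩
      induction i using Fin.cases with
      | zero =>
        induction j using Fin.cases with
        | zero => exact ⟨Sum.inl (), rfl⟩
        | succ j => exact ⟨Sum.inr (Sum.inl j), rfl⟩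
      | succ i =>
        induction j using Fin.cases with
        | zero => exact absurd h (by simp)
        | succ j => exact ⟨Sum.inr (Sum.inr ⟨(i, j), Fin.succ_le_succ_iff.1 h⟩), rfl⟩)

/-- Coordinates of a bordered matrix. -/
noncomputable def borderedCoord (q : ℕ) : ℝ × (Fin q → ℝ) × UpperCoord q ≃ᵐ UpperCoord (q + 1) :=
  (((MeasurableEquiv.funUnique Unit ℝ).symm.prodCongr
      (MeasurableEquiv.sumPiEquivProdPi
        (fun _ : Fin q ⊕ {p : Fin q × Fin q // p.1 ≤ p.2} => ℝ)).symm).trans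
    (MeasurableEquiv.sumPiEquivProdPi
      (fun _ : Unit ⊕ (Fin q ⊕ {p : Fin q × Fin q // p.1 ≤ p.2}) => ℝ)).symm).trans
    (MeasurableEquiv.piCongrLeft (fun _ => ℝ) (upperIndexSucc q))

theorem measurePreserving_borderedCoord (q : ℕ) : MeasurePreserving (borderedCoord q) := by
  refine MeasurePreserving.trans (MeasurePreserving.trans (MeasurePreserving.prod
    (volume_preserving_funUnique Unit ℝ).symm
    (volume_measurePreserving_sumPiEquivProdPi_symm _))
    (volume_measurePreserving_sumPiEquivProdPi_symm _))
    (volume_measurePreserving_piCongrLeft _ _)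

theorem symOfUpper_borderedCoord {q : ℕ} (a : ℝ) (b : Fin q → ℝ) (v : UpperCoord q) :
    symOfUpper (borderedCoord q (a, b, v)) = bordered a b (symOfUpper v) := by
  have key : ∀ x, borderedCoord q (a, b, v) (upperIndexSucc q x) =
      Sum.elim (fun _ => a) (Sum.elim b v) x := by
    intro x
    have : borderedCoord q (a, b, v) (upperIndexSucc q x) =
        (Equiv.piCongrLeft (fun _ => ℝ) (upperIndexSucc q))
          (Sum.elim (fun _ => a) (Sum.elim b v)) (upperIndexSucc q x) := by
      rw [Equiv.piCongrLeft_apply_apply]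
      simp only [borderedCoord, MeasurableEquiv.trans_apply]
      rw [MeasurableEquiv.coe_piCongrLeft, Equiv.piCongrLeft_apply_apply]
      rcases x with _ | _ | _ <;> rfl
    rw [this, Equiv.piCongrLeft_apply_apply]
  have h00 : symOfUpper (borderedCoord q (a, b, v)) 0 0 = a := by
    rw [symOfUpper_apply_of_le _ le_rfl]; exact key (Sum.inl ())
  have h0s : ∀ j : Fin q, symOfUpper (borderedCoord q (a, b, v)) 0 j.succ = b j := fun j => by
    rw [symOfUpper_apply_of_le _ (Fin.zero_le _)]; exact key (Sum.inr (Sum.inl j))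
  have hss : ∀ i j : Fin q, i ≤ j → symOfUpper (borderedCoord q (a, b, v)) i.succ j.succ =
      symOfUpper v i j := fun i j h => by
    rw [symOfUpper_apply_of_le _ (Fin.succ_le_succ_iff.2 h), symOfUpper_apply_of_le _ h]
    exact key (Sum.inr (Sum.inr ⟨(i, j), h⟩))
  ext i j
  refine Fin.cases ?_ (fun i => ?_) i <;> refine Fin.cases ?_ (fun j => ?_) j
  · exact h00
  · exact h0s j
  · rw [symOfUpper_apply_comm]; exact h0s i
  · rcases le_total i j with h | h
    · exact hss i j h
    · rw [symOfUpper_apply_comm, hss j i h, symOfUpper_apply_comm]; rfl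

theorem lintegral_symLebesgue {q : ℕ} {f : Mat q → ℝ≥0∞} (hf : Measurable f) :
    ∫⁻ A, f A ∂symLebesgue q = ∫⁻ v, f (symOfUpper v) :=
  lintegral_map hf measurable_symOfUpper

/-- Translation invariance of Lebesgue measure in coordinates. It is used with S = a⁻¹bb', to
integrate over the Schur complement instead of the lower right block. -/
theorem lintegral_symLebesgue_add {q : ℕ} {f : Mat q → ℝ≥0∞} (hf : Measurable f) {S : Mat q}
    (hS : Sᵀ = S) : ∫⁻ A, f (A + S) ∂symLebesgue q = ∫⁻ A, f A ∂symLebesgue q := by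
  have hm : Measurable fun A : Mat q => A + S :=
    (by fun_prop : Continuous fun A : Mat q => A + S).measurable
  have hfm : Measurable fun A : Mat q => f (A + S) := hf.comp hm
  rw [lintegral_symLebesgue hf, lintegral_symLebesgue hfm]
  refine Eq.trans (lintegral_congr fun v => congrArg f ?_)
    (lintegral_add_right_eq_self (μ := volume) (fun v => f (symOfUpper v)) (upperOf S))
  ext i j
  rcases le_total i j with h | h
  · simp [symOfUpper_apply_of_le _ h, upperOf]
  · have : S i j = S j i := congrFun (congrFun hS j) i
    simp [symOfUpper_apply_comm _ i j, symOfUpper_apply_of_le _ h, upperOf, this]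

theorem measurable_bordered {q : ℕ} :
    Measurable fun p : ℝ × (Fin q → ℝ) × Mat q => bordered p.1 p.2.1 p.2.2 := by
  refine measurable_mat fun i j => ?_
  refine Fin.cases ?_ (fun i => ?_) i <;> refine Fin.cases ?_ (fun j => ?_) j
  · exact measurable_fst
  · exact (measurable_pi_apply j).comp (measurable_fst.comp measurable_snd)
  · exact (measurable_pi_apply i).comp (measurable_fst.comp measurable_snd)
  · exact (measurable_entry i j).comp (measurable_snd.comp measurable_snd)

theorem lintegral_symLebesgue_succ {q : ℕ} {f : Mat (q + 1) → ℝ≥0∞} (hf : Measurable f) :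
    ∫⁻ A, f A ∂symLebesgue (q + 1) =
      ∫⁻ a : ℝ, ∫⁻ b : Fin q → ℝ, ∫⁻ C, f (bordered a b C) ∂symLebesgue q := by
  have hfm : Measurable fun v : UpperCoord (q + 1) => f (symOfUpper v) :=
    hf.comp measurable_symOfUpper
  rw [lintegral_symLebesgue hf, ← (measurePreserving_borderedCoord q).lintegral_comp hfm]
  have hm : Measurable fun p : ℝ × (Fin q → ℝ) × UpperCoord q =>
      f (symOfUpper (borderedCoord q p)) :=
    (hf.comp measurable_symOfUpper).comp (borderedCoord q).measurable
  rw [Measure.volume_eq_prod, lintegral_prod _ hm.aemeasurable]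
  refine lintegral_congr fun a => ?_
  have hm2 : Measurable fun p : (Fin q → ℝ) × UpperCoord q =>
      f (symOfUpper (borderedCoord q (a, p))) := hm.comp measurable_prodMk_left
  rw [Measure.volume_eq_prod, lintegral_prod _ hm2.aemeasurable]
  refine lintegral_congr fun b => ?_
  have hm3 : Measurable fun C : Mat q => f (bordered a b C) :=
    hf.comp (measurable_bordered.comp (measurable_prodMk_left.comp measurable_prodMk_left))
  rw [lintegral_symLebesgue hm3]
  exact lintegral_congr fun v => by rw [symOfUpper_borderedCoord]

end VolatilityProcess

namespace VolatilityProcess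

open scoped ENNReal

/-! ### The multivariate gamma integral -/

open Classical in
/-- The unnormalised Wishart density with identity scale matrix. -/
noncomputable def detExp {q : ℕ} (α : ℝ) (A : Mat q) : ℝ≥0∞ :=
  if A.PosDef then ENNReal.ofReal (A.det ^ α * Real.exp (-(1 / 2) * A.trace)) else 0

theorem measurable_det {q : ℕ} : Measurable fun A : Mat q => A.det :=
  (continuous_id.matrix_det).measurable

theorem measurable_trace {q : ℕ} : Measurable fun A : Mat q => A.trace :=
  (continuous_id.matrix_trace).measurable

theorem measurable_detExp {q : ℕ} (α : ℝ) : Measurable (detExp α : Mat q → ℝ≥0∞) :=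
  Measurable.ite (measurableSet_posDef q)
    (((measurable_det.pow_const α).mul ((measurable_trace.const_mul _).exp)).ennreal_ofReal)
    measurable_const

/-- In terms of a, b and the Schur complement C the determinant is a det C and the trace is a +
|b|²/a + tr C. The three variables therefore separate, with the same exponent α for C; this is one
step of the Bartlett decomposition. -/
theorem detExp_bordered {q : ℕ} (α : ℝ) {a : ℝ} (ha : 0 < a) (b : Fin q → ℝ) (C : Mat q) :
    detExp α (bordered a b (C + a⁻¹ • vecMulVec b b)) =
      ENNReal.ofReal (a ^ α * Real.exp (-a / 2)) *
        (ENNReal.ofReal (∏ i, Real.exp (-(1 / (2 * a)) * b i ^ 2)) * detExp α C) := by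
  unfold detExp
  rw [posDef_bordered_iff, add_sub_cancel_right]
  by_cases hC : C.PosDef
  · rw [if_pos ⟨ha, hC⟩, if_pos hC, det_bordered _ _ _ ha.ne', add_sub_cancel_right,
      Real.mul_rpow ha.le hC.det_pos.le, trace_bordered, Matrix.trace_add, Matrix.trace_smul,
      Matrix.trace_vecMulVec, ← ENNReal.ofReal_mul (Finset.prod_nonneg fun i _ => (Real.exp_pos _).le),
      ← ENNReal.ofReal_mul (by positivity), ← Real.exp_sum]
    congr 1
    have : Real.exp (-(1 / 2) * (a + (C.trace + a⁻¹ • (b ⬝ᵥ b)))) =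
        Real.exp (-a / 2) * (Real.exp (∑ i, -(1 / (2 * a)) * b i ^ 2) *
          Real.exp (-(1 / 2) * C.trace)) := by
      rw [← Real.exp_add, ← Real.exp_add]
      congr 1
      rw [← Finset.mul_sum, dotProduct, smul_eq_mul]
      simp only [sq]
      field_simp
      ring
    rw [this]; ring
  · rw [if_neg (fun h => hC h.2), if_neg hC, mul_zero, mul_zero]

theorem lintegral_prod_exp_neg_sq {q : ℕ} {c : ℝ} (hc : 0 < c) :
    ∫⁻ b : Fin q → ℝ, ENNReal.ofReal (∏ i, Real.exp (-c * b i ^ 2)) =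
      ENNReal.ofReal (√(Real.pi / c) ^ q) := by
  have hint : Integrable (fun x : ℝ => Real.exp (-c * x ^ 2)) := integrable_exp_neg_mul_sq hc
  rw [volume_pi, ← ofReal_integral_eq_lintegral_ofReal (Integrable.fintype_prod fun _ => hint)
    (Filter.Eventually.of_forall fun b => Finset.prod_nonneg fun i _ => (Real.exp_pos _).le)]
  rw [integral_fintype_prod_eq_pow (fun x : ℝ => Real.exp (-c * x ^ 2)), integral_gaussian,
    Fintype.card_fin]

/-- The Gaussian integral over b produces the factor √(2πa)^q. The choice g = 1 yields the recursion
for the normalising constant, and g(a) = a the first moment. -/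
theorem lintegral_detExp_succ {q : ℕ} (α : ℝ) {g : ℝ → ℝ≥0∞} (hg : Measurable g) :
    ∫⁻ A, g (A 0 0) * detExp α A ∂symLebesgue (q + 1) =
      (∫⁻ A, detExp α A ∂symLebesgue q) * ∫⁻ a in Set.Ioi (0 : ℝ),
        g a * ENNReal.ofReal (a ^ α * Real.exp (-a / 2) * √(2 * Real.pi * a) ^ q) := by
  have hm : Measurable fun A : Mat (q + 1) => g (A 0 0) * detExp α A :=
    (hg.comp (measurable_entry 0 0)).mul (measurable_detExp α)
  have hgm : Measurable fun a : ℝ =>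
      g a * ENNReal.ofReal (a ^ α * Real.exp (-a / 2) * √(2 * Real.pi * a) ^ q) := by fun_prop
  rw [lintegral_symLebesgue_succ hm, ← lintegral_const_mul _ hgm,
    ← lintegral_indicator measurableSet_Ioi]
  refine lintegral_congr fun a => ?_
  simp only [bordered_zero_zero]
  by_cases ha : 0 < a
  · rw [Set.indicator_of_mem (Set.mem_Ioi.2 ha)]
    have h1 : ∀ b : Fin q → ℝ, ∫⁻ C, g a * detExp α (bordered a b C) ∂symLebesgue q =
        g a * ENNReal.ofReal (a ^ α * Real.exp (-a / 2)) * (∫⁻ C, detExp α C ∂symLebesgue q) *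
        ENNReal.ofReal (∏ i, Real.exp (-(1 / (2 * a)) * b i ^ 2)) := by
      intro b
      have hb : (a⁻¹ • vecMulVec b b)ᵀ = a⁻¹ • vecMulVec b b := by
        ext i j; simp [vecMulVec_apply, mul_comm]
      have hm1 : Measurable fun C : Mat q => detExp α (bordered a b C) :=
        (measurable_detExp α).comp
          (measurable_bordered.comp (measurable_prodMk_left.comp measurable_prodMk_left))
      rw [lintegral_const_mul _ hm1, ← lintegral_symLebesgue_add hm1 hb]
      simp only [detExp_bordered α ha]
      rw [lintegral_const_mul _ ((measurable_detExp α).const_mul _),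
        lintegral_const_mul _ (measurable_detExp α)]
      ring
    simp only [h1]
    rw [lintegral_const_mul _ (by fun_prop), lintegral_prod_exp_neg_sq (by positivity),
      ENNReal.ofReal_mul (p := a ^ α * Real.exp (-a / 2)) (by positivity)]
    have : Real.pi / (1 / (2 * a)) = 2 * Real.pi * a := by field_simp
    rw [this]
    ring
  · rw [Set.indicator_of_notMem (by simpa using ha)]
    have : ∀ (b : Fin q → ℝ) (C : Mat q), detExp α (bordered a b C) = 0 := by
      intro b C
      unfold detExp
      rw [if_neg]
      rw [posDef_bordered_iff]
      exact fun h => ha h.1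
    simp [this]

theorem lintegral_rpow_mul_exp {c : ℝ} (hc : 0 < c) :
    ∫⁻ a in Set.Ioi (0 : ℝ), ENNReal.ofReal (a ^ (c - 1) * Real.exp (-(1 / 2 * a))) =
      ENNReal.ofReal (2 ^ c * Real.Gamma c) := by
  have h := Real.integral_rpow_mul_exp_neg_mul_Ioi hc (r := 1 / 2) (by norm_num)
  have hI : IntegrableOn (fun a : ℝ => a ^ (c - 1) * Real.exp (-(1 / 2 * a))) (Set.Ioi 0) := by
    -- A non-integrable function has integral 0 by convention, whereas the known value of the
    -- integral is positive; integrability thus follows from the formula.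
    by_contra hI
    rw [integral_undef hI] at h
    have : 0 < (1 / (1 / 2) : ℝ) ^ c * Real.Gamma c :=
      mul_pos (by positivity) (Real.Gamma_pos_of_pos hc)
    exact this.ne h
  rw [← ofReal_integral_eq_lintegral_ofReal hI, h]
  · norm_num
  · refine (ae_restrict_iff' measurableSet_Ioi).2 (Filter.Eventually.of_forall fun a ha => ?_)
    exact mul_nonneg (Real.rpow_nonneg (le_of_lt ha) _) (Real.exp_pos _).le

/-- The factor a^(q/2) from the Gaussian integral cancels the dependence of the exponent on q,
leaving a^(h/2 + s - 1): up to constants the first entry is chi-square with h degrees of freedom.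
The cases s = 0 and s = 1 give the mass and the mean. -/
theorem lintegral_chiSq_factor {q : ℕ} {h : ℝ} (s : ℝ) (hs : 0 < h / 2 + s) :
    ∫⁻ a in Set.Ioi (0 : ℝ), ENNReal.ofReal (a ^ s) * ENNReal.ofReal
        (a ^ ((h - (q + 1 : ℕ) - 1) / 2) * Real.exp (-a / 2) * √(2 * Real.pi * a) ^ q) =
      ENNReal.ofReal ((2 * Real.pi) ^ ((q : ℝ) / 2)) *
        ENNReal.ofReal (2 ^ (h / 2 + s) * Real.Gamma (h / 2 + s)) := by
  rw [← lintegral_rpow_mul_exp hs, ← lintegral_const_mul _ (by fun_prop)]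
  refine setLIntegral_congr_fun measurableSet_Ioi fun a ha => ?_
  have ha' : 0 < a := ha
  rw [← ENNReal.ofReal_mul (by positivity), ← ENNReal.ofReal_mul (by positivity)]
  congr 1
  have h1 : √(2 * Real.pi * a) ^ q = (2 * Real.pi) ^ ((q : ℝ) / 2) * a ^ ((q : ℝ) / 2) := by
    rw [Real.sqrt_eq_rpow, ← Real.rpow_natCast, ← Real.rpow_mul (by positivity),
      Real.mul_rpow (by positivity) ha'.le]
    congr 2 <;> ring
  have h2 : a ^ (h / 2 + s - 1) =
      a ^ s * (a ^ ((h - (q + 1 : ℕ) - 1) / 2) * a ^ ((q : ℝ) / 2)) := by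
    rw [← Real.rpow_add ha', ← Real.rpow_add ha']
    congr 1
    push_cast
    ring
  have h3 : -a / 2 = -(1 / 2 * a) := by ring
  rw [h1, h2, h3]
  ring

theorem multivariateGamma_pos {q : ℕ} {h : ℝ} (hh : (q : ℝ) - 1 < h) :
    0 < multivariateGamma q (h / 2) := by
  refine mul_pos (by positivity) (Finset.prod_pos fun j _ => Real.Gamma_pos_of_pos ?_)
  have : ((j : ℕ) : ℝ) + 1 ≤ q := by exact_mod_cast j.2
  linarith

theorem multivariateGamma_succ (q : ℕ) (h : ℝ) :
    multivariateGamma (q + 1) (h / 2) =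
      Real.pi ^ ((q : ℝ) / 2) * Real.Gamma (h / 2) * multivariateGamma q ((h - 1) / 2) := by
  unfold multivariateGamma
  rw [Fin.prod_univ_succ]
  have h1 : Real.pi ^ (((q + 1 : ℕ) : ℝ) * (((q + 1 : ℕ) : ℝ) - 1) / 4) =
      Real.pi ^ ((q : ℝ) / 2) * Real.pi ^ ((q : ℝ) * ((q : ℝ) - 1) / 4) := by
    rw [← Real.rpow_add Real.pi_pos]
    congr 1
    push_cast
    ring
  have h2 : ∀ i : Fin q, Real.Gamma (h / 2 - ((i.succ : Fin (q + 1)) : ℝ) / 2) =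
      Real.Gamma ((h - 1) / 2 - (i : ℝ) / 2) := by
    intro i
    congr 1
    simp only [Fin.val_succ]
    push_cast
    ring
  rw [h1, Finset.prod_congr rfl fun i _ => h2 i]
  simp only [Fin.val_zero, Nat.cast_zero, zero_div, sub_zero]
  ring

/-- Induction on q by peeling off the first row. The exponent is unchanged while the dimension drops
by one, so the remaining block has h - 1 degrees of freedom; for this reason h is quantified inside
the induction. -/
theorem lintegral_detExp {q : ℕ} : ∀ {h : ℝ}, (q : ℝ) - 1 < h →
    ∫⁻ A, detExp ((h - q - 1) / 2) A ∂symLebesgue q =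
      ENNReal.ofReal (2 ^ (h * q / 2) * multivariateGamma q (h / 2)) := by
  induction q with
  | zero =>
    intro h _
    have : ∀ A : Mat 0, detExp ((h - (0 : ℕ) - 1) / 2) A = 1 := by
      intro A
      unfold detExp
      rw [if_pos (Matrix.PosDef.of_dotProduct_mulVec_pos (Subsingleton.elim _ _)
        fun x hx => absurd (Subsingleton.elim x 0) hx)]
      simp
    simp only [this, lintegral_const, one_mul]
    rw [symLebesgue, Measure.map_apply measurable_symOfUpper MeasurableSet.univ, Set.preimage_univ]
    simp [multivariateGamma, volume_pi]
  | succ q ih =>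
    intro h hh
    push_cast at hh
    have h1 := lintegral_detExp_succ (q := q) ((h - (q + 1 : ℕ) - 1) / 2) (g := fun _ => 1)
      measurable_const
    simp only [one_mul] at h1
    have h2 := lintegral_chiSq_factor (q := q) (h := h) 0 (by
      have : (0 : ℝ) ≤ q := Nat.cast_nonneg q
      linarith)
    simp only [Real.rpow_zero, ENNReal.ofReal_one, one_mul, add_zero] at h2
    have h3 := ih (h := h - 1) (by linarith)
    have h4 : (h - 1 - q - 1) / 2 = (h - (q + 1 : ℕ) - 1) / 2 := by push_cast; ring
    have hg := multivariateGamma_pos (q := q) (h := h - 1) (by linarith)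
    rw [h4] at h3
    rw [h1, h2, h3, ← ENNReal.ofReal_mul (by positivity), ← ENNReal.ofReal_mul (by positivity),
      multivariateGamma_succ]
    congr 1
    have e1 : (2 : ℝ) ^ (h * (q + 1 : ℕ) / 2) =
        2 ^ ((h - 1) * q / 2) * (2 ^ ((q : ℝ) / 2) * 2 ^ (h / 2)) := by
      rw [← Real.rpow_add two_pos, ← Real.rpow_add two_pos]
      congr 1
      push_cast
      ring
    rw [e1, Real.mul_rpow two_pos.le Real.pi_pos.le]
    ring

end VolatilityProcess

namespace VolatilityProcess

open scoped ENNReal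

/-! ### Wishart distributions with a density -/

theorem wishart_of_lt {q : ℕ} {h : ℝ} (hh : (q : ℝ) - 1 < h) (S : Mat q) :
    wishart h S = (symLebesgue q).withDensity fun A => ENNReal.ofReal (wishartDensity h S A) :=
  if_pos hh

theorem measurable_wishartDensity {q : ℕ} (h : ℝ) (S : Mat q) :
    Measurable (wishartDensity h S : Mat q → ℝ) := by
  refine Measurable.ite (measurableSet_posDef q) ?_ measurable_const
  have : Measurable fun A : Mat q => (S⁻¹ * A).trace :=
    (by fun_prop : Continuous fun A : Mat q => (S⁻¹ * A).trace).measurable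
  exact ((measurable_det.pow_const _).const_mul _).mul (this.const_mul _).exp

theorem ofReal_wishartDensity_one {q : ℕ} {h : ℝ} (hh : (q : ℝ) - 1 < h) (A : Mat q) :
    ENNReal.ofReal (wishartDensity h 1 A) =
      ENNReal.ofReal (2 ^ (-(h * q / 2)) * (multivariateGamma q (h / 2))⁻¹) *
        detExp ((h - q - 1) / 2) A := by
  have hg := multivariateGamma_pos hh
  unfold wishartDensity detExp
  split_ifs with hA
  · rw [← ENNReal.ofReal_mul (by positivity)]
    congr 1
    simp only [Matrix.det_one, Real.one_rpow, mul_one, inv_one, one_mul]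
    ring
  · simp

theorem lintegral_wishart_one {q : ℕ} {h : ℝ} (hh : (q : ℝ) - 1 < h) {f : Mat q → ℝ≥0∞}
    (hf : Measurable f) :
    ∫⁻ A, f A ∂wishart h 1 =
      ENNReal.ofReal (2 ^ (-(h * q / 2)) * (multivariateGamma q (h / 2))⁻¹) *
        ∫⁻ A, f A * detExp ((h - q - 1) / 2) A ∂symLebesgue q := by
  have hfm : Measurable fun A => f A * detExp ((h - q - 1) / 2) A :=
    hf.mul (measurable_detExp _)
  rw [wishart_of_lt hh, lintegral_withDensity_eq_lintegral_mul _
    (measurable_wishartDensity h 1).ennreal_ofReal hf, ← lintegral_const_mul _ hfm]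
  refine lintegral_congr fun A => ?_
  rw [Pi.mul_apply, ofReal_wishartDensity_one hh]
  ring

theorem isProbabilityMeasure_wishart_one {q : ℕ} {h : ℝ} (hh : (q : ℝ) - 1 < h) :
    IsProbabilityMeasure (wishart h (1 : Mat q)) := by
  constructor
  have hg := multivariateGamma_pos hh
  have := lintegral_wishart_one hh (f := fun _ : Mat q => 1) measurable_const
  simp only [one_mul, lintegral_const] at this
  rw [this, lintegral_detExp hh, ← ENNReal.ofReal_mul (by positivity), Real.rpow_neg two_pos.le]
  rw [← ENNReal.ofReal_one]
  congr 1
  field_simp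

/-- The integral differs from the normalising one only by an extra power of a in the chi-square
factor, and the quotient is 2 Γ(h/2 + 1) / Γ(h/2) = h. -/
theorem lintegral_wishart_one_zero_zero {q : ℕ} {h : ℝ} (hh : ((q + 1 : ℕ) : ℝ) - 1 < h) :
    ∫⁻ A, ENNReal.ofReal (A 0 0) ∂wishart h (1 : Mat (q + 1)) = ENNReal.ofReal h := by
  have hh' : (q : ℝ) < h := by push_cast at hh; linarith
  have hq : (0 : ℝ) ≤ q := Nat.cast_nonneg q
  have hg := multivariateGamma_pos hh
  have hG := Real.Gamma_pos_of_pos (s := h / 2) (by linarith)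
  have h1 := lintegral_detExp_succ (q := q) ((h - (q + 1 : ℕ) - 1) / 2)
    (g := fun a => ENNReal.ofReal (a ^ (1 : ℝ))) (by fun_prop)
  have h0 := lintegral_detExp_succ (q := q) ((h - (q + 1 : ℕ) - 1) / 2) (g := fun _ => 1)
    measurable_const
  have c1 := lintegral_chiSq_factor (q := q) (h := h) 1 (by linarith)
  have c0 := lintegral_chiSq_factor (q := q) (h := h) 0 (by linarith)
  simp only [Real.rpow_zero, ENNReal.ofReal_one, one_mul, add_zero] at c0 h0
  have hfac : ENNReal.ofReal ((2 : ℝ) ^ (h / 2 + 1) * Real.Gamma (h / 2 + 1)) =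
      ENNReal.ofReal h * ENNReal.ofReal (2 ^ (h / 2) * Real.Gamma (h / 2)) := by
    rw [← ENNReal.ofReal_mul (by linarith), Real.Gamma_add_one (by linarith),
      Real.rpow_add two_pos]
    congr 1
    simp only [Real.rpow_one]
    ring
  have key : ∫⁻ A, ENNReal.ofReal (A 0 0) * detExp ((h - (q + 1 : ℕ) - 1) / 2) A
        ∂symLebesgue (q + 1) =
      ENNReal.ofReal h * ∫⁻ A, detExp ((h - (q + 1 : ℕ) - 1) / 2) A ∂symLebesgue (q + 1) := by
    simp only [Real.rpow_one] at h1 c1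
    rw [h1, c1, h0, c0, hfac]
    ring
  rw [lintegral_wishart_one hh (measurable_entry 0 0).ennreal_ofReal, key, lintegral_detExp hh,
    mul_left_comm, ← ENNReal.ofReal_mul (by positivity), Real.rpow_neg two_pos.le]
  conv_rhs => rw [← mul_one (ENNReal.ofReal h), ← ENNReal.ofReal_one]
  congr 2
  field_simp

theorem posDef_congr_iff {q : ℕ} {L : Mat q} (hL : L.det ≠ 0) (A : Mat q) :
    (L * A * Lᵀ).PosDef ↔ A.PosDef := by
  have := Matrix.IsUnit.posDef_star_right_conjugate_iff (x := A)
    ((Matrix.isUnit_iff_isUnit_det L).2 hL.isUnit)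
  simpa [Matrix.star_eq_conjTranspose, Matrix.conjTranspose_eq_transpose_of_trivial] using this

theorem measurable_congr_mul {q : ℕ} (L : Mat q) : Measurable fun A : Mat q => L * A * Lᵀ :=
  (by fun_prop : Continuous fun A : Mat q => L * A * Lᵀ).measurable

theorem wishartDensity_congr {q : ℕ} (h : ℝ) {L : Mat q} (hL : L.det ≠ 0) (A : Mat q) :
    wishartDensity h (L * Lᵀ) (L * A * Lᵀ) =
      (|L.det| ^ (q + 1))⁻¹ * wishartDensity h 1 A := by
  unfold wishartDensity
  by_cases hA : A.PosDef
  · rw [if_pos ((posDef_congr_iff hL A).2 hA), if_pos hA]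
    have hp : 0 < |L.det| := abs_pos.2 hL
    have hd : (L * Lᵀ).det = |L.det| ^ (2 : ℝ) := by
      rw [Matrix.det_mul, Matrix.det_transpose, ← abs_mul_abs_self, ← sq]; norm_cast
    have hd2 : (L * A * Lᵀ).det = |L.det| ^ (2 : ℝ) * A.det := by
      rw [Matrix.det_mul, Matrix.det_mul, mul_right_comm, ← Matrix.det_mul, hd]
    have ht : ((L * Lᵀ)⁻¹ * (L * A * Lᵀ)).trace = ((1 : Mat q)⁻¹ * A).trace := by
      have hLu : IsUnit L.det := hL.isUnit
      have hLu' : IsUnit Lᵀ.det := by rwa [Matrix.det_transpose]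
      rw [Matrix.mul_inv_rev, Matrix.mul_assoc, Matrix.mul_assoc L,
        Matrix.nonsing_inv_mul_cancel_left _ _ hLu, Matrix.trace_mul_comm,
        Matrix.mul_assoc, Matrix.mul_nonsing_inv _ hLu']
      simp
    rw [hd, hd2, ht, Real.mul_rpow (by positivity) hA.det_pos.le, ← Real.rpow_mul hp.le,
      ← Real.rpow_mul hp.le, Matrix.det_one, Real.one_rpow]
    have e : (|L.det| ^ (q + 1))⁻¹ =
        |L.det| ^ (2 * -(h / 2)) * |L.det| ^ (2 * ((h - q - 1) / 2)) := by
      rw [← Real.rpow_add hp, ← Real.rpow_natCast, ← Real.rpow_neg hp.le]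
      congr 1
      push_cast
      ring
    rw [e]; ring
  · rw [if_neg (fun h => hA ((posDef_congr_iff hL A).1 h)), if_neg hA, mul_zero]

/-- Change of variables A ↦ LAL': the factor |det L|^-(q+1) gained by the density cancels the
Jacobian of the congruence on symmetric matrices. -/
theorem wishart_congr {q : ℕ} {h : ℝ} (hh : (q : ℝ) - 1 < h) {L : Mat q} (hL : L.det ≠ 0) :
    wishart h (L * Lᵀ) = (wishart h 1).map fun A => L * A * Lᵀ := by
  have hp : 0 < |L.det| := abs_pos.2 hL
  have hm := measurable_congr_mul L
  have hs : symLebesgue q = ENNReal.ofReal (|L.det| ^ (q + 1)) •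
      (symLebesgue q).map fun A => L * A * Lᵀ := by
    rw [map_congruence_symLebesgue hL, smul_smul, ← ENNReal.ofReal_mul (by positivity),
      mul_inv_cancel₀ (by positivity), ENNReal.ofReal_one, one_smul]
  ext B hB
  rw [Measure.map_apply hm hB, wishart_of_lt hh, wishart_of_lt hh, withDensity_apply _ hB,
    withDensity_apply _ (hm hB), ← lintegral_indicator hB, ← lintegral_indicator (hm hB)]
  conv_lhs => rw [hs]
  have hmi : Measurable (B.indicator fun A : Mat q =>
      ENNReal.ofReal (wishartDensity h (L * Lᵀ) A)) :=
    (measurable_wishartDensity h (L * Lᵀ)).ennreal_ofReal.indicator hB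
  have hmc : Measurable fun A : Mat q => B.indicator (fun A : Mat q =>
      ENNReal.ofReal (wishartDensity h (L * Lᵀ) A)) (L * A * Lᵀ) := hmi.comp hm
  rw [lintegral_smul_measure, lintegral_map hmi hm, smul_eq_mul, ← lintegral_const_mul _ hmc]
  refine lintegral_congr fun A => ?_
  by_cases hA : L * A * Lᵀ ∈ B
  · rw [Set.indicator_of_mem hA, Set.indicator_of_mem (show A ∈ (fun A => L * A * Lᵀ) ⁻¹' B from hA),
      wishartDensity_congr h hL, ← ENNReal.ofReal_mul (by positivity),
      mul_inv_cancel_left₀ (by positivity)]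
  · rw [Set.indicator_of_notMem hA,
      Set.indicator_of_notMem (show A ∉ (fun A => L * A * Lᵀ) ⁻¹' B from hA), mul_zero]

theorem exists_eq_mul_transpose {q : ℕ} {S : Mat q} (hS : S.PosDef) :
    ∃ L : Mat q, L.det ≠ 0 ∧ S = L * Lᵀ := by
  refine ⟨(uchol S)ᵀ, ?_, ?_⟩
  · rw [Matrix.det_transpose]; exact (uchol_spec hS).det_pos.ne'
  · rw [Matrix.transpose_transpose, (uchol_spec hS).transpose_mul_self]

theorem isProbabilityMeasure_wishart_of_lt {q : ℕ} {h : ℝ} (hh : (q : ℝ) - 1 < h) {S : Mat q}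
    (hS : S.PosDef) : IsProbabilityMeasure (wishart h S) := by
  obtain ⟨L, hL, rfl⟩ := exists_eq_mul_transpose hS
  have := isProbabilityMeasure_wishart_one (q := q) hh
  rw [wishart_congr hh hL]
  exact Measure.isProbabilityMeasure_map (measurable_congr_mul L).aemeasurable

/-- An orthogonal matrix (a Householder reflection) mapping `u` to a multiple of the first
basis vector. -/
theorem exists_orthogonal_mulVec_eq {q : ℕ} (u : Fin (q + 1) → ℝ) :
    ∃ (H : Mat (q + 1)) (c : ℝ), H * Hᵀ = 1 ∧ H *ᵥ u = c • Pi.single 0 1 := by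
  set c := √(u ⬝ᵥ u) with hc
  have hcc : c * c = u ⬝ᵥ u := Real.mul_self_sqrt (by
    rw [dotProduct]; exact Finset.sum_nonneg fun i _ => mul_self_nonneg _)
  -- The reflection in the hyperplane orthogonal to w maps u to c e_0, which has the same length; if
  -- w = 0 the identity matrix serves.
  set w : Fin (q + 1) → ℝ := u - c • Pi.single 0 1 with hw
  by_cases hw0 : w = 0
  · exact ⟨1, c, by simp, by rw [Matrix.one_mulVec]; exact sub_eq_zero.1 hw0⟩
  have hww : w ⬝ᵥ w ≠ 0 := fun h => hw0 (dotProduct_self_eq_zero.1 h)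
  have hwu : 2 * (w ⬝ᵥ u) = w ⬝ᵥ w := by
    simp only [hw, sub_dotProduct, dotProduct_sub, smul_dotProduct, dotProduct_smul,
      single_one_dotProduct, dotProduct_single_one, smul_eq_mul, Pi.sub_apply, Pi.smul_apply,
      Pi.single_eq_same]
    linarith
  refine ⟨1 - (2 / (w ⬝ᵥ w)) • vecMulVec w w, c, ?_, ?_⟩
  · have ht : (1 - (2 / (w ⬝ᵥ w)) • vecMulVec w w : Mat (q + 1))ᵀ =
        1 - (2 / (w ⬝ᵥ w)) • vecMulVec w w := by
      simp [Matrix.transpose_sub, Matrix.transpose_vecMulVec]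
    have hv : vecMulVec w w * vecMulVec w w = (w ⬝ᵥ w) • vecMulVec w w := by
      rw [Matrix.vecMulVec_mul_vecMulVec]
      ext i j; simp [vecMulVec_apply]; ring
    rw [ht, sub_mul, mul_sub, Matrix.one_mul, Matrix.mul_sub, Matrix.mul_one, Matrix.one_mul, Matrix.smul_mul, Matrix.mul_smul, hv,
      smul_smul, smul_smul]
    have : 2 / (w ⬝ᵥ w) * (2 / (w ⬝ᵥ w)) * (w ⬝ᵥ w) = 2 / (w ⬝ᵥ w) + 2 / (w ⬝ᵥ w) := by
      field_simp; norm_num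
    rw [this, add_smul]
    abel
  · rw [Matrix.sub_mulVec, Matrix.one_mulVec, Matrix.smul_mulVec, Matrix.vecMulVec_mulVec]
    have : (2 / (w ⬝ᵥ w)) • (MulOpposite.op (w ⬝ᵥ u) • w) = w := by
      ext i
      simp only [Pi.smul_apply, MulOpposite.smul_eq_mul_unop, MulOpposite.unop_op, smul_eq_mul]
      field_simp
      linear_combination w i * hwu
    rw [this, hw]
    abel

theorem quadForm_congr {q : ℕ} (L A : Mat q) (v : Fin q → ℝ) :
    v ⬝ᵥ ((L * A * Lᵀ) *ᵥ v) = (Lᵀ *ᵥ v) ⬝ᵥ (A *ᵥ (Lᵀ *ᵥ v)) := by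
  rw [Matrix.dotProduct_mulVec, Matrix.dotProduct_mulVec, ← Matrix.vecMul_vecMul,
    ← Matrix.vecMul_vecMul, ← Matrix.dotProduct_mulVec, Matrix.mulVec_transpose]

theorem measurable_quadForm {q : ℕ} (v : Fin q → ℝ) :
    Measurable fun A : Mat q => v ⬝ᵥ (A *ᵥ v) :=
  (by fun_prop : Continuous fun A : Mat q => v ⬝ᵥ (A *ᵥ v)).measurable

/-- A factor L of S = LL' is determined only up to an orthogonal matrix on the right, so it can be
rotated until L'v is a multiple of the first basis vector. The quadratic form then becomes a
multiple of the first diagonal entry of a standard Wishart matrix. -/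
theorem lintegral_quadForm_wishart_of_lt {q : ℕ} {h : ℝ} (hh : (q : ℝ) - 1 < h) {S : Mat q}
    (hS : S.PosDef) (v : Fin q → ℝ) :
    ∫⁻ A, ENNReal.ofReal (v ⬝ᵥ (A *ᵥ v)) ∂wishart h S = ENNReal.ofReal (h * (v ⬝ᵥ (S *ᵥ v))) := by
  cases q with
  | zero => simp
  | succ q =>
    obtain ⟨K, hK, rfl⟩ := exists_eq_mul_transpose hS
    obtain ⟨H, c, hH, hc⟩ := exists_orthogonal_mulVec_eq (Kᵀ *ᵥ v)
    have hH' : Hᵀ * H = 1 := mul_eq_one_comm.1 hH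
    have hHd : H.det ≠ 0 := by
      intro h0
      have := congrArg Matrix.det hH
      rw [Matrix.det_mul, h0, zero_mul, Matrix.det_one] at this
      exact zero_ne_one this
    have hS' : K * Kᵀ = (K * Hᵀ) * (K * Hᵀ)ᵀ := by
      rw [Matrix.transpose_mul, Matrix.transpose_transpose, Matrix.mul_assoc K,
        ← Matrix.mul_assoc Hᵀ, hH', Matrix.one_mul]
    have hLd : (K * Hᵀ).det ≠ 0 := by
      rw [Matrix.det_mul, Matrix.det_transpose]; exact mul_ne_zero hK hHd
    have hLv : (K * Hᵀ)ᵀ *ᵥ v = c • Pi.single 0 1 := by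
      rw [Matrix.transpose_mul, Matrix.transpose_transpose, ← Matrix.mulVec_mulVec, hc]
    have hq : ∀ A : Mat (q + 1), (c • Pi.single 0 1 : Fin (q + 1) → ℝ) ⬝ᵥ
        (A *ᵥ (c • Pi.single 0 1)) = c ^ 2 * A 0 0 := by
      intro A
      rw [Matrix.mulVec_smul, smul_dotProduct, dotProduct_smul, single_one_dotProduct,
        Matrix.mulVec_single_one]
      simp only [smul_eq_mul, Matrix.col_apply]
      ring
    have hvs : v ⬝ᵥ ((K * Kᵀ) *ᵥ v) = c ^ 2 := by
      have := quadForm_congr (K * Hᵀ) 1 v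
      rw [Matrix.mul_one, ← hS', hLv, hq] at this
      simpa using this
    rw [hvs, hS', wishart_congr hh hLd,
      lintegral_map (measurable_quadForm v).ennreal_ofReal (measurable_congr_mul _)]
    have hh0 : 0 ≤ h := by
      have : (0 : ℝ) ≤ q := Nat.cast_nonneg q
      push_cast at hh
      linarith
    simp only [quadForm_congr, hLv, hq, ENNReal.ofReal_mul (sq_nonneg c)]
    rw [lintegral_const_mul _ (measurable_entry 0 0).ennreal_ofReal,
      lintegral_wishart_one_zero_zero hh, mul_comm h, ENNReal.ofReal_mul (sq_nonneg c)]

/-- The gamma constant and the power of det A do not involve S and cancel in the quotient of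
densities. This relative form, unlike the density itself, persists for singular degrees of freedom.
-/
theorem wishart_of_lt_eq_withDensity {q : ℕ} {h : ℝ} (hh : (q : ℝ) - 1 < h) (S : Mat q) :
    wishart h S = (wishart h 1).withDensity fun A => ENNReal.ofReal
      (S.det ^ (-(h / 2)) * Real.exp (-(1 / 2) * ((S⁻¹ - 1) * A).trace)) := by
  have hm : Measurable fun A : Mat q => ENNReal.ofReal
      (S.det ^ (-(h / 2)) * Real.exp (-(1 / 2) * ((S⁻¹ - 1) * A).trace)) := by
    have : Measurable fun A : Mat q => ((S⁻¹ - 1) * A).trace :=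
      (by fun_prop : Continuous fun A : Mat q => ((S⁻¹ - 1) * A).trace).measurable
    exact ((this.const_mul _).exp.const_mul _).ennreal_ofReal
  rw [wishart_of_lt hh, wishart_of_lt hh,
    ← withDensity_mul _ (measurable_wishartDensity h 1).ennreal_ofReal hm]
  congr 1
  ext1 A
  have hg := multivariateGamma_pos hh
  unfold wishartDensity
  by_cases hA : A.PosDef
  · have hd := hA.det_pos
    rw [Pi.mul_apply, if_pos hA, if_pos hA, ← ENNReal.ofReal_mul (by simp only [Matrix.det_one, Real.one_rpow]; positivity)]
    congr 1
    have e : Real.exp (-(1 / 2) * (S⁻¹ * A).trace) = Real.exp (-(1 / 2) * ((1 : Mat q)⁻¹ * A).trace) *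
        Real.exp (-(1 / 2) * ((S⁻¹ - 1) * A).trace) := by
      rw [← Real.exp_add, sub_mul, Matrix.trace_sub, inv_one]
      congr 1
      ring
    rw [e, Matrix.det_one, Real.one_rpow]
    ring
  · rw [Pi.mul_apply, if_neg hA, if_neg hA]; simp

theorem ae_posDef_wishart {q : ℕ} {h : ℝ} (hh : (q : ℝ) - 1 < h) (S : Mat q) :
    ∀ᵐ A ∂wishart h S, A.PosDef := by
  rw [wishart_of_lt hh, ae_withDensity_iff (measurable_wishartDensity h S).ennreal_ofReal]
  refine Filter.Eventually.of_forall fun A hA => ?_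
  by_contra hn
  exact hA (by simp [wishartDensity, hn])

end VolatilityProcess

namespace VolatilityProcess

open scoped ENNReal

/-! ### Product measures with densities -/

theorem lintegral_pi_prod {n : ℕ} {X : Type*} [MeasurableSpace X] (μ : Measure X) [SigmaFinite μ]
    {f : Fin n → X → ℝ≥0∞} (hf : ∀ i, Measurable (f i)) :
    ∫⁻ x, ∏ i, f i (x i) ∂Measure.pi (fun _ : Fin n => μ) = ∏ i, ∫⁻ x, f i x ∂μ := by
  induction n with
  | zero => simp
  | succ n ih =>
    have hm : ∀ (m : ℕ) (f : Fin m → X → ℝ≥0∞), (∀ i, Measurable (f i)) →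
        Measurable fun x : Fin m → X => ∏ i, f i (x i) := fun m f hf =>
      Finset.measurable_prod _ fun i _ => (hf i).comp (measurable_pi_apply i)
    have mp := (measurePreserving_piFinSuccAbove (fun _ : Fin (n + 1) => μ) 0).symm
    have hm' : Measurable fun x : X × (Fin n → X) =>
        ∏ i, f i ((MeasurableEquiv.piFinSuccAbove (fun _ => X) 0).symm x i) :=
      (hm _ f hf).comp (MeasurableEquiv.measurable _)
    rw [← mp.lintegral_comp (hm _ f hf), lintegral_prod _ hm'.aemeasurable, Fin.prod_univ_succ,
      ← ih (f := fun i => f i.succ) (fun i => hf i.succ), ← lintegral_mul_const _ (hf 0)]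
    refine lintegral_congr fun x => ?_
    rw [← lintegral_const_mul _ (hm _ _ fun i => hf i.succ)]
    refine lintegral_congr fun y => ?_
    rw [Fin.prod_univ_succ]
    simp [MeasurableEquiv.piFinSuccAbove]

theorem pi_withDensity {n : ℕ} {X : Type*} [MeasurableSpace X] (μ : Measure X) [SigmaFinite μ]
    {f : X → ℝ≥0∞} (hf : Measurable f) [SigmaFinite (μ.withDensity f)] :
    Measure.pi (fun _ : Fin n => μ.withDensity f) =
      (Measure.pi fun _ : Fin n => μ).withDensity fun x => ∏ i, f (x i) := by
  refine Measure.pi_eq fun s hs => ?_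
  have hs' : MeasurableSet (Set.univ.pi s) := MeasurableSet.univ_pi hs
  rw [withDensity_apply _ hs', ← lintegral_indicator hs']
  have : ∀ x : Fin n → X, (Set.univ.pi s).indicator (fun x => ∏ i, f (x i)) x =
      ∏ i, (s i).indicator f (x i) := by
    intro x
    by_cases hx : x ∈ Set.univ.pi s
    · rw [Set.indicator_of_mem hx]
      exact Finset.prod_congr rfl fun i _ => (Set.indicator_of_mem (hx i trivial) f).symm
    · rw [Set.indicator_of_notMem hx]
      obtain ⟨i, hi⟩ : ∃ i, x i ∉ s i := by simpa using hx
      exact (Finset.prod_eq_zero (Finset.mem_univ i) (Set.indicator_of_notMem hi f)).symm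
  rw [lintegral_congr this, lintegral_pi_prod μ fun i => hf.indicator (hs i)]
  exact Finset.prod_congr rfl fun i _ => by
    rw [lintegral_indicator (hs i), withDensity_apply _ (hs i)]

/-! ### Multivariate Gaussian densities -/

theorem prod_gaussianPDF {q : ℕ} (x : Fin q → ℝ) :
    ∏ i, gaussianPDF 0 1 (x i) =
      ENNReal.ofReal (((√(2 * Real.pi))⁻¹) ^ q * Real.exp (-(1 / 2) * (x ⬝ᵥ x))) := by
  simp only [gaussianPDF]
  rw [← ENNReal.ofReal_prod_of_nonneg fun i _ => gaussianPDFReal_nonneg _ _ _]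
  congr 1
  simp only [gaussianPDFReal, Finset.prod_mul_distrib, Finset.prod_const, Finset.card_univ,
    Fintype.card_fin, NNReal.coe_one, mul_one, sub_zero]
  rw [← Real.exp_sum, dotProduct, Finset.mul_sum]
  congr 2
  exact Finset.sum_congr rfl fun i _ => by ring

theorem lintegral_stdGaussian {q : ℕ} {f : EuclideanSpace ℝ (Fin q) → ℝ≥0∞} (hf : Measurable f) :
    ∫⁻ x, f x ∂stdGaussian (EuclideanSpace ℝ (Fin q)) = ∫⁻ x : Fin q → ℝ,
      ENNReal.ofReal (((√(2 * Real.pi))⁻¹) ^ q * Real.exp (-(1 / 2) * (x ⬝ᵥ x))) *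
        f (WithLp.toLp 2 x) := by
  have hsf : SigmaFinite ((volume : Measure ℝ).withDensity (gaussianPDF 0 1)) := by
    rw [← gaussianReal_of_var_ne_zero 0 one_ne_zero]; infer_instance
  have hm : Measurable fun x : Fin q → ℝ => f (WithLp.toLp 2 x) :=
    hf.comp (WithLp.measurable_toLp 2 _)
  rw [← map_pi_eq_stdGaussian, lintegral_map hf (WithLp.measurable_toLp 2 _),
    gaussianReal_of_var_ne_zero 0 one_ne_zero,
    pi_withDensity _ (measurable_gaussianPDF 0 1), lintegral_withDensity_eq_lintegral_mul _ _ hm,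
    ← volume_pi]
  · exact lintegral_congr fun x => by rw [Pi.mul_apply, prod_gaussianPDF]
  · exact Finset.measurable_prod _ fun i _ =>
      (measurable_gaussianPDF 0 1).comp (measurable_pi_apply i)

theorem lintegral_mulVec {q : ℕ} {L : Mat q} (hL : L.det ≠ 0) {f : (Fin q → ℝ) → ℝ≥0∞}
    (hf : Measurable f) :
    ∫⁻ x, f x = ENNReal.ofReal |L.det| * ∫⁻ x, f (L *ᵥ x) := by
  have h := Real.map_matrix_volume_pi_eq_smul_volume_pi hL
  have hm : Measurable (Matrix.toLin' L) :=
    (LinearMap.continuous_of_finiteDimensional _).measurable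
  have h2 : ∫⁻ x, f (L *ᵥ x) = ENNReal.ofReal |(L.det)⁻¹| * ∫⁻ x, f x := by
    rw [← smul_eq_mul, ← lintegral_smul_measure, ← h, lintegral_map hf hm]
    rfl
  rw [h2, ← mul_assoc, ← ENNReal.ofReal_mul (abs_nonneg _), ← abs_mul, mul_inv_cancel₀ hL,
    abs_one, ENNReal.ofReal_one, one_mul]

open scoped MatrixOrder in
-- The symmetric root is taken, and not the Cholesky factor, because `multivariateGaussian` is the
-- image of the standard Gaussian under it.
theorem exists_sqrt {q : ℕ} {S : Mat q} (hS : S.PosDef) :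
    ∃ L : Mat q, L = CFC.sqrt S ∧ Lᵀ = L ∧ L * L = S ∧ L.det ≠ 0 := by
  have h1 : CFC.sqrt S * CFC.sqrt S = S := CFC.sqrt_mul_sqrt_self _ hS.posSemidef.nonneg
  refine ⟨CFC.sqrt S, rfl, ?_, h1, ?_⟩
  · have := (CFC.sqrt_nonneg S).isSelfAdjoint
    rw [IsSelfAdjoint, Matrix.star_eq_conjTranspose,
      Matrix.conjTranspose_eq_transpose_of_trivial] at this
    exact this
  · intro h0
    have := congrArg Matrix.det h1
    rw [Matrix.det_mul, h0, zero_mul] at this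
    exact hS.det_pos.ne this

theorem measurable_quadForm_vec {q : ℕ} (M : Mat q) :
    Measurable fun x : Fin q → ℝ => x ⬝ᵥ (M *ᵥ x) :=
  (by fun_prop : Continuous fun x : Fin q → ℝ => x ⬝ᵥ (M *ᵥ x)).measurable

/-- The density of `N(0, S)` with respect to `N(0, I)`. -/
noncomputable def gaussianRatio {q : ℕ} (S : Mat q) (x : Fin q → ℝ) : ℝ≥0∞ :=
  ENNReal.ofReal (S.det ^ (-(1 / 2 : ℝ)) * Real.exp (-(1 / 2) * (x ⬝ᵥ ((S⁻¹ - 1) *ᵥ x))))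

theorem measurable_gaussianRatio {q : ℕ} (S : Mat q) : Measurable (gaussianRatio S) :=
  (((measurable_quadForm_vec _).const_mul _).exp.const_mul _).ennreal_ofReal

/-- Both sides are Lebesgue integrals related by the substitution x ↦ Lx with L² = S: the Jacobian
|det L| cancels det(S)^(-1/2), and (Lx)'(S⁻¹ - I)(Lx) = x'x - (Lx)'(Lx). -/
theorem multivariateGaussian_eq_withDensity {q : ℕ} {S : Mat q} (hS : S.PosDef) :
    multivariateGaussian (0 : EuclideanSpace ℝ (Fin q)) S =
      (multivariateGaussian (0 : EuclideanSpace ℝ (Fin q)) 1).withDensity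
        fun x => gaussianRatio S x := by
  obtain ⟨L, hLdef, hLt, hLL, hL⟩ := exists_sqrt hS
  have hg : Measurable fun x : EuclideanSpace ℝ (Fin q) => gaussianRatio S x :=
    (measurable_gaussianRatio S).comp (WithLp.measurable_ofLp 2 _)
  have hT : Measurable fun x : EuclideanSpace ℝ (Fin q) =>
      (0 : EuclideanSpace ℝ (Fin q)) + toEuclideanCLM (𝕜 := ℝ) L x := by fun_prop
  rw [multivariateGaussian_zero_one]
  refine Measure.ext_of_lintegral _ fun f hf => ?_
  have hfT : Measurable fun x : EuclideanSpace ℝ (Fin q) =>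
      f ((0 : EuclideanSpace ℝ (Fin q)) + toEuclideanCLM (𝕜 := ℝ) L x) := hf.comp hT
  rw [multivariateGaussian, ← hLdef, lintegral_map hf hT, lintegral_stdGaussian hfT,
    lintegral_withDensity_eq_lintegral_mul _ hg hf, lintegral_stdGaussian (hg.mul hf)]
  have hmeas : Measurable fun x : Fin q → ℝ =>
      ENNReal.ofReal (((√(2 * Real.pi))⁻¹) ^ q * Real.exp (-(1 / 2) * (x ⬝ᵥ x))) *
        (gaussianRatio S x * f (WithLp.toLp 2 x)) := by
    have h1 : Measurable fun x : Fin q → ℝ => x ⬝ᵥ x :=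
      (by fun_prop : Continuous fun x : Fin q → ℝ => x ⬝ᵥ x).measurable
    exact ((h1.const_mul _).exp.const_mul _).ennreal_ofReal.mul
      ((measurable_gaussianRatio S).mul (hf.comp (WithLp.measurable_toLp 2 _)))
  have := lintegral_mulVec hL hmeas
  simp only [Pi.mul_apply] at this ⊢
  have hmeas' : Measurable fun x : Fin q → ℝ =>
      ENNReal.ofReal (((√(2 * Real.pi))⁻¹) ^ q * Real.exp (-(1 / 2) * ((L *ᵥ x) ⬝ᵥ (L *ᵥ x)))) *
        (gaussianRatio S (L *ᵥ x) * f (WithLp.toLp 2 (L *ᵥ x))) :=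
    hmeas.comp (by fun_prop : Continuous fun x : Fin q → ℝ => L *ᵥ x).measurable
  rw [this, ← lintegral_const_mul _ hmeas']
  refine lintegral_congr fun x => ?_
  rw [zero_add, toEuclideanCLM_toLp, ← mul_assoc, ← mul_assoc]
  congr 1
  unfold gaussianRatio
  have hp : 0 < |L.det| := abs_pos.2 hL
  have hd : S.det = |L.det| ^ (2 : ℝ) := by
    rw [← hLL, Matrix.det_mul, ← abs_mul_abs_self, ← sq]; norm_cast
  have hdet : S.det ^ (-(1 / 2 : ℝ)) = |L.det|⁻¹ := by
    rw [hd, ← Real.rpow_mul hp.le, ← Real.rpow_neg_one]; norm_num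
  rw [← ENNReal.ofReal_mul (abs_nonneg _), ← ENNReal.ofReal_mul (by positivity), hdet]
  congr 1
  have hLu : IsUnit L.det := hL.isUnit
  have hquad : (L *ᵥ x) ⬝ᵥ ((S⁻¹ - 1) *ᵥ (L *ᵥ x)) = x ⬝ᵥ x - (L *ᵥ x) ⬝ᵥ (L *ᵥ x) := by
    rw [Matrix.sub_mulVec, Matrix.one_mulVec, dotProduct_sub]
    congr 1
    have h1 : L * S⁻¹ * Lᵀ = 1 := by
      rw [hLt, ← hLL, Matrix.mul_inv_rev, ← Matrix.mul_assoc, Matrix.mul_nonsing_inv _ hLu,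
        Matrix.one_mul, Matrix.nonsing_inv_mul _ hLu]
    have := quadForm_congr L S⁻¹ x
    rw [h1, Matrix.one_mulVec, hLt] at this
    exact this.symm
  have e : Real.exp (-(1 / 2) * (x ⬝ᵥ x)) = Real.exp (-(1 / 2) * ((L *ᵥ x) ⬝ᵥ (L *ᵥ x))) *
      Real.exp (-(1 / 2) * ((L *ᵥ x) ⬝ᵥ ((S⁻¹ - 1) *ᵥ (L *ᵥ x)))) := by
    rw [← Real.exp_add, hquad]; congr 1; ring
  rw [e]
  field_simp

theorem lintegral_sq_multivariateGaussian {q : ℕ} {S : Mat q} (hS : S.PosDef) (v : Fin q → ℝ) :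
    ∫⁻ x, ENNReal.ofReal ((v ⬝ᵥ (x : Fin q → ℝ)) ^ 2)
      ∂multivariateGaussian (0 : EuclideanSpace ℝ (Fin q)) S =
    ENNReal.ofReal (v ⬝ᵥ (S *ᵥ v)) := by
  have hL2 : MemLp id 2 (multivariateGaussian (0 : EuclideanSpace ℝ (Fin q)) S) :=
    IsGaussian.memLp_two_id
  have h1 := covarianceBilin_multivariateGaussian (μ := 0) hS.posSemidef (WithLp.toLp 2 v)
    (WithLp.toLp 2 v)
  rw [covarianceBilin_apply hL2] at h1
  have hin : ∀ x : EuclideanSpace ℝ (Fin q), inner ℝ (WithLp.toLp 2 v) x = v ⬝ᵥ (x : Fin q → ℝ) := by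
    intro x
    simp [PiLp.inner_apply, dotProduct, mul_comm]
  simp only [id, integral_id_multivariateGaussian, sub_zero, hin] at h1
  rw [← h1, ofReal_integral_eq_lintegral_ofReal]
  · simp only [sq]
  · have : MemLp (fun x : EuclideanSpace ℝ (Fin q) => inner ℝ (WithLp.toLp 2 v) x) 2
        (multivariateGaussian (0 : EuclideanSpace ℝ (Fin q)) S) := hL2.const_inner _
    have h2 := this.integrable_sq
    simp only [hin, sq] at h2
    exact h2
  · exact Filter.Eventually.of_forall fun x => mul_self_nonneg _

end VolatilityProcess

namespace VolatilityProcess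

open scoped ENNReal

/-! ### Wishart distributions, singular or not -/

instance instSecondCountableMat (q : ℕ) : SecondCountableTopology (Mat q) :=
  inferInstanceAs (SecondCountableTopology (Fin q → Fin q → ℝ))

/-- Admissible degrees of freedom. -/
def IsWishartDof (q : ℕ) (h : ℝ) : Prop := (∃ m : ℕ, 0 < m ∧ m < q ∧ h = m) ∨ (q : ℝ) - 1 < h

theorem IsWishartDof.pos {q : ℕ} {h : ℝ} (hq : 1 ≤ q) (hh : IsWishartDof q h) : 0 < h := by
  rcases hh with ⟨m, hm, -, rfl⟩ | hh
  · exact_mod_cast hm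
  · have : (1 : ℝ) ≤ q := by exact_mod_cast hq
    linarith

/-- The density of `Wishart(h, S)` with respect to `Wishart(h, I)`. -/
noncomputable def wishartRatio {q : ℕ} (h : ℝ) (S A : Mat q) : ℝ :=
  S.det ^ (-(h / 2)) * Real.exp (-(1 / 2) * ((S⁻¹ - 1) * A).trace)

theorem wishartRatio_pos {q : ℕ} (h : ℝ) {S : Mat q} (hS : S.PosDef) (A : Mat q) :
    0 < wishartRatio h S A := mul_pos (Real.rpow_pos_of_pos hS.det_pos _) (Real.exp_pos _)

theorem measurable_wishartRatio_uncurry {q : ℕ} (h : ℝ) :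
    Measurable fun p : Mat q × Mat q => wishartRatio h p.1 p.2 := by
  have h1 : Measurable fun p : Mat q × Mat q => ((p.1 - 1) * p.2).trace :=
    (by fun_prop : Continuous fun p : Mat q × Mat q => ((p.1 - 1) * p.2).trace).measurable
  have h2 : Measurable fun p : Mat q × Mat q => (p.1⁻¹, p.2) :=
    (measurable_mat_inv.comp measurable_fst).prodMk measurable_snd
  exact ((measurable_det.comp measurable_fst).pow_const _).mul
    (((h1.comp h2).const_mul _).exp)

theorem measurable_wishartRatio {q : ℕ} (h : ℝ) (S : Mat q) : Measurable (wishartRatio h S) :=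
  (measurable_wishartRatio_uncurry h).comp measurable_prodMk_left

/-- `∑ x_l x_l'`. -/
def gramSum {q m : ℕ} (x : Fin m → EuclideanSpace ℝ (Fin q)) : Mat q :=
  ∑ l, Matrix.vecMulVec (x l : Fin q → ℝ) (x l : Fin q → ℝ)

theorem measurable_gramSum {q m : ℕ} :
    Measurable (gramSum : (Fin m → EuclideanSpace ℝ (Fin q)) → Mat q) := by
  refine measurable_mat fun i j => ?_
  simp only [gramSum, Matrix.sum_apply, vecMulVec_apply]
  fun_prop

theorem trace_mul_gramSum {q m : ℕ} (M : Mat q) (x : Fin m → EuclideanSpace ℝ (Fin q)) :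
    (M * gramSum x).trace = ∑ l, (x l : Fin q → ℝ) ⬝ᵥ (M *ᵥ (x l : Fin q → ℝ)) := by
  rw [gramSum, Matrix.mul_sum, Matrix.trace_sum]
  refine Finset.sum_congr rfl fun l _ => ?_
  rw [Matrix.mul_vecMulVec, Matrix.trace_vecMulVec, dotProduct_comm]

theorem quadForm_gramSum {q m : ℕ} (v : Fin q → ℝ) (x : Fin m → EuclideanSpace ℝ (Fin q)) :
    v ⬝ᵥ (gramSum x *ᵥ v) = ∑ l, (v ⬝ᵥ (x l : Fin q → ℝ)) ^ 2 := by
  rw [gramSum, Matrix.sum_mulVec, dotProduct_sum]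
  refine Finset.sum_congr rfl fun l _ => ?_
  rw [Matrix.vecMulVec_mulVec, dotProduct_smul, dotProduct_comm (x l : Fin q → ℝ)]
  simp [sq]

theorem posSemidef_gramSum {q m : ℕ} (x : Fin m → EuclideanSpace ℝ (Fin q)) :
    (gramSum x).PosSemidef :=
  Matrix.posSemidef_sum _ fun l _ => by
    simpa using Matrix.posSemidef_vecMulVec_self_star (x l : Fin q → ℝ)

theorem wishart_of_lt_card {q m : ℕ} (hm : m < q) (S : Mat q) :
    wishart (m : ℝ) S = (Measure.pi fun _ : Fin m =>
      multivariateGaussian (0 : EuclideanSpace ℝ (Fin q)) S).map gramSum := by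
  unfold wishart
  rw [if_neg, Nat.floor_natCast]
  · rfl
  · have : (m : ℝ) + 1 ≤ q := by exact_mod_cast hm
    linarith

theorem map_withDensity_comp {X Y : Type*} [MeasurableSpace X] [MeasurableSpace Y]
    (μ : Measure X) {g : X → Y} (hg : Measurable g) {f : Y → ℝ≥0∞} (hf : Measurable f) :
    (μ.withDensity fun x => f (g x)).map g = (μ.map g).withDensity f := by
  ext s hs
  rw [Measure.map_apply hg hs, withDensity_apply _ (hg hs), withDensity_apply _ hs,
    setLIntegral_map hs hf hg]

/-- In the singular case the product of the Gaussian density ratios over the m vectors depends on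
them only through ∑ x_l x_l', since ∑ x_l'Mx_l = tr(M ∑ x_l x_l'). It therefore passes to the image
measure, with the same formula as in the regular case. -/
theorem wishart_eq_withDensity {q : ℕ} {h : ℝ} (hh : IsWishartDof q h) {S : Mat q}
    (hS : S.PosDef) :
    wishart h S = (wishart h 1).withDensity fun A => ENNReal.ofReal (wishartRatio h S A) := by
  rcases hh with ⟨m, -, hm, rfl⟩ | hh
  · rw [wishart_of_lt_card hm, wishart_of_lt_card hm]
    have hsf : SigmaFinite ((multivariateGaussian (0 : EuclideanSpace ℝ (Fin q)) 1).withDensity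
        fun x => gaussianRatio S x) := by
      rw [← multivariateGaussian_eq_withDensity hS]; infer_instance
    have hg : Measurable fun x : EuclideanSpace ℝ (Fin q) => gaussianRatio S x :=
      (measurable_gaussianRatio S).comp (WithLp.measurable_ofLp 2 _)
    rw [← map_withDensity_comp _ measurable_gramSum
      (measurable_wishartRatio _ S).ennreal_ofReal,
      multivariateGaussian_eq_withDensity hS, pi_withDensity _ hg]
    congr 2
    ext1 x
    have hd := hS.det_pos
    simp only [gaussianRatio]
    rw [← ENNReal.ofReal_prod_of_nonneg fun i _ => by positivity]
    congr 1
    rw [Finset.prod_mul_distrib, ← Real.exp_sum, ← Finset.mul_sum, wishartRatio,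
      trace_mul_gramSum, Finset.prod_const, Finset.card_univ, Fintype.card_fin,
      ← Real.rpow_natCast, ← Real.rpow_mul hd.le]
    congr 2
    ring
  · exact wishart_of_lt_eq_withDensity hh S

theorem isProbabilityMeasure_wishart {q : ℕ} {h : ℝ} (hh : IsWishartDof q h) {S : Mat q}
    (hS : S.PosDef) : IsProbabilityMeasure (wishart h S) := by
  rcases hh with ⟨m, -, hm, rfl⟩ | hh
  · rw [wishart_of_lt_card hm]
    exact Measure.isProbabilityMeasure_map measurable_gramSum.aemeasurable
  · exact isProbabilityMeasure_wishart_of_lt hh hS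

/-- In the singular case the quadratic form is a sum of m squares (v'x_l)², each with mean v'Sv. -/
theorem lintegral_quadForm_wishart {q : ℕ} {h : ℝ} (hh : IsWishartDof q h) {S : Mat q}
    (hS : S.PosDef) (v : Fin q → ℝ) :
    ∫⁻ A, ENNReal.ofReal (v ⬝ᵥ (A *ᵥ v)) ∂wishart h S = ENNReal.ofReal (h * (v ⬝ᵥ (S *ᵥ v))) := by
  rcases hh with ⟨m, -, hm, rfl⟩ | hh
  · rw [wishart_of_lt_card hm,
      lintegral_map (measurable_quadForm v).ennreal_ofReal measurable_gramSum]
    simp only [quadForm_gramSum]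
    have hmeas : Measurable fun x : EuclideanSpace ℝ (Fin q) =>
        ENNReal.ofReal ((v ⬝ᵥ (x : Fin q → ℝ)) ^ 2) := by
      have : Measurable fun x : Fin q → ℝ => v ⬝ᵥ x :=
        (by fun_prop : Continuous fun x : Fin q → ℝ => v ⬝ᵥ x).measurable
      exact ((this.comp (WithLp.measurable_ofLp 2 _)).pow_const 2).ennreal_ofReal
    have hsplit : ∀ x : Fin m → EuclideanSpace ℝ (Fin q),
        ENNReal.ofReal (∑ l, (v ⬝ᵥ (x l : Fin q → ℝ)) ^ 2) =
        ∑ l, ENNReal.ofReal ((v ⬝ᵥ (x l : Fin q → ℝ)) ^ 2) := fun x =>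
      ENNReal.ofReal_sum_of_nonneg fun l _ => sq_nonneg _
    simp only [hsplit]
    have hmeas' : ∀ l : Fin m, Measurable fun x : Fin m → EuclideanSpace ℝ (Fin q) =>
        ENNReal.ofReal ((v ⬝ᵥ (x l : Fin q → ℝ)) ^ 2) :=
      fun l => hmeas.comp (measurable_pi_apply l)
    rw [lintegral_finsetSum _ fun l _ => hmeas' l]
    have : ∀ l : Fin m, ∫⁻ x : Fin m → EuclideanSpace ℝ (Fin q),
        ENNReal.ofReal ((v ⬝ᵥ (x l : Fin q → ℝ)) ^ 2) ∂(Measure.pi fun _ : Fin m =>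
          multivariateGaussian (0 : EuclideanSpace ℝ (Fin q)) S) =
        ENNReal.ofReal (v ⬝ᵥ (S *ᵥ v)) := by
      intro l
      rw [← lintegral_sq_multivariateGaussian hS v]
      exact (measurePreserving_eval (fun _ : Fin m =>
        multivariateGaussian (0 : EuclideanSpace ℝ (Fin q)) S) l).lintegral_comp hmeas
    simp only [this, Finset.sum_const, Finset.card_univ, Fintype.card_fin, nsmul_eq_mul]
    rw [ENNReal.ofReal_mul (Nat.cast_nonneg m), ENNReal.ofReal_natCast]
  · exact lintegral_quadForm_wishart_of_lt hh hS v

theorem ae_posSemidef_wishart {q : ℕ} {h : ℝ} (hh : IsWishartDof q h) (S : Mat q) :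
    ∀ᵐ A ∂wishart h S, A.PosSemidef := by
  rcases hh with ⟨m, -, hm, rfl⟩ | hh
  · rw [wishart_of_lt_card hm]
    rw [ae_map_iff measurable_gramSum.aemeasurable (measurableSet_posSemidef q)]
    exact Filter.Eventually.of_forall fun x => posSemidef_gramSum x
  · filter_upwards [ae_posDef_wishart hh S] with A hA using hA.posSemidef

end VolatilityProcess

namespace VolatilityProcess

open scoped ENNReal Topology

/-! ### Uniqueness of Laplace transforms near zero -/

/-- Both complex moment generating functions are analytic on the strip |Re z| < ε, which is
connected and contains the imaginary unit. They agree on a real interval around 0, hence on the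
whole strip. -/
theorem complexMGF_I_eq_of_mgf_eqOn {X : Type*} [MeasurableSpace X] {μ ν : Measure X}
    {f : X → ℝ} {ε : ℝ} (hε : 0 < ε)
    (hμ : ∀ t, |t| < ε → Integrable (fun x => Real.exp (t * f x)) μ)
    (hν : ∀ t, |t| < ε → Integrable (fun x => Real.exp (t * f x)) ν)
    (h : ∀ t, |t| < ε → mgf f μ t = mgf f ν t) :
    complexMGF f μ Complex.I = complexMGF f ν Complex.I := by
  set s : Set ℂ := {z | z.re ∈ Set.Ioo (-ε) ε} with hs
  have hint : ∀ ρ : Measure X, (∀ t, |t| < ε → Integrable (fun x => Real.exp (t * f x)) ρ) →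
      s ⊆ {z | z.re ∈ interior (integrableExpSet f ρ)} := by
    intro ρ hρ z hz
    exact interior_maximal (fun t ht => hρ t (abs_lt.2 ht)) isOpen_Ioo hz
  have hX : AnalyticOnNhd ℂ (complexMGF f μ) s := analyticOnNhd_complexMGF.mono (hint μ hμ)
  have hY : AnalyticOnNhd ℂ (complexMGF f ν) s := analyticOnNhd_complexMGF.mono (hint ν hν)
  have hconn : IsPreconnected s :=
    ((convex_Ioo (-ε) ε).linear_preimage Complex.reLm).isPreconnected
  have hfreq : ∃ᶠ z in 𝓝[≠] (0 : ℂ), complexMGF f μ z = complexMGF f ν z := by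
    have h_real : ∃ᶠ (x : ℝ) in 𝓝[≠] 0, complexMGF f μ x = complexMGF f ν x := by
      refine Filter.Eventually.frequently ?_
      filter_upwards [nhdsWithin_le_nhds (Metric.ball_mem_nhds (0 : ℝ) hε)] with x hx
      rw [complexMGF_ofReal, complexMGF_ofReal, h x (by simpa using hx)]
    rw [Filter.frequently_iff_seq_forall] at h_real ⊢
    obtain ⟨xs, hx_tendsto, hx_eq⟩ := h_real
    refine ⟨fun n => xs n, ?_, fun n => hx_eq n⟩
    rw [tendsto_nhdsWithin_iff] at hx_tendsto ⊢
    refine ⟨?_, by simpa using hx_tendsto.2⟩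
    have := (Complex.continuous_ofReal.tendsto 0).comp hx_tendsto.1
    simpa [Function.comp_def] using this
  exact AnalyticOnNhd.eqOn_of_preconnected_of_frequently_eq hX hY hconn (z₀ := 0)
    (by simp [hs, hε]) hfreq (by simp [hs, hε])

/-- The entries of a matrix. -/
def entriesEquiv (q : ℕ) : Mat q ≃ᵐ (Fin q → Fin q → ℝ) where
  toEquiv := Matrix.of.symm
  measurable_toFun := measurable_pi_lambda _ fun i => measurable_pi_lambda _ fun j =>
    measurable_entry i j
  measurable_invFun := measurable_mat fun i j =>
    (measurable_pi_apply j).comp (measurable_pi_apply i)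

theorem entriesEquiv_apply {q : ℕ} (A : Mat q) (i j : Fin q) : entriesEquiv q A i j = A i j := rfl

/-- Characteristic functions are compared one direction at a time. On symmetric matrices every
linear functional is A ↦ tr(ΘA) with Θ symmetric, and its characteristic function follows from the
one-variable Laplace transform by analytic continuation. The radius ε may depend on Θ, as it does
for Wishart laws. -/
theorem ext_of_laplace_nhds {q : ℕ} {μ ν : Measure (Mat q)} [IsFiniteMeasure μ]
    [IsFiniteMeasure ν] (hμ : ∀ᵐ A ∂μ, Aᵀ = A) (hν : ∀ᵐ A ∂ν, Aᵀ = A)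
    (h : ∀ Θ : Mat q, Θᵀ = Θ → ∃ ε > 0, ∀ t : ℝ, |t| < ε →
      ∫⁻ A, ENNReal.ofReal (Real.exp (t * (Θ * A).trace)) ∂μ ≠ ∞ ∧
      ∫⁻ A, ENNReal.ofReal (Real.exp (t * (Θ * A).trace)) ∂μ =
        ∫⁻ A, ENNReal.ofReal (Real.exp (t * (Θ * A).trace)) ∂ν) :
    μ = ν := by
  have : μ.map (entriesEquiv q) = ν.map (entriesEquiv q) := by
    refine Measure.ext_of_charFunDual ?_
    ext L
    -- The indices are exchanged because tr(Θ₀A) pairs the (j, i) entry of Θ₀ with A_ij;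
    -- symmetrising Θ₀ does not change the trace on symmetric A.
    set Θ₀ : Mat q := Matrix.of fun j i => L (Pi.single i (Pi.single j 1)) with hΘ₀
    set Θ : Mat q := (1 / 2 : ℝ) • (Θ₀ + Θ₀ᵀ) with hΘ
    have hΘs : Θᵀ = Θ := by
      rw [hΘ, Matrix.transpose_smul, Matrix.transpose_add, Matrix.transpose_transpose, add_comm]
    have hL : ∀ A : Mat q, Aᵀ = A → L (entriesEquiv q A) = (Θ * A).trace := by
      intro A hA
      have h1 : L (entriesEquiv q A) = (Θ₀ * A).trace := by
        have hdec : entriesEquiv q A =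
            ∑ i, ∑ j, A i j • (Pi.single i (Pi.single j 1) : Fin q → Fin q → ℝ) := by
          ext a b
          simp only [Finset.sum_apply, Pi.smul_apply, smul_eq_mul, entriesEquiv_apply]
          rw [Finset.sum_eq_single a, Finset.sum_eq_single b]
          · simp
          · intro j _ hj; simp [hj.symm]
          · simp
          · intro i _ hi; simp [hi.symm]
          · simp
        conv_lhs => rw [hdec]
        simp only [map_sum, map_smul, Matrix.trace, Matrix.diag, Matrix.mul_apply, hΘ₀,
          Matrix.of_apply, smul_eq_mul]
        rw [Finset.sum_comm]
        exact Finset.sum_congr rfl fun i _ => Finset.sum_congr rfl fun j _ => mul_comm _ _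
      have h2 : (Θ₀ᵀ * A).trace = (Θ₀ * A).trace := by
        rw [← Matrix.trace_transpose, Matrix.transpose_mul, Matrix.transpose_transpose, hA,
          Matrix.trace_mul_comm]
      rw [h1, hΘ, Matrix.smul_mul, Matrix.trace_smul, add_mul, Matrix.trace_add, h2, smul_eq_mul]
      ring
    obtain ⟨ε, hε, hh⟩ := h Θ hΘs
    have hmeas : ∀ t : ℝ, Measurable fun A : Mat q => Real.exp (t * (Θ * A).trace) := fun t =>
      (((by fun_prop : Continuous fun A : Mat q => (Θ * A).trace).measurable).const_mul t).exp
    have hint : ∀ ρ : Measure (Mat q), ∀ t : ℝ,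
        ∫⁻ A, ENNReal.ofReal (Real.exp (t * (Θ * A).trace)) ∂ρ ≠ ∞ →
        Integrable (fun A : Mat q => Real.exp (t * (Θ * A).trace)) ρ := by
      intro ρ t ht
      refine ⟨(hmeas t).aestronglyMeasurable, ?_⟩
      rw [hasFiniteIntegral_iff_ofReal (Filter.Eventually.of_forall fun A => (Real.exp_pos _).le)]
      exact lt_top_iff_ne_top.2 ht
    have hI := complexMGF_I_eq_of_mgf_eqOn (μ := μ) (ν := ν) (f := fun A => (Θ * A).trace) hε
      (fun t ht => hint μ t (hh t ht).1) (fun t ht => hint ν t ((hh t ht).2 ▸ (hh t ht).1))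
      (fun t ht => by
        unfold mgf
        rw [integral_eq_lintegral_of_nonneg_ae
            (Filter.Eventually.of_forall fun A => (Real.exp_pos _).le)
            (hmeas t).aestronglyMeasurable,
          integral_eq_lintegral_of_nonneg_ae
            (Filter.Eventually.of_forall fun A => (Real.exp_pos _).le)
            (hmeas t).aestronglyMeasurable, (hh t ht).2])
    have hchar : ∀ ρ : Measure (Mat q), (∀ᵐ A ∂ρ, Aᵀ = A) →
        charFunDual (ρ.map (entriesEquiv q)) L =
          complexMGF (fun A : Mat q => (Θ * A).trace) ρ Complex.I := by
      intro ρ hρ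
      rw [charFunDual_apply, (entriesEquiv q).measurableEmbedding.integral_map]
      unfold complexMGF
      refine integral_congr_ae ?_
      filter_upwards [hρ] with A hA
      rw [hL A hA, mul_comm]
    rw [hchar μ hμ, hchar ν hν, hI]
  exact (entriesEquiv q).map_measurableEquiv_injective this

end VolatilityProcess

namespace VolatilityProcess

open scoped ENNReal Topology

/-! ### Exponential tilting of Wishart laws -/

theorem abs_quadForm_le {q : ℕ} (Θ : Mat q) (x : Fin q → ℝ) :
    |x ⬝ᵥ (Θ *ᵥ x)| ≤ (∑ i, ∑ j, |Θ i j|) * (x ⬝ᵥ x) := by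
  have hle : ∀ i, x i ^ 2 ≤ x ⬝ᵥ x := fun i => by
    rw [dotProduct, sq]
    exact Finset.single_le_sum (f := fun i => x i * x i) (fun i _ => mul_self_nonneg _)
      (Finset.mem_univ i)
  have he : x ⬝ᵥ (Θ *ᵥ x) = ∑ i, ∑ j, x i * (Θ i j * x j) := by
    simp only [dotProduct, Matrix.mulVec, Finset.mul_sum]
  rw [he, Finset.sum_mul]
  refine (Finset.abs_sum_le_sum_abs _ _).trans (Finset.sum_le_sum fun i _ => ?_)
  rw [Finset.sum_mul]
  refine (Finset.abs_sum_le_sum_abs _ _).trans (Finset.sum_le_sum fun j _ => ?_)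
  have h1 := hle i
  have h2 := hle j
  have h3 : |x i * x j| ≤ x ⬝ᵥ x := by
    rw [abs_le]; constructor <;> nlinarith [sq_nonneg (x i + x j), sq_nonneg (x i - x j)]
  calc |x i * (Θ i j * x j)| = |Θ i j| * |x i * x j| := by rw [← abs_mul]; congr 1; ring
    _ ≤ _ := mul_le_mul_of_nonneg_left h3 (abs_nonneg _)

/-- A range of t in which tilting by exp(t tr(ΘA)) turns a standard Wishart law into a multiple of
another Wishart law. -/
theorem exists_posDef_one_sub_smul {q : ℕ} {Θ : Mat q} (hΘ : Θᵀ = Θ) :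
    ∃ ε > 0, ∀ t : ℝ, |t| < ε → (1 - (2 * t) • Θ).PosDef := by
  set C := ∑ i, ∑ j, |Θ i j| with hC
  have hC0 : 0 ≤ C := Finset.sum_nonneg fun i _ => Finset.sum_nonneg fun j _ => abs_nonneg _
  refine ⟨1 / (2 * (C + 1)), by positivity, fun t ht => ?_⟩
  refine Matrix.PosDef.of_dotProduct_mulVec_pos ?_ fun x hx => ?_
  · rw [Matrix.IsHermitian, Matrix.conjTranspose_eq_transpose_of_trivial]
    simp [Matrix.transpose_sub, hΘ]
  · rw [star_trivial, Matrix.sub_mulVec, Matrix.one_mulVec, dotProduct_sub, Matrix.smul_mulVec,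
      dotProduct_smul, smul_eq_mul]
    have hxx : 0 < x ⬝ᵥ x := lt_of_le_of_ne
      (by rw [dotProduct]; exact Finset.sum_nonneg fun i _ => mul_self_nonneg _)
      (fun h => hx (dotProduct_self_eq_zero.1 h.symm))
    have h1 := abs_quadForm_le Θ x
    have h2 : |2 * t * (x ⬝ᵥ (Θ *ᵥ x))| < x ⬝ᵥ x := by
      rw [abs_mul, abs_mul, abs_two]
      rw [lt_div_iff₀ (by positivity)] at ht
      calc 2 * |t| * |x ⬝ᵥ (Θ *ᵥ x)| ≤ 2 * |t| * (C * (x ⬝ᵥ x)) := by gcongr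
        _ ≤ (|t| * (2 * (C + 1))) * (x ⬝ᵥ x) := by
            nlinarith [mul_nonneg (abs_nonneg t) hxx.le]
        _ < 1 * (x ⬝ᵥ x) := by gcongr
        _ = _ := one_mul _
    linarith [(abs_lt.1 h2).2]

/-- The exponential factor is, up to a constant, the density of Wishart(h, M⁻¹) relative to
Wishart(h, I): tilting changes the scale and keeps the degrees of freedom. -/
theorem lintegral_mul_exp_wishart {q : ℕ} {h : ℝ} (hh : IsWishartDof q h) {M : Mat q}
    (hM : M.PosDef) {f : Mat q → ℝ≥0∞} (hf : Measurable f) :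
    ∫⁻ A, f A * ENNReal.ofReal (Real.exp (-(1 / 2) * ((M - 1) * A).trace)) ∂wishart h 1 =
      ENNReal.ofReal (M⁻¹.det ^ (h / 2)) * ∫⁻ A, f A ∂wishart h M⁻¹ := by
  have hMi := hM.inv
  have hd := hMi.det_pos
  have hfm := (measurable_wishartRatio h M⁻¹).ennreal_ofReal.mul hf
  rw [wishart_eq_withDensity hh hMi, lintegral_withDensity_eq_lintegral_mul _
    (measurable_wishartRatio h M⁻¹).ennreal_ofReal hf, ← lintegral_const_mul _ hfm]
  refine lintegral_congr fun A => ?_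
  have hMu : IsUnit M.det := hM.det_pos.ne'.isUnit
  rw [Pi.mul_apply, wishartRatio, Matrix.nonsing_inv_nonsing_inv _ hMu, ← mul_assoc,
    ← ENNReal.ofReal_mul (by positivity), ← mul_assoc, ← Real.rpow_add hd, add_neg_cancel,
    Real.rpow_zero, one_mul, mul_comm]

/-! ### The mean of the matrix beta distribution -/

section

variable {q : ℕ} {n k : ℝ}

/-- The joint law of two independent Wishart matrices. -/
noncomputable def wishartPair (q : ℕ) (n k : ℝ) : Measure (Mat q × Mat q) :=
  (wishart n (1 : Mat q)).prod (wishart k (1 : Mat q))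

theorem isProbabilityMeasure_wishartPair (hn : IsWishartDof q n) (hk : IsWishartDof q k) :
    IsProbabilityMeasure (wishartPair q n k) := by
  have := isProbabilityMeasure_wishart hn (Matrix.PosDef.one (n := Fin q) (R := ℝ))
  have := isProbabilityMeasure_wishart hk (Matrix.PosDef.one (n := Fin q) (R := ℝ))
  unfold wishartPair; infer_instance

theorem ae_wishartPair_fst (hn : IsWishartDof q n) (hk : IsWishartDof q k) {p : Mat q → Prop}
    (h : ∀ᵐ A ∂wishart n (1 : Mat q), p A) : ∀ᵐ A ∂wishartPair q n k, p A.1 := by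
  have := isProbabilityMeasure_wishart hn (Matrix.PosDef.one (n := Fin q) (R := ℝ))
  have := isProbabilityMeasure_wishart hk (Matrix.PosDef.one (n := Fin q) (R := ℝ))
  exact Measure.quasiMeasurePreserving_fst.ae h

theorem ae_wishartPair_snd (hn : IsWishartDof q n) (hk : IsWishartDof q k) {p : Mat q → Prop}
    (h : ∀ᵐ A ∂wishart k (1 : Mat q), p A) : ∀ᵐ A ∂wishartPair q n k, p A.2 := by
  have := isProbabilityMeasure_wishart hn (Matrix.PosDef.one (n := Fin q) (R := ℝ))
  have := isProbabilityMeasure_wishart hk (Matrix.PosDef.one (n := Fin q) (R := ℝ))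
  exact Measure.quasiMeasurePreserving_snd.ae h

theorem ae_wishartPair_posSemidef (hn : IsWishartDof q n) (hk : IsWishartDof q k) :
    ∀ᵐ A ∂wishartPair q n k, A.1.PosSemidef ∧ A.2.PosSemidef := by
  filter_upwards [ae_wishartPair_fst hn hk (ae_posSemidef_wishart hn 1),
    ae_wishartPair_snd hn hk (ae_posSemidef_wishart hk 1)] with A h1 h2 using ⟨h1, h2⟩

theorem lintegral_wishartPair (hn : IsWishartDof q n) (hk : IsWishartDof q k)
    {f g : Mat q → ℝ≥0∞} (hf : Measurable f) (hg : Measurable g) :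
    ∫⁻ A, f A.1 * g A.2 ∂wishartPair q n k =
      (∫⁻ A, f A ∂wishart n 1) * ∫⁻ A, g A ∂wishart k 1 := by
  have := isProbabilityMeasure_wishart hn (Matrix.PosDef.one (n := Fin q) (R := ℝ))
  have := isProbabilityMeasure_wishart hk (Matrix.PosDef.one (n := Fin q) (R := ℝ))
  exact lintegral_prod_mul hf.aemeasurable hg.aemeasurable

/-- The quadratic form `v'Av` as an extended nonnegative number. -/
noncomputable def quadENN (v : Fin q → ℝ) (A : Mat q) : ℝ≥0∞ := ENNReal.ofReal (v ⬝ᵥ (A *ᵥ v))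

theorem measurable_quadENN (v : Fin q → ℝ) : Measurable (quadENN v) :=
  (measurable_quadForm v).ennreal_ofReal

theorem quadENN_add {v : Fin q → ℝ} {A B : Mat q} (hA : A.PosSemidef) (hB : B.PosSemidef) :
    quadENN v (A + B) = quadENN v A + quadENN v B := by
  unfold quadENN
  rw [Matrix.add_mulVec, dotProduct_add, ENNReal.ofReal_add]
  · simpa using hA.dotProduct_mulVec_nonneg v
  · simpa using hB.dotProduct_mulVec_nonneg v

theorem lintegral_quadENN_fst (hn : IsWishartDof q n) (hk : IsWishartDof q k)
    (v : Fin q → ℝ) :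
    ∫⁻ A, quadENN v A.1 ∂wishartPair q n k = ENNReal.ofReal (n * (v ⬝ᵥ v)) := by
  have := isProbabilityMeasure_wishart hk (Matrix.PosDef.one (n := Fin q) (R := ℝ))
  have h1 := lintegral_wishartPair hn hk (measurable_quadENN v) (g := fun _ => 1) measurable_const
  have h2 := lintegral_quadForm_wishart hn (Matrix.PosDef.one (n := Fin q) (R := ℝ)) v
  rw [Matrix.one_mulVec] at h2
  simp only [mul_one, lintegral_const, measure_univ] at h1
  exact h1.trans h2

theorem lintegral_quadENN_snd (hn : IsWishartDof q n) (hk : IsWishartDof q k)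
    (v : Fin q → ℝ) :
    ∫⁻ A, quadENN v A.2 ∂wishartPair q n k = ENNReal.ofReal (k * (v ⬝ᵥ v)) := by
  have := isProbabilityMeasure_wishart hn (Matrix.PosDef.one (n := Fin q) (R := ℝ))
  have h1 := lintegral_wishartPair hn hk (f := fun _ => 1) measurable_const (measurable_quadENN v)
  have h2 := lintegral_quadForm_wishart hk (Matrix.PosDef.one (n := Fin q) (R := ℝ)) v
  rw [Matrix.one_mulVec] at h2
  simp only [one_mul, lintegral_const, measure_univ] at h1
  exact h1.trans h2

theorem measurable_pair_add : Measurable fun A : Mat q × Mat q => A.1 + A.2 :=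
  (by fun_prop : Continuous fun A : Mat q × Mat q => A.1 + A.2).measurable

/-- `E[A₁ | A₁ + A₂] = n / (n + k) (A₁ + A₂)`, for quadratic forms. -/
theorem map_withDensity_quadENN (hq : 1 ≤ q) (hn : IsWishartDof q n) (hk : IsWishartDof q k)
    (v : Fin q → ℝ) :
    ((wishartPair q n k).withDensity fun A => quadENN v A.1).map (fun A => A.1 + A.2) =
      ((wishartPair q n k).withDensity fun A =>
        ENNReal.ofReal (n / (n + k)) * quadENN v (A.1 + A.2)).map (fun A => A.1 + A.2) := by
  have hn0 := hn.pos hq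
  have hk0 := hk.pos hq
  have hpp := isProbabilityMeasure_wishartPair hn hk
  have hm1 : Measurable fun A : Mat q × Mat q => quadENN v A.1 :=
    (measurable_quadENN v).comp measurable_fst
  have hm2 : Measurable fun A : Mat q × Mat q => quadENN v A.2 :=
    (measurable_quadENN v).comp measurable_snd
  have hm3 : Measurable fun A : Mat q × Mat q =>
      ENNReal.ofReal (n / (n + k)) * quadENN v (A.1 + A.2) :=
    ((measurable_quadENN v).comp measurable_pair_add).const_mul _
  have hsplit : ∀ᵐ A ∂wishartPair q n k, quadENN v (A.1 + A.2) = quadENN v A.1 + quadENN v A.2 := by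
    filter_upwards [ae_wishartPair_posSemidef hn hk] with A hA using quadENN_add hA.1 hA.2
  have hfin1 : ∫⁻ A, quadENN v A.1 ∂wishartPair q n k ≠ ∞ := by
    rw [lintegral_quadENN_fst hn hk]; exact ENNReal.ofReal_ne_top
  have hfin2 : ∫⁻ A, ENNReal.ofReal (n / (n + k)) * quadENN v (A.1 + A.2) ∂wishartPair q n k ≠ ∞ := by
    have hms : Measurable fun A : Mat q × Mat q => quadENN v (A.1 + A.2) :=
      (measurable_quadENN v).comp measurable_pair_add
    rw [lintegral_const_mul _ hms,
      lintegral_congr_ae hsplit, lintegral_add_left hm1, lintegral_quadENN_fst hn hk,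
      lintegral_quadENN_snd hn hk]
    exact ENNReal.mul_ne_top ENNReal.ofReal_ne_top
      (ENNReal.add_ne_top.2 ⟨ENNReal.ofReal_ne_top, ENNReal.ofReal_ne_top⟩)
  have hf1 : IsFiniteMeasure ((wishartPair q n k).withDensity fun A => quadENN v A.1) :=
    isFiniteMeasure_withDensity hfin1
  have hf2 : IsFiniteMeasure ((wishartPair q n k).withDensity fun A =>
      ENNReal.ofReal (n / (n + k)) * quadENN v (A.1 + A.2)) :=
    isFiniteMeasure_withDensity hfin2
  have hsymset : MeasurableSet {A : Mat q | Aᵀ = A} :=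
    (isClosed_eq (by fun_prop) continuous_id).measurableSet
  have hsym : ∀ f : Mat q × Mat q → ℝ≥0∞, ∀ᵐ A ∂((wishartPair q n k).withDensity f).map
      (fun A => A.1 + A.2), Aᵀ = A := by
    intro f
    rw [ae_map_iff measurable_pair_add.aemeasurable hsymset]
    refine (withDensity_absolutelyContinuous _ f).ae_le ?_
    filter_upwards [ae_wishartPair_posSemidef hn hk] with A hA
    have := (hA.1.add hA.2).isHermitian
    rwa [Matrix.IsHermitian, Matrix.conjTranspose_eq_transpose_of_trivial] at this
  refine ext_of_laplace_nhds (hsym _) (hsym _) fun Θ hΘ => ?_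
  obtain ⟨ε, hε, hpd⟩ := exists_posDef_one_sub_smul hΘ
  refine ⟨ε, hε, fun t ht => ?_⟩
  -- With this M, exp(t tr(ΘA)) = exp(-½ tr((M - I)A)). The exponential of a sum is a product, so
  -- the tilted pair is still independent, with common scale M⁻¹.
  set M : Mat q := 1 - (2 * t) • Θ with hM
  have hMp : M.PosDef := hpd t ht
  have hMi := hMp.inv
  set E : Mat q → ℝ≥0∞ := fun A => ENNReal.ofReal (Real.exp (-(1 / 2) * ((M - 1) * A).trace)) with hE
  have hEt : ∀ A, ENNReal.ofReal (Real.exp (t * (Θ * A).trace)) = E A := by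
    intro A
    simp only [hE]
    congr 2
    rw [hM, sub_sub_cancel_left, Matrix.neg_mul, Matrix.smul_mul, Matrix.trace_neg,
      Matrix.trace_smul, smul_eq_mul]
    ring
  have hEm : Measurable E := by
    have : Measurable fun A : Mat q => ((M - 1) * A).trace :=
      (by fun_prop : Continuous fun A : Mat q => ((M - 1) * A).trace).measurable
    exact ((this.const_mul _).exp).ennreal_ofReal
  have hEadd : ∀ A B, E (A + B) = E A * E B := by
    intro A B
    simp only [hE]
    rw [← ENNReal.ofReal_mul (Real.exp_pos _).le, ← Real.exp_add, mul_add, Matrix.trace_add]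
    congr 2
    ring
  have hE0 : ∀ {h : ℝ}, IsWishartDof q h →
      ∫⁻ A, E A ∂wishart h 1 = ENNReal.ofReal (M⁻¹.det ^ (h / 2)) := by
    intro h hh
    have := isProbabilityMeasure_wishart hh hMi
    have h1 := lintegral_mul_exp_wishart hh hMp (f := fun _ => 1) measurable_const
    simpa [hE] using h1
  have hE1 : ∀ {h : ℝ}, IsWishartDof q h →
      ∫⁻ A, quadENN v A * E A ∂wishart h 1 = ENNReal.ofReal (M⁻¹.det ^ (h / 2)) *
        ENNReal.ofReal (h * (v ⬝ᵥ (M⁻¹ *ᵥ v))) := by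
    intro h hh
    rw [← lintegral_quadForm_wishart hh hMi v]
    exact lintegral_mul_exp_wishart hh hMp (measurable_quadENN v)
  have hqE : Measurable fun A => quadENN v A * E A := (measurable_quadENN v).mul hEm
  have hEs : Measurable fun A : Mat q × Mat q => E (A.1 + A.2) := hEm.comp measurable_pair_add
  have hv0 : 0 ≤ v ⬝ᵥ (M⁻¹ *ᵥ v) := by simpa using hMi.posSemidef.dotProduct_mulVec_nonneg v
  have hd := hMi.det_pos
  -- The tilted means of v'A₁v and v'A₂v are n and k times the same number v'M⁻¹v. Weighting by
  -- v'A₁v or by n/(n+k) v'(A₁ + A₂)v thus gives the same Laplace transform of A₁ + A₂.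
  have e1 : ∫⁻ A, quadENN v A.1 * E (A.1 + A.2) ∂wishartPair q n k =
      ENNReal.ofReal (M⁻¹.det ^ (n / 2) * (n * (v ⬝ᵥ (M⁻¹ *ᵥ v))) * M⁻¹.det ^ (k / 2)) := by
    have : ∀ A : Mat q × Mat q, quadENN v A.1 * E (A.1 + A.2) =
        (quadENN v A.1 * E A.1) * E A.2 := fun A => by rw [hEadd, mul_assoc]
    rw [lintegral_congr this, lintegral_wishartPair hn hk hqE hEm, hE0 hk, hE1 hn,
      ← ENNReal.ofReal_mul (by positivity), ← ENNReal.ofReal_mul (by positivity)]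
  have e2 : ∫⁻ A, quadENN v A.2 * E (A.1 + A.2) ∂wishartPair q n k =
      ENNReal.ofReal (M⁻¹.det ^ (n / 2) * (M⁻¹.det ^ (k / 2) * (k * (v ⬝ᵥ (M⁻¹ *ᵥ v))))) := by
    have : ∀ A : Mat q × Mat q, quadENN v A.2 * E (A.1 + A.2) =
        E A.1 * (quadENN v A.2 * E A.2) := fun A => by rw [hEadd]; ring
    rw [lintegral_congr this, lintegral_wishartPair hn hk hEm hqE, hE0 hn, hE1 hk,
      ← ENNReal.ofReal_mul (by positivity), ← ENNReal.ofReal_mul (by positivity)]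
  have l1 : ∫⁻ A, E A ∂((wishartPair q n k).withDensity fun A => quadENN v A.1).map
      (fun A => A.1 + A.2) = ENNReal.ofReal
        (M⁻¹.det ^ (n / 2) * (n * (v ⬝ᵥ (M⁻¹ *ᵥ v))) * M⁻¹.det ^ (k / 2)) := by
    rw [lintegral_map hEm measurable_pair_add, lintegral_withDensity_eq_lintegral_mul _ hm1 hEs]
    exact e1
  have l2 : ∫⁻ A, E A ∂((wishartPair q n k).withDensity fun A =>
      ENNReal.ofReal (n / (n + k)) * quadENN v (A.1 + A.2)).map (fun A => A.1 + A.2) =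
      ENNReal.ofReal (M⁻¹.det ^ (n / 2) * (n * (v ⬝ᵥ (M⁻¹ *ᵥ v))) * M⁻¹.det ^ (k / 2)) := by
    rw [lintegral_map hEm measurable_pair_add, lintegral_withDensity_eq_lintegral_mul _ hm3 hEs]
    have : ∀ᵐ A ∂wishartPair q n k, ((fun A : Mat q × Mat q =>
        ENNReal.ofReal (n / (n + k)) * quadENN v (A.1 + A.2)) *
        fun A : Mat q × Mat q => E (A.1 + A.2)) A =
        ENNReal.ofReal (n / (n + k)) *
          (quadENN v A.1 * E (A.1 + A.2) + quadENN v A.2 * E (A.1 + A.2)) := by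
      filter_upwards [hsplit] with A hA
      rw [Pi.mul_apply, hA, mul_assoc, add_mul]
    have hmm1 : Measurable fun A : Mat q × Mat q => quadENN v A.1 * E (A.1 + A.2) := hm1.mul hEs
    have hmm2 : Measurable fun A : Mat q × Mat q => quadENN v A.2 * E (A.1 + A.2) := hm2.mul hEs
    have hmm : Measurable fun A : Mat q × Mat q =>
        quadENN v A.1 * E (A.1 + A.2) + quadENN v A.2 * E (A.1 + A.2) := hmm1.add hmm2
    rw [lintegral_congr_ae this, lintegral_const_mul _ hmm, lintegral_add_left hmm1, e1, e2,
      ← ENNReal.ofReal_add (by positivity) (by positivity),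
      ← ENNReal.ofReal_mul (by positivity)]
    congr 1
    field_simp
  simp only [hEt]
  exact ⟨by rw [l1]; exact ENNReal.ofReal_ne_top, l1.trans l2.symm⟩

end

end VolatilityProcess

/-! ### From quadratic forms to entries, and the mean of the matrix beta law -/

namespace VolatilityProcess

open scoped ENNReal Topology

theorem quadForm_single_add_smul {q : ℕ} (A : Mat q) (i j : Fin q) (c : ℝ) :
    (Pi.single i 1 + c • Pi.single j 1) ⬝ᵥ (A *ᵥ (Pi.single i 1 + c • Pi.single j 1)) =
      A i i + c * A i j + c * A j i + c ^ 2 * A j j := by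
  simp only [Matrix.mulVec_add, Matrix.mulVec_smul, dotProduct_add, add_dotProduct,
    smul_dotProduct, dotProduct_smul, Matrix.mulVec_single_one, single_dotProduct, smul_eq_mul,
    Matrix.col_apply, one_mul]
  ring

theorem quadForm_single {q : ℕ} (A : Mat q) (i : Fin q) :
    Pi.single i 1 ⬝ᵥ (A *ᵥ Pi.single i 1) = A i i := by
  simp

theorem transpose_eq_of_posSemidef {q : ℕ} {A : Mat q} (hA : A.PosSemidef) : Aᵀ = A := by
  have := hA.isHermitian
  rwa [Matrix.IsHermitian, Matrix.conjTranspose_eq_transpose_of_trivial] at this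

theorem abs_entry_le_of_posSemidef {q : ℕ} {A : Mat q} (hA : A.PosSemidef) (i j : Fin q) :
    |A i j| ≤ (A i i + A j j) / 2 := by
  have hs : A j i = A i j := congrFun (congrFun (transpose_eq_of_posSemidef hA) i) j
  have h1 := hA.dotProduct_mulVec_nonneg (Pi.single i 1 + (1 : ℝ) • Pi.single j 1)
  have h2 := hA.dotProduct_mulVec_nonneg (Pi.single i 1 + (-1 : ℝ) • Pi.single j 1)
  rw [star_trivial, quadForm_single_add_smul, hs] at h1 h2
  rw [abs_le]; constructor <;> linarith

section

variable {q : ℕ} {n k : ℝ}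

theorem integrable_quadForm_fst (hn : IsWishartDof q n) (hk : IsWishartDof q k)
    (v : Fin q → ℝ) :
    Integrable (fun A : Mat q × Mat q => v ⬝ᵥ (A.1 *ᵥ v)) (wishartPair q n k) := by
  have hm : Measurable fun A : Mat q × Mat q => v ⬝ᵥ (A.1 *ᵥ v) :=
    (measurable_quadForm v).comp measurable_fst
  refine (lintegral_ofReal_ne_top_iff_integrable hm.aestronglyMeasurable ?_).1 ?_
  · filter_upwards [ae_wishartPair_posSemidef hn hk] with A hA
    simpa using hA.1.dotProduct_mulVec_nonneg v
  · have := lintegral_quadENN_fst hn hk v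
    simp only [quadENN] at this
    exact this ▸ ENNReal.ofReal_ne_top

theorem integrable_quadForm_snd (hn : IsWishartDof q n) (hk : IsWishartDof q k)
    (v : Fin q → ℝ) :
    Integrable (fun A : Mat q × Mat q => v ⬝ᵥ (A.2 *ᵥ v)) (wishartPair q n k) := by
  have hm : Measurable fun A : Mat q × Mat q => v ⬝ᵥ (A.2 *ᵥ v) :=
    (measurable_quadForm v).comp measurable_snd
  refine (lintegral_ofReal_ne_top_iff_integrable hm.aestronglyMeasurable ?_).1 ?_
  · filter_upwards [ae_wishartPair_posSemidef hn hk] with A hA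
    simpa using hA.2.dotProduct_mulVec_nonneg v
  · have := lintegral_quadENN_snd hn hk v
    simp only [quadENN] at this
    exact this ▸ ENNReal.ofReal_ne_top

/-- Integration of g against the two equal image measures of `map_withDensity_quadENN`. No bound on
g is needed, because equal measures give equal integrals even under the convention for
non-integrable functions. -/
theorem integral_mul_quadForm (hq : 1 ≤ q) (hn : IsWishartDof q n) (hk : IsWishartDof q k)
    {g : Mat q → ℝ} (hg : Measurable g) (v : Fin q → ℝ) :
    ∫ A, g (A.1 + A.2) * (v ⬝ᵥ (A.1 *ᵥ v)) ∂wishartPair q n k =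
      n / (n + k) * ∫ A, g (A.1 + A.2) * (v ⬝ᵥ ((A.1 + A.2) *ᵥ v)) ∂wishartPair q n k := by
  have hn0 := hn.pos hq
  have hk0 := hk.pos hq
  have hm1 : Measurable fun A : Mat q × Mat q => quadENN v A.1 :=
    (measurable_quadENN v).comp measurable_fst
  have hm3 : Measurable fun A : Mat q × Mat q =>
      ENNReal.ofReal (n / (n + k)) * quadENN v (A.1 + A.2) :=
    ((measurable_quadENN v).comp measurable_pair_add).const_mul _
  have h := congrArg (fun ν => ∫ S, g S ∂ν) (map_withDensity_quadENN hq hn hk v)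
  beta_reduce at h
  rw [integral_map measurable_pair_add.aemeasurable hg.aestronglyMeasurable,
    integral_map measurable_pair_add.aemeasurable hg.aestronglyMeasurable,
    integral_withDensity_eq_integral_toReal_smul hm1 (.of_forall fun _ => ENNReal.ofReal_lt_top),
    integral_withDensity_eq_integral_toReal_smul hm3
      (.of_forall fun _ => ENNReal.mul_lt_top ENNReal.ofReal_lt_top ENNReal.ofReal_lt_top)] at h
  rw [← integral_const_mul]
  have e1 : ∫ A, g (A.1 + A.2) * (v ⬝ᵥ (A.1 *ᵥ v)) ∂wishartPair q n k =
      ∫ A, (quadENN v A.1).toReal • g (A.1 + A.2) ∂wishartPair q n k := by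
    refine integral_congr_ae ?_
    filter_upwards [ae_wishartPair_posSemidef hn hk] with A hA
    rw [quadENN, ENNReal.toReal_ofReal (by simpa using hA.1.dotProduct_mulVec_nonneg v),
      smul_eq_mul, mul_comm]
  rw [e1, h]
  refine integral_congr_ae ?_
  filter_upwards [ae_wishartPair_posSemidef hn hk] with A hA
  rw [quadENN, ENNReal.toReal_mul, ENNReal.toReal_ofReal (by positivity), ENNReal.toReal_ofReal
    (by simpa using (hA.1.add hA.2).dotProduct_mulVec_nonneg v), smul_eq_mul]
  ring

theorem integrable_entry_fst (hn : IsWishartDof q n) (hk : IsWishartDof q k) (i j : Fin q) :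
    Integrable (fun A : Mat q × Mat q => A.1 i j) (wishartPair q n k) := by
  have h := ((integrable_quadForm_fst hn hk (Pi.single i 1)).add
    (integrable_quadForm_fst hn hk (Pi.single j 1))).div_const 2
  refine h.mono' ((measurable_entry i j).comp measurable_fst).aestronglyMeasurable ?_
  filter_upwards [ae_wishartPair_posSemidef hn hk] with A hA
  simp only [Pi.add_apply, quadForm_single]
  exact abs_entry_le_of_posSemidef hA.1 i j

theorem integrable_entry_snd (hn : IsWishartDof q n) (hk : IsWishartDof q k) (i j : Fin q) :
    Integrable (fun A : Mat q × Mat q => A.2 i j) (wishartPair q n k) := by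
  have h := ((integrable_quadForm_snd hn hk (Pi.single i 1)).add
    (integrable_quadForm_snd hn hk (Pi.single j 1))).div_const 2
  refine h.mono' ((measurable_entry i j).comp measurable_snd).aestronglyMeasurable ?_
  filter_upwards [ae_wishartPair_posSemidef hn hk] with A hA
  simp only [Pi.add_apply, quadForm_single]
  exact abs_entry_le_of_posSemidef hA.2 i j

theorem integrable_entry_add (hn : IsWishartDof q n) (hk : IsWishartDof q k) (i j : Fin q) :
    Integrable (fun A : Mat q × Mat q => (A.1 + A.2) i j) (wishartPair q n k) :=
  (integrable_entry_fst hn hk i j).add (integrable_entry_snd hn hk i j)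

/-- `E[A₁ | A₁ + A₂] = n / (n + k) (A₁ + A₂)`, entrywise. -/
theorem integral_mul_entry_fst (hq : 1 ≤ q) (hn : IsWishartDof q n) (hk : IsWishartDof q k)
    {g : Mat q → ℝ} (hg : Measurable g) {C : ℝ} (hC : ∀ S, |g S| ≤ C) (i j : Fin q) :
    ∫ A, g (A.1 + A.2) * A.1 i j ∂wishartPair q n k =
      n / (n + k) * ∫ A, g (A.1 + A.2) * (A.1 + A.2) i j ∂wishartPair q n k := by
  have hgm : Measurable fun A : Mat q × Mat q => g (A.1 + A.2) := hg.comp measurable_pair_add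
  have hbd : ∀ {f : Mat q × Mat q → ℝ}, Integrable f (wishartPair q n k) →
      Integrable (fun A => g (A.1 + A.2) * f A) (wishartPair q n k) := fun hf =>
    hf.bdd_mul hgm.aestronglyMeasurable (.of_forall fun A => hC (A.1 + A.2))
  -- Polarisation, which is also correct for i = j.
  have hpol : ∀ {A : Mat q}, A.PosSemidef → A i j =
      ((Pi.single i 1 + (1 : ℝ) • Pi.single j 1) ⬝ᵥ
        (A *ᵥ (Pi.single i 1 + (1 : ℝ) • Pi.single j 1)) - A i i - A j j) / 2 := by
    intro A hA
    have hs : A j i = A i j := congrFun (congrFun (transpose_eq_of_posSemidef hA) i) j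
    rw [quadForm_single_add_smul, hs]
    ring
  set w : Fin q → ℝ := Pi.single i 1 + (1 : ℝ) • Pi.single j 1 with hw
  have hd : ∀ l, ∫ A, g (A.1 + A.2) * A.1 l l ∂wishartPair q n k =
      n / (n + k) * ∫ A, g (A.1 + A.2) * (A.1 + A.2) l l ∂wishartPair q n k := by
    intro l
    have := integral_mul_quadForm hq hn hk hg (Pi.single l 1)
    simpa only [quadForm_single] using this
  have iadd : Integrable (fun A : Mat q × Mat q => w ⬝ᵥ ((A.1 + A.2) *ᵥ w)) (wishartPair q n k) := by
    refine ((integrable_quadForm_fst hn hk w).add (integrable_quadForm_snd hn hk w)).congr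
      (.of_forall fun A => ?_)
    change w ⬝ᵥ (A.1 *ᵥ w) + w ⬝ᵥ (A.2 *ᵥ w) = w ⬝ᵥ ((A.1 + A.2) *ᵥ w)
    rw [Matrix.add_mulVec, dotProduct_add]
  have e1 : ∫ A, g (A.1 + A.2) * A.1 i j ∂wishartPair q n k =
      ∫ A, (g (A.1 + A.2) * (w ⬝ᵥ (A.1 *ᵥ w)) - g (A.1 + A.2) * A.1 i i -
        g (A.1 + A.2) * A.1 j j) / 2 ∂wishartPair q n k := by
    refine integral_congr_ae ?_
    filter_upwards [ae_wishartPair_posSemidef hn hk] with A hA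
    rw [hpol hA.1]; ring
  have e2 : ∫ A, g (A.1 + A.2) * (A.1 + A.2) i j ∂wishartPair q n k =
      ∫ A, (g (A.1 + A.2) * (w ⬝ᵥ ((A.1 + A.2) *ᵥ w)) - g (A.1 + A.2) * (A.1 + A.2) i i -
        g (A.1 + A.2) * (A.1 + A.2) j j) / 2 ∂wishartPair q n k := by
    refine integral_congr_ae ?_
    filter_upwards [ae_wishartPair_posSemidef hn hk] with A hA
    rw [hpol (hA.1.add hA.2)]; ring
  have a1 := hbd (integrable_quadForm_fst hn hk w)
  have a2 := hbd (integrable_entry_fst hn hk i i)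
  have a3 := hbd (integrable_entry_fst hn hk j j)
  have b1 := hbd iadd
  have b2 := hbd (integrable_entry_add hn hk i i)
  have b3 := hbd (integrable_entry_add hn hk j j)
  have a12 : Integrable (fun A : Mat q × Mat q => g (A.1 + A.2) * (w ⬝ᵥ (A.1 *ᵥ w)) -
      g (A.1 + A.2) * A.1 i i) (wishartPair q n k) := a1.sub a2
  have b12 : Integrable (fun A : Mat q × Mat q => g (A.1 + A.2) * (w ⬝ᵥ ((A.1 + A.2) *ᵥ w)) -
      g (A.1 + A.2) * (A.1 + A.2) i i) (wishartPair q n k) := b1.sub b2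
  rw [e1, e2, integral_div, integral_div, integral_sub a12 a3, integral_sub a1 a2,
    integral_sub b12 b3, integral_sub b1 b2, integral_mul_quadForm hq hn hk hg w, hd, hd]
  ring

/-- The matrix beta variable `(R')⁻¹ A₁ R⁻¹`, `R = uchol (A₁ + A₂)`. -/
noncomputable def betaRatio (A : Mat q × Mat q) : Mat q :=
  ((uchol (A.1 + A.2))ᵀ)⁻¹ * A.1 * (uchol (A.1 + A.2))⁻¹

theorem measurable_mat_mul {α : Type*} [MeasurableSpace α] {f g : α → Mat q} (hf : Measurable f)
    (hg : Measurable g) : Measurable fun x => f x * g x := by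
  have h : Measurable fun p : Mat q × Mat q => p.1 * p.2 :=
    (by fun_prop : Continuous fun p : Mat q × Mat q => p.1 * p.2).measurable
  exact h.comp (hf.prodMk hg)

theorem measurable_mat_transpose {α : Type*} [MeasurableSpace α] {f : α → Mat q}
    (hf : Measurable f) : Measurable fun x => (f x)ᵀ := by
  have h : Measurable fun p : Mat q => pᵀ :=
    (by fun_prop : Continuous fun p : Mat q => pᵀ).measurable
  exact h.comp hf

theorem betaRatio_eq (A : Mat q × Mat q) :
    betaRatio A = ((uchol (A.1 + A.2))⁻¹)ᵀ * A.1 * (uchol (A.1 + A.2))⁻¹ := by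
  rw [betaRatio, Matrix.transpose_nonsing_inv]

theorem measurable_uchol_inv : Measurable fun S : Mat q => (uchol S)⁻¹ :=
  measurable_mat_inv.comp measurable_uchol

theorem measurable_betaRatio : Measurable (betaRatio : Mat q × Mat q → Mat q) := by
  have h : Measurable fun A : Mat q × Mat q => (uchol (A.1 + A.2))⁻¹ :=
    measurable_uchol_inv.comp measurable_pair_add
  have := measurable_mat_mul (measurable_mat_mul (measurable_mat_transpose h) measurable_fst) h
  exact (funext betaRatio_eq : betaRatio = _) ▸ this

theorem matrixBeta_eq (n k : ℝ) :
    matrixBeta q (n / 2) (k / 2) = (wishartPair q n k).map betaRatio := by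
  rw [matrixBeta, wishartPair, mul_div_cancel₀ _ two_ne_zero, mul_div_cancel₀ _ two_ne_zero]
  rfl

theorem ae_wishartPair_posDef (hn : (q : ℝ) - 1 < n) (hk : IsWishartDof q k) :
    ∀ᵐ A ∂wishartPair q n k, A.1.PosDef ∧ A.2.PosSemidef ∧ (A.1 + A.2).PosDef := by
  filter_upwards [ae_wishartPair_fst (Or.inr hn) hk (ae_posDef_wishart hn 1),
    ae_wishartPair_snd (Or.inr hn) hk (ae_posSemidef_wishart hk 1)] with A h1 h2
    using ⟨h1, h2, h1.add_posSemidef h2⟩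

theorem uchol_inv_congr {S : Mat q} (hS : S.PosDef) :
    ((uchol S)⁻¹)ᵀ * S * (uchol S)⁻¹ = 1 := by
  have h := uchol_spec hS
  have hu := h.isUnit_det
  have he : ((uchol S)⁻¹)ᵀ * S * (uchol S)⁻¹ =
      ((uchol S)⁻¹)ᵀ * ((uchol S)ᵀ * uchol S) * (uchol S)⁻¹ := by rw [h.transpose_mul_self]
  rw [he, ← Matrix.mul_assoc, Matrix.transpose_nonsing_inv, Matrix.nonsing_inv_mul _
    (by rwa [Matrix.det_transpose]), Matrix.one_mul, Matrix.mul_nonsing_inv _ hu]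

theorem posDef_transpose_mul_mul {L A : Mat q} (hL : L.det ≠ 0) (hA : A.PosDef) :
    (Lᵀ * A * L).PosDef := by
  have := (posDef_congr_iff (L := Lᵀ) (by rwa [Matrix.det_transpose]) A).2 hA
  rwa [Matrix.transpose_transpose] at this

theorem posSemidef_transpose_mul_mul (L : Mat q) {A : Mat q} (hA : A.PosSemidef) :
    (Lᵀ * A * L).PosSemidef := by
  have := hA.conjTranspose_mul_mul_same L
  rwa [Matrix.conjTranspose_eq_transpose_of_trivial] at this

theorem betaRatio_posDef {A : Mat q × Mat q} (h1 : A.1.PosDef) (hS : (A.1 + A.2).PosDef) :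
    (betaRatio A).PosDef := by
  rw [betaRatio_eq]
  refine posDef_transpose_mul_mul ?_ h1
  exact (Matrix.isUnit_nonsing_inv_det _ (uchol_spec hS).isUnit_det).ne_zero

/-- Since I - Ψ = (R')⁻¹A₂R⁻¹ is positive semidefinite, the diagonal of Ψ is at most one, and it
controls the other entries. This bound provides both integrability and the domination used in the
limit. -/
theorem abs_betaRatio_le {A : Mat q × Mat q} (h1 : A.1.PosDef) (h2 : A.2.PosSemidef)
    (hS : (A.1 + A.2).PosDef) (i j : Fin q) : |betaRatio A i j| ≤ 1 := by
  have hsub : (1 - betaRatio A).PosSemidef := by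
    have : 1 - betaRatio A = ((uchol (A.1 + A.2))⁻¹)ᵀ * A.2 * (uchol (A.1 + A.2))⁻¹ := by
      rw [← uchol_inv_congr hS, betaRatio_eq, Matrix.mul_add, Matrix.add_mul, add_sub_cancel_left]
    rw [this]
    exact posSemidef_transpose_mul_mul _ h2
  have hd : ∀ l, betaRatio A l l ≤ 1 := by
    intro l
    have := hsub.dotProduct_mulVec_nonneg (Pi.single l 1)
    rw [star_trivial, quadForm_single] at this
    simpa using this
  have := abs_entry_le_of_posSemidef (betaRatio_posDef h1 hS).posSemidef i j
  linarith [hd i, hd j]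

theorem isProbabilityMeasure_matrixBeta (hn : IsWishartDof q n) (hk : IsWishartDof q k) :
    IsProbabilityMeasure (matrixBeta q (n / 2) (k / 2)) := by
  have := isProbabilityMeasure_wishartPair hn hk
  rw [matrixBeta_eq]
  exact Measure.isProbabilityMeasure_map measurable_betaRatio.aemeasurable

theorem ae_posDef_matrixBeta (hn : (q : ℝ) - 1 < n) (hk : IsWishartDof q k) :
    ∀ᵐ Ψ ∂matrixBeta q (n / 2) (k / 2), Ψ.PosDef := by
  rw [matrixBeta_eq, ae_map_iff measurable_betaRatio.aemeasurable (measurableSet_posDef q)]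
  filter_upwards [ae_wishartPair_posDef hn hk] with A hA using betaRatio_posDef hA.1 hA.2.2

theorem ae_abs_betaRatio_le (hn : (q : ℝ) - 1 < n) (hk : IsWishartDof q k) (i j : Fin q) :
    ∀ᵐ A ∂wishartPair q n k, |betaRatio A i j| ≤ 1 := by
  filter_upwards [ae_wishartPair_posDef hn hk] with A hA using abs_betaRatio_le hA.1 hA.2.1 hA.2.2 i j

theorem integrable_entry_matrixBeta (hn : (q : ℝ) - 1 < n) (hk : IsWishartDof q k)
    (i j : Fin q) : Integrable (fun Ψ : Mat q => Ψ i j) (matrixBeta q (n / 2) (k / 2)) := by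
  have := isProbabilityMeasure_wishartPair (Or.inr hn) hk
  rw [matrixBeta_eq]
  refine (integrable_map_measure (measurable_entry i j).aestronglyMeasurable
    measurable_betaRatio.aemeasurable).2 ?_
  exact (integrable_const (1 : ℝ)).mono'
    ((measurable_entry i j).comp measurable_betaRatio).aestronglyMeasurable
    (ae_abs_betaRatio_le hn hk i j)

open Classical in
-- Each entry of (R')⁻¹A₁R⁻¹ is a combination of entries of A₁ whose coefficients are functions of
-- A₁ + A₂, so the conditional mean identity applies term by term. It asks for bounded coefficients,
-- hence the truncation of R⁻¹. After A₁ has been replaced by A₁ + A₂ the conjugation gives the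
-- identity matrix.
theorem integral_indicator_betaRatio (hq : 1 ≤ q) (hn : (q : ℝ) - 1 < n) (hk : IsWishartDof q k)
    (m : ℝ) (hm : 0 ≤ m) (i j : Fin q) :
    ∫ A, (if ∀ a b, |(uchol (A.1 + A.2))⁻¹ a b| ≤ m then (1 : ℝ) else 0) * betaRatio A i j
        ∂wishartPair q n k =
      n / (n + k) * ∫ A, (if ∀ a b, |(uchol (A.1 + A.2))⁻¹ a b| ≤ m then (1 : ℝ) else 0) *
        (1 : Mat q) i j ∂wishartPair q n k := by
  have hn' : IsWishartDof q n := Or.inr hn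
  set B : Mat q → Mat q := fun S => (uchol S)⁻¹ with hB
  have hBm : Measurable B := measurable_uchol_inv
  set c : Mat q → ℝ := fun S => if ∀ a b, |B S a b| ≤ m then (1 : ℝ) else 0 with hc
  have hcm : Measurable c := by
    refine Measurable.ite ?_ measurable_const measurable_const
    simp only [Set.ofPred_forall]
    refine MeasurableSet.iInter fun a => MeasurableSet.iInter fun b => ?_
    exact measurableSet_le ((measurable_entry a b).comp hBm).abs measurable_const
  set g : Fin q → Fin q → Mat q → ℝ := fun a b S => c S * (B S a i * B S b j) with hg
  have hgm : ∀ a b, Measurable (g a b) := fun a b =>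
    hcm.mul (((measurable_entry a i).comp hBm).mul ((measurable_entry b j).comp hBm))
  have hgb : ∀ a b S, |g a b S| ≤ m * m := by
    intro a b S
    simp only [hg, hc]
    split_ifs with h
    · rw [one_mul, abs_mul]
      exact mul_le_mul (h _ _) (h _ _) (abs_nonneg _) hm
    · simp; positivity
  have hexp : ∀ S X : Mat q, c S * (((B S)ᵀ * X * B S) i j) = ∑ a, ∑ b, g a b S * X a b := by
    intro S X
    rw [Matrix.mul_assoc, Matrix.mul_apply, Finset.mul_sum]
    refine Finset.sum_congr rfl fun a _ => ?_
    rw [Matrix.mul_apply, Matrix.transpose_apply, Finset.mul_sum, Finset.mul_sum]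
    refine Finset.sum_congr rfl fun b _ => ?_
    simp only [hg]; ring
  have hint : ∀ {f : Mat q × Mat q → ℝ} a b, Integrable f (wishartPair q n k) →
      Integrable (fun A => g a b (A.1 + A.2) * f A) (wishartPair q n k) := fun a b hf =>
    hf.bdd_mul ((hgm a b).comp measurable_pair_add).aestronglyMeasurable
      (.of_forall fun A => hgb a b (A.1 + A.2))
  have e1 : ∀ A : Mat q × Mat q, c (A.1 + A.2) * betaRatio A i j =
      ∑ a, ∑ b, g a b (A.1 + A.2) * A.1 a b := fun A => by rw [betaRatio_eq, ← hexp]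
  have e2 : ∀ᵐ A ∂wishartPair q n k, c (A.1 + A.2) * (1 : Mat q) i j =
      ∑ a, ∑ b, g a b (A.1 + A.2) * (A.1 + A.2) a b := by
    filter_upwards [ae_wishartPair_posDef hn hk] with A hA
    rw [← hexp, uchol_inv_congr hA.2.2]
  change ∫ A, c (A.1 + A.2) * betaRatio A i j ∂wishartPair q n k =
    n / (n + k) * ∫ A, c (A.1 + A.2) * (1 : Mat q) i j ∂wishartPair q n k
  rw [integral_congr_ae (.of_forall e1), integral_congr_ae e2, integral_finsetSum _ fun a _ =>
    integrable_finsetSum _ fun b _ => hint a b (integrable_entry_fst hn' hk a b),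
    integral_finsetSum _ fun a _ =>
    integrable_finsetSum _ fun b _ => hint a b (integrable_entry_add hn' hk a b), Finset.mul_sum]
  refine Finset.sum_congr rfl fun a _ => ?_
  rw [integral_finsetSum _ fun b _ => hint a b (integrable_entry_fst hn' hk a b),
    integral_finsetSum _ fun b _ => hint a b (integrable_entry_add hn' hk a b), Finset.mul_sum]
  exact Finset.sum_congr rfl fun b _ => integral_mul_entry_fst hq hn' hk (hgm a b) (hgb a b) a b

/-- The mean of the matrix beta distribution is `n / (n + k)` times the identity. -/
theorem integral_entry_matrixBeta (hq : 1 ≤ q) (hn : (q : ℝ) - 1 < n) (hk : IsWishartDof q k)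
    (i j : Fin q) :
    ∫ Ψ, Ψ i j ∂matrixBeta q (n / 2) (k / 2) = n / (n + k) * (1 : Mat q) i j := by
  classical
  have := isProbabilityMeasure_wishartPair (Or.inr hn) hk
  rw [matrixBeta_eq, integral_map measurable_betaRatio.aemeasurable
    (measurable_entry i j).aestronglyMeasurable]
  set c : ℕ → Mat q × Mat q → ℝ := fun m A =>
    if ∀ a b, |(uchol (A.1 + A.2))⁻¹ a b| ≤ (m : ℝ) then (1 : ℝ) else 0 with hc
  have hBm : ∀ a b, Measurable fun A : Mat q × Mat q => |(uchol (A.1 + A.2))⁻¹ a b| := fun a b =>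
    (((measurable_entry a b).comp measurable_uchol_inv).comp measurable_pair_add).abs
  have hcm : ∀ m, Measurable (c m) := by
    intro m
    refine Measurable.ite ?_ measurable_const measurable_const
    simp only [Set.ofPred_forall]
    exact MeasurableSet.iInter fun a => MeasurableSet.iInter fun b =>
      measurableSet_le (hBm a b) measurable_const
  -- For a fixed pair the truncation is inactive once m exceeds the sum of the absolute entries of
  -- R⁻¹.
  have hcl : ∀ A, Filter.Tendsto (fun m => c m A) Filter.atTop (𝓝 1) := by
    intro A
    refine tendsto_const_nhds.congr' ?_
    obtain ⟨m₀, hm₀⟩ := exists_nat_ge (∑ a, ∑ b, |(uchol (A.1 + A.2))⁻¹ a b|)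
    filter_upwards [Filter.eventually_ge_atTop m₀] with m hm
    simp only [hc]
    rw [if_pos]
    intro a b
    have h1 : |(uchol (A.1 + A.2))⁻¹ a b| ≤ ∑ b, |(uchol (A.1 + A.2))⁻¹ a b| :=
      Finset.single_le_sum (f := fun b => |(uchol (A.1 + A.2))⁻¹ a b|)
        (fun _ _ => abs_nonneg _) (Finset.mem_univ b)
    have h2 : ∑ b, |(uchol (A.1 + A.2))⁻¹ a b| ≤ ∑ a, ∑ b, |(uchol (A.1 + A.2))⁻¹ a b| :=
      Finset.single_le_sum (f := fun a => ∑ b, |(uchol (A.1 + A.2))⁻¹ a b|)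
        (fun _ _ => Finset.sum_nonneg fun _ _ => abs_nonneg _) (Finset.mem_univ a)
    exact (h1.trans h2).trans (hm₀.trans (by exact_mod_cast hm))
  have hc1 : ∀ m A, |c m A| ≤ 1 := by
    intro m A
    simp only [hc]
    split_ifs <;> simp
  have hbm : Measurable fun A : Mat q × Mat q => betaRatio A i j :=
    (measurable_entry i j).comp measurable_betaRatio
  have key : ∀ {f : Mat q × Mat q → ℝ}, Measurable f → (∀ᵐ A ∂wishartPair q n k, |f A| ≤ 1) →
      Filter.Tendsto (fun m => ∫ A, c m A * f A ∂wishartPair q n k) Filter.atTop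
        (𝓝 (∫ A, f A ∂wishartPair q n k)) := by
    intro f hf hf1
    refine tendsto_integral_of_dominated_convergence (fun _ => (1 : ℝ))
      (fun m => ((hcm m).mul hf).aestronglyMeasurable) (integrable_const _) (fun m => ?_)
      (.of_forall fun A => ?_)
    · filter_upwards [hf1] with A hA
      rw [Real.norm_eq_abs, abs_mul]
      exact mul_le_one₀ (hc1 m A) (abs_nonneg _) hA
    · simpa using (hcl A).mul_const (f A)
  have t1 := key hbm (ae_abs_betaRatio_le hn hk i j)
  have t2 := (key (f := fun _ => (1 : Mat q) i j) measurable_const (.of_forall fun A => by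
    rw [Matrix.one_apply]; split_ifs <;> simp)).const_mul (n / (n + k))
  have := tendsto_nhds_unique t1 (t2.congr fun m =>
    (integral_indicator_betaRatio hq hn hk m (Nat.cast_nonneg m) i j).symm)
  rw [this]
  simp

end

end VolatilityProcess

namespace VolatilityProcess

open scoped ENNReal Topology

/-! ### Moments of the beta distribution -/

theorem ae_mem_Ioo_betaMeasure (a b : ℝ) : ∀ᵐ x ∂betaMeasure a b, 0 < x ∧ x < 1 := by
  have hm : Measurable (betaPDF a b) := (measurable_betaPDFReal a b).ennreal_ofReal
  rw [betaMeasure, ae_withDensity_iff hm]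
  refine .of_forall fun x hx => ?_
  by_contra hc
  exact hx (by rw [betaPDF_eq, if_neg hc, ENNReal.ofReal_zero])

/-- Multiplying the Beta(a, b) density by x^s gives a multiple of the Beta(a + s, b) density. The
cases s = 1 and s = 1/2 are the ones needed. -/
theorem lintegral_rpow_betaMeasure {a b s : ℝ} (ha : 0 < a) (hb : 0 < b) (hs : 0 ≤ s) :
    ∫⁻ x, ENNReal.ofReal (x ^ s) ∂betaMeasure a b =
      ENNReal.ofReal (beta (a + s) b / beta a b) := by
  have hm : Measurable (betaPDF a b) := (measurable_betaPDFReal a b).ennreal_ofReal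
  have hm' : Measurable (betaPDF (a + s) b) := (measurable_betaPDFReal (a + s) b).ennreal_ofReal
  have h1 := beta_pos ha hb
  have h2 := beta_pos (add_pos_of_pos_of_nonneg ha hs) hb
  have hxs : Measurable fun x : ℝ => ENNReal.ofReal (x ^ s) := by fun_prop
  rw [betaMeasure, lintegral_withDensity_eq_lintegral_mul _ hm hxs]
  have : ∀ x, (betaPDF a b * fun x : ℝ => ENNReal.ofReal (x ^ s)) x =
      ENNReal.ofReal (beta (a + s) b / beta a b) * betaPDF (a + s) b x := by
    intro x
    rw [Pi.mul_apply, betaPDF_eq, betaPDF_eq]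
    split_ifs with hx
    · have hx1 : 0 < 1 - x := by linarith [hx.2]
      rw [← ENNReal.ofReal_mul (by have := hx.1; positivity), ← ENNReal.ofReal_mul (by positivity)]
      congr 1
      rw [show a + s - 1 = (a - 1) + s by ring, Real.rpow_add hx.1]
      field_simp
    · simp
  rw [lintegral_congr this, lintegral_const_mul _ hm',
    lintegral_betaPDF_eq_one (add_pos_of_pos_of_nonneg ha hs) hb, mul_one]

theorem integrable_rpow_betaMeasure {a b s : ℝ} (ha : 0 < a) (hb : 0 < b) (hs : 0 ≤ s) :
    Integrable (fun x : ℝ => x ^ s) (betaMeasure a b) := by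
  refine (lintegral_ofReal_ne_top_iff_integrable (by fun_prop) ?_).1 ?_
  · filter_upwards [ae_mem_Ioo_betaMeasure a b] with x hx using Real.rpow_nonneg hx.1.le _
  · rw [lintegral_rpow_betaMeasure ha hb hs]
    exact ENNReal.ofReal_ne_top

theorem integral_rpow_betaMeasure {a b s : ℝ} (ha : 0 < a) (hb : 0 < b) (hs : 0 ≤ s) :
    ∫ x, x ^ s ∂betaMeasure a b = beta (a + s) b / beta a b := by
  rw [integral_eq_lintegral_of_nonneg_ae, lintegral_rpow_betaMeasure ha hb hs,
    ENNReal.toReal_ofReal]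
  · exact (div_pos (beta_pos (add_pos_of_pos_of_nonneg ha hs) hb) (beta_pos ha hb)).le
  · filter_upwards [ae_mem_Ioo_betaMeasure a b] with x hx using Real.rpow_nonneg hx.1.le _
  · exact (by fun_prop : Measurable fun x : ℝ => x ^ s).aestronglyMeasurable

theorem beta_div_beta {a b s : ℝ} (ha : 0 < a) (hb : 0 < b) (hs : 0 ≤ s) :
    beta (a + s) b / beta a b =
      Real.Gamma (a + s) * Real.Gamma (a + b) / (Real.Gamma a * Real.Gamma (a + b + s)) := by
  have h1 := Real.Gamma_pos_of_pos ha
  have h2 := Real.Gamma_pos_of_pos hb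
  have h3 := Real.Gamma_pos_of_pos (add_pos ha hb)
  have h4 : 0 < Real.Gamma (a + b + s) := Real.Gamma_pos_of_pos (by positivity)
  rw [beta, beta, show a + s + b = a + b + s by ring]
  field_simp

theorem integrable_betaMeasure {a b : ℝ} (ha : 0 < a) (hb : 0 < b) :
    Integrable (fun x : ℝ => x) (betaMeasure a b) := by
  simpa using integrable_rpow_betaMeasure ha hb zero_le_one

theorem integral_betaMeasure {a b : ℝ} (ha : 0 < a) (hb : 0 < b) :
    ∫ x, x ∂betaMeasure a b = a / (a + b) := by
  have h := integral_rpow_betaMeasure ha hb zero_le_one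
  rw [beta_div_beta ha hb zero_le_one, Real.Gamma_add_one ha.ne',
    Real.Gamma_add_one (add_pos ha hb).ne'] at h
  simp only [Real.rpow_one] at h
  rw [h]
  have h1 := Real.Gamma_pos_of_pos ha
  have h3 := Real.Gamma_pos_of_pos (add_pos ha hb)
  field_simp

theorem integrable_sqrt_betaMeasure {a b : ℝ} (ha : 0 < a) (hb : 0 < b) :
    Integrable (fun x : ℝ => √x) (betaMeasure a b) := by
  simpa [Real.sqrt_eq_rpow] using
    integrable_rpow_betaMeasure ha hb (by norm_num : (0 : ℝ) ≤ 1 / 2)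

theorem integral_sqrt_betaMeasure {a b : ℝ} (ha : 0 < a) (hb : 0 < b) :
    ∫ x, √x ∂betaMeasure a b = Real.Gamma (a + 1 / 2) * Real.Gamma (a + b) /
      (Real.Gamma a * Real.Gamma (a + b + 1 / 2)) := by
  rw [← beta_div_beta ha hb (by norm_num), ← integral_rpow_betaMeasure ha hb (by norm_num)]
  simp only [Real.sqrt_eq_rpow]

/-- Pointwise x < √x on (0, 1), where the law is concentrated; this replaces any inequality between
gamma quotients. -/
theorem integral_lt_integral_sqrt_betaMeasure {a b : ℝ} (ha : 0 < a) (hb : 0 < b) :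
    ∫ x, x ∂betaMeasure a b < ∫ x, √x ∂betaMeasure a b := by
  have := isProbabilityMeasureBeta ha hb
  have hlt : ∀ᵐ x ∂betaMeasure a b, 0 < √x - x := by
    filter_upwards [ae_mem_Ioo_betaMeasure a b] with x hx
    have h1 := Real.sqrt_pos.2 hx.1
    have h2 : √x < 1 := by rw [Real.sqrt_lt' one_pos]; simpa using hx.2
    nlinarith [Real.mul_self_sqrt hx.1.le]
  rw [← sub_pos, ← integral_sub (integrable_sqrt_betaMeasure ha hb) (integrable_betaMeasure ha hb),
    integral_pos_iff_support_of_nonneg_ae (hlt.mono fun x hx => hx.le)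
      ((integrable_sqrt_betaMeasure ha hb).sub (integrable_betaMeasure ha hb))]
  have h0 : betaMeasure a b (Function.support fun x => √x - x)ᶜ = 0 :=
    ae_iff.1 (hlt.mono fun x hx => hx.ne')
  rw [pos_iff_ne_zero]
  intro h
  have h1 : betaMeasure a b Set.univ ≤ 0 := by
    rw [← Set.union_compl_self (Function.support fun x => √x - x)]
    exact (measure_union_le _ _).trans (by rw [h, h0, add_zero])
  simp at h1

/-! ### The gram matrix of the perturbed Bartlett factor -/

/-- Triangularity stops the sum at l = min i j. That last term is split off because it is the only
one containing a diagonal entry of V, hence the only one affected by the beta noise. -/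
theorem gram_upper {q : ℕ} {V : Mat q} (hV : ∀ i j, j < i → V i j = 0) (i j : Fin q) :
    (Vᵀ * V) i j = (∑ l ∈ Finset.Iio (min i j), V l i * V l j) +
      V (min i j) (min i j) * V (min i j) (max i j) := by
  have hc : V (min i j) i * V (min i j) j = V (min i j) (min i j) * V (min i j) (max i j) := by
    rcases le_total i j with h | h
    · rw [min_eq_left h, max_eq_right h]
    · rw [min_eq_right h, max_eq_left h, mul_comm]
  rw [Matrix.mul_apply, ← hc, add_comm, ← Finset.sum_insert (f := fun l => V l i * V l j)
    (Finset.notMem_Iio_self)]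
  simp only [Matrix.transpose_apply]
  symm
  refine Finset.sum_subset (Finset.subset_univ _) fun l _ hl => ?_
  rw [Finset.mem_insert, Finset.mem_Iio, not_or, not_lt] at hl
  have hlt : min i j < l := lt_of_le_of_ne hl.2 (Ne.symm hl.1)
  rcases min_lt_iff.1 hlt with h | h
  · rw [hV l i h, zero_mul]
  · rw [hV l j h, mul_zero]

theorem bbFactor_upper {q : ℕ} {U : Mat q} (hU : ∀ i j, j < i → U i j = 0) (η : Fin q → ℝ) :
    ∀ i j, j < i → bbFactor U η i j = 0 := by
  intro i j h
  rw [bbFactor, Matrix.of_apply, if_neg h.ne', hU i j h]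

theorem gram_bbFactor {q : ℕ} {U : Mat q} (hU : ∀ i j, j < i → U i j = 0) {η : Fin q → ℝ}
    (hη : ∀ i, 0 ≤ η i) (i j : Fin q) :
    ((bbFactor U η)ᵀ * bbFactor U η) i j = (∑ l ∈ Finset.Iio (min i j), U l i * U l j) +
      if i = j then η i * U i i ^ 2 else
        √(η (min i j)) * (U (min i j) (min i j) * U (min i j) (max i j)) := by
  rw [gram_upper (bbFactor_upper hU η)]
  congr 1
  · refine Finset.sum_congr rfl fun l hl => ?_
    rw [Finset.mem_Iio, lt_min_iff] at hl
    rw [bbFactor, Matrix.of_apply, Matrix.of_apply, if_neg hl.1.ne, if_neg hl.2.ne]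
  · split_ifs with h
    · subst h
      rw [min_self, max_self, bbFactor, Matrix.of_apply, if_pos rfl]
      have := Real.mul_self_sqrt (hη i)
      linear_combination (U i i ^ 2) * this
    · have hmm : min i j ≠ max i j := fun e => h (by simpa using e)
      rw [bbFactor, Matrix.of_apply, Matrix.of_apply, if_pos rfl, if_neg hmm, mul_assoc]

/-- The beta noise under the matching condition. -/
noncomputable def betaNoise (q : ℕ) (n k : ℝ) : Measure (Fin q → ℝ) :=
  Measure.pi fun i : Fin q => betaMeasure ((n - (i : ℝ)) / 2) (k / 2)

/-- The matching condition starts the recursion at the fixed point of x ↦ βx + k. -/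
theorem bbDof_matching {n k : ℝ} (h : n + k ≠ 0) (t : ℕ) :
    bbDof (n / (n + k)) k (n + k) t = n + k := by
  induction t with
  | zero => rfl
  | succ t ih => rw [bbDof, ih, div_mul_cancel₀ _ h]

theorem bbNoise_matching {q : ℕ} {n k : ℝ} (h : n + k ≠ 0) :
    bbNoise q (n / (n + k)) (n + k) = betaNoise q n k := by
  unfold bbNoise betaNoise
  congr 1
  funext i
  congr 1
  · rw [div_mul_cancel₀ _ h]; ring
  · field_simp; ring

section

variable {q : ℕ} {n k : ℝ}

theorem dof_sub_pos (hn : (q : ℝ) - 1 < n) (i : Fin q) : 0 < n - (i : ℝ) := by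
  have : ((i : ℕ) : ℝ) + 1 ≤ q := by exact_mod_cast i.2
  linarith

theorem isProbabilityMeasure_betaMeasure_dof (hn : (q : ℝ) - 1 < n) (hk : 0 < k) (i : Fin q) :
    IsProbabilityMeasure (betaMeasure ((n - (i : ℝ)) / 2) (k / 2)) :=
  isProbabilityMeasureBeta (half_pos (dof_sub_pos hn i)) (half_pos hk)

theorem isProbabilityMeasure_betaNoise (hn : (q : ℝ) - 1 < n) (hk : 0 < k) :
    IsProbabilityMeasure (betaNoise q n k) := by
  have := isProbabilityMeasure_betaMeasure_dof hn hk
  unfold betaNoise; infer_instance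

theorem measurePreserving_eval_betaNoise (hn : (q : ℝ) - 1 < n) (hk : 0 < k) (i : Fin q) :
    MeasurePreserving (Function.eval i) (betaNoise q n k)
      (betaMeasure ((n - (i : ℝ)) / 2) (k / 2)) := by
  have := isProbabilityMeasure_betaMeasure_dof hn hk
  exact measurePreserving_eval (fun i : Fin q => betaMeasure ((n - (i : ℝ)) / 2) (k / 2)) i

theorem ae_pos_betaNoise (hn : (q : ℝ) - 1 < n) (hk : 0 < k) :
    ∀ᵐ η ∂betaNoise q n k, ∀ i, 0 < η i := by
  rw [ae_all_iff]
  intro i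
  exact (measurePreserving_eval_betaNoise hn hk i).quasiMeasurePreserving.ae
    ((ae_mem_Ioo_betaMeasure _ _).mono fun x hx => hx.1)

theorem integrable_eval_betaNoise (hn : (q : ℝ) - 1 < n) (hk : 0 < k) (i : Fin q) {f : ℝ → ℝ}
    (hf : Integrable f (betaMeasure ((n - (i : ℝ)) / 2) (k / 2))) :
    Integrable (fun η : Fin q → ℝ => f (η i)) (betaNoise q n k) :=
  (measurePreserving_eval_betaNoise hn hk i).integrable_comp_of_integrable hf

theorem integral_eval_betaNoise (hn : (q : ℝ) - 1 < n) (hk : 0 < k) (i : Fin q) {f : ℝ → ℝ}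
    (hf : Measurable f) :
    ∫ η, f (η i) ∂betaNoise q n k = ∫ x, f x ∂betaMeasure ((n - (i : ℝ)) / 2) (k / 2) := by
  have h := measurePreserving_eval_betaNoise hn hk i
  rw [← h.map_eq, integral_map h.measurable.aemeasurable hf.aestronglyMeasurable]

/-- `E √η_i`. -/
noncomputable def sqrtMean (n k : ℝ) (i : ℝ) : ℝ := ∫ x, √x ∂betaMeasure ((n - i) / 2) (k / 2)

/-- The left side is the mean of η_i itself; for i = 0 it equals the UE factor n/(n+k). -/
theorem lt_sqrtMean (hn : (q : ℝ) - 1 < n) (hk : 0 < k) (i : Fin q) :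
    (n - (i : ℝ)) / (n - i + k) < sqrtMean n k i := by
  have h1 := dof_sub_pos hn i
  refine lt_of_eq_of_lt ?_ (integral_lt_integral_sqrt_betaMeasure (half_pos h1) (half_pos hk))
  rw [integral_betaMeasure (half_pos h1) (half_pos hk)]
  field_simp

theorem gramMean_apply (hn : (q : ℝ) - 1 < n) (hk : 0 < k) (U : Mat q) (i j : Fin q) :
    gramMean n k U i j = (∑ l ∈ Finset.Iio (min i j), U l i * U l j) +
      if i = j then (n - (i : ℝ)) / (n - i + k) * U i i ^ 2 else
        sqrtMean n k (min i j : Fin q) * (U (min i j) (min i j) * U (min i j) (max i j)) := by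
  rw [gramMean, Matrix.of_apply]
  congr 1
  split_ifs
  · rw [show n - ((i : ℝ) + 1) + 1 = n - i by ring]
    ring
  · have h1 := dof_sub_pos hn (min i j)
    rw [sqrtMean, integral_sqrt_betaMeasure (half_pos h1) (half_pos hk)]
    ring_nf

theorem integrable_gram_bbFactor (hn : (q : ℝ) - 1 < n) (hk : 0 < k) {U : Mat q}
    (hU : ∀ i j, j < i → U i j = 0) (i j : Fin q) :
    Integrable (fun η => ((bbFactor U η)ᵀ * bbFactor U η) i j) (betaNoise q n k) ∧
    ∫ η, ((bbFactor U η)ᵀ * bbFactor U η) i j ∂betaNoise q n k = gramMean n k U i j := by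
  have := isProbabilityMeasure_betaNoise hn hk
  have hp := fun l : Fin q => half_pos (dof_sub_pos hn l)
  have hae : ∀ᵐ η ∂betaNoise q n k, ((bbFactor U η)ᵀ * bbFactor U η) i j =
      (∑ l ∈ Finset.Iio (min i j), U l i * U l j) + if i = j then η i * U i i ^ 2 else
        √(η (min i j)) * (U (min i j) (min i j) * U (min i j) (max i j)) := by
    filter_upwards [ae_pos_betaNoise hn hk] with η hη
      using gram_bbFactor hU (fun i => (hη i).le) i j
  rw [integral_congr_ae hae, integrable_congr hae, gramMean_apply hn hk]
  split_ifs with h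
  · have hi := (integrable_eval_betaNoise hn hk i
      (integrable_betaMeasure (hp i) (half_pos hk))).mul_const (U i i ^ 2)
    refine ⟨(integrable_const _).add hi, ?_⟩
    rw [integral_add (integrable_const _) hi, integral_mul_const,
      integral_eval_betaNoise hn hk i (f := fun x => x) measurable_id,
      integral_betaMeasure (hp i) (half_pos hk)]
    have := dof_sub_pos hn i
    simp only [integral_const, probReal_univ, one_smul]
    congr 2
    field_simp
  · have hi := (integrable_eval_betaNoise hn hk (min i j)
      (integrable_sqrt_betaMeasure (hp (min i j)) (half_pos hk))).mul_const
        (U (min i j) (min i j) * U (min i j) (max i j))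
    refine ⟨(integrable_const _).add hi, ?_⟩
    rw [integral_add (integrable_const _) hi, integral_mul_const,
      integral_eval_betaNoise hn hk (min i j) (f := fun x => √x) (by fun_prop), sqrtMean]
    simp only [integral_const, probReal_univ, one_smul]

/-! ### Means of the transition laws -/

theorem integral_congruence {α : Type*} [MeasurableSpace α] {ν : Measure α} {X : α → Mat q}
    {m : Mat q} (hX : ∀ a b, Integrable (fun x => X x a b) ν ∧ ∫ x, X x a b ∂ν = m a b)
    (c : ℝ) (L : Mat q) (i j : Fin q) :
    Integrable (fun x => (c • (Lᵀ * X x * L)) i j) ν ∧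
      ∫ x, (c • (Lᵀ * X x * L)) i j ∂ν = (c • (Lᵀ * m * L)) i j := by
  have hexp : ∀ Y : Mat q, (c • (Lᵀ * Y * L)) i j = ∑ a, ∑ b, (c * L a i * L b j) * Y a b := by
    intro Y
    rw [Matrix.smul_apply, Matrix.mul_assoc, Matrix.mul_apply, smul_eq_mul, Finset.mul_sum]
    refine Finset.sum_congr rfl fun a _ => ?_
    rw [Matrix.mul_apply, Matrix.transpose_apply, Finset.mul_sum, Finset.mul_sum]
    exact Finset.sum_congr rfl fun b _ => by ring
  simp only [hexp]
  have hi : ∀ a b, Integrable (fun x => (c * L a i * L b j) * X x a b) ν := fun a b =>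
    (hX a b).1.const_mul _
  refine ⟨integrable_finsetSum _ fun a _ => integrable_finsetSum _ fun b _ => hi a b, ?_⟩
  rw [integral_finsetSum _ fun a _ => integrable_finsetSum _ fun b _ => hi a b]
  refine Finset.sum_congr rfl fun a _ => ?_
  rw [integral_finsetSum _ fun b _ => hi a b]
  exact Finset.sum_congr rfl fun b _ => by rw [integral_const_mul, (hX a b).2]

theorem measurable_bbFactor : Measurable fun p : Mat q × (Fin q → ℝ) => bbFactor p.1 p.2 := by
  refine measurable_mat fun i j => ?_
  simp only [bbFactor, Matrix.of_apply]
  split_ifs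
  · exact (Real.continuous_sqrt.measurable.comp
      ((measurable_pi_apply i).comp measurable_snd)).mul ((measurable_entry i i).comp measurable_fst)
  · exact (measurable_entry i j).comp measurable_fst

theorem measurable_congruence (c : ℝ) (L : Mat q) :
    Measurable fun X : Mat q => c • (Lᵀ * X * L) :=
  (by fun_prop : Continuous fun X : Mat q => c • (Lᵀ * X * L)).measurable

theorem ueTransition_mean (hq : 1 ≤ q) (hn : (q : ℝ) - 1 < n) (hk : IsWishartDof q k) (lam : ℝ)
    (D Φ : Mat q) (i j : Fin q) :
    let P := scaleFactor k D
    let U := bartlettFactor P Φ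
    Integrable (fun A : Mat q => A i j) (ueTransition lam n k D Φ) ∧
      ∫ A, A i j ∂ueTransition lam n k D Φ =
        (lam⁻¹ • (Pᵀ * ((n / (n + k)) • (Uᵀ * U)) * P)) i j := by
  intro P U
  have h := integral_congruence (ν := matrixBeta q (n / 2) (k / 2)) (X := id)
    (m := (n / (n + k)) • 1) (fun a b => ⟨integrable_entry_matrixBeta hn hk a b,
      integral_entry_matrixBeta hq hn hk a b⟩) lam⁻¹ (U * P) i j
  have hm := measurable_congruence lam⁻¹ (U * P)
  have he := (measurable_entry (q := q) i j).aestronglyMeasurable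
    (μ := (matrixBeta q (n / 2) (k / 2)).map fun Ψ => lam⁻¹ • ((U * P)ᵀ * Ψ * (U * P)))
  have h2 : (U * P)ᵀ * ((n / (n + k)) • (1 : Mat q)) * (U * P) =
      Pᵀ * ((n / (n + k)) • (Uᵀ * U)) * P := by
    rw [Matrix.transpose_mul, Matrix.mul_smul, Matrix.mul_one, Matrix.mul_smul, Matrix.smul_mul,
      Matrix.smul_mul, Matrix.mul_assoc, Matrix.mul_assoc, Matrix.mul_assoc]
  rw [h2] at h
  refine ⟨(integrable_map_measure he hm.aemeasurable).2 h.1, ?_⟩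
  exact (integral_map hm.aemeasurable he).trans h.2

theorem bbTransition_mean (hn : (q : ℝ) - 1 < n) (hk : 0 < k) (b : ℝ) {D Φ : Mat q}
    (hU : ∀ i j, j < i → bartlettFactor (scaleFactor k D) Φ i j = 0) (hnk : n + k ≠ 0)
    (i j : Fin q) :
    let P := scaleFactor k D
    let U := bartlettFactor P Φ
    Integrable (fun A : Mat q => A i j) (bbTransition (n / (n + k)) b k (n + k) D Φ) ∧
      ∫ A, A i j ∂bbTransition (n / (n + k)) b k (n + k) D Φ =
        (b⁻¹ • (Pᵀ * gramMean n k U * P)) i j := by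
  intro P U
  have h := integral_congruence (ν := betaNoise q n k)
    (X := fun η => (bbFactor U η)ᵀ * bbFactor U η)
    (m := gramMean n k U) (fun i j => integrable_gram_bbFactor hn hk hU i j) b⁻¹ P i j
  have h1 : ∀ η, b⁻¹ • (Pᵀ * ((bbFactor U η)ᵀ * bbFactor U η) * P) =
      b⁻¹ • ((bbFactor U η * P)ᵀ * (bbFactor U η * P)) := fun η => by
    rw [Matrix.transpose_mul, Matrix.mul_assoc, Matrix.mul_assoc, Matrix.mul_assoc]
  simp only [h1] at h
  have hb : Measurable fun η : Fin q → ℝ => bbFactor U η :=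
    measurable_bbFactor.comp measurable_prodMk_left
  have hm : Measurable fun η => b⁻¹ • ((bbFactor U η * P)ᵀ * (bbFactor U η * P)) := by
    have hc : Measurable fun X : Mat q => b⁻¹ • ((X * P)ᵀ * (X * P)) :=
      (by fun_prop : Continuous fun X : Mat q => b⁻¹ • ((X * P)ᵀ * (X * P))).measurable
    exact hc.comp hb
  rw [bbTransition, bbNoise_matching hnk]
  have he := (measurable_entry (q := q) i j).aestronglyMeasurable
    (μ := (betaNoise q n k).map fun η => b⁻¹ • ((bbFactor U η * P)ᵀ * (bbFactor U η * P)))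
  refine ⟨(integrable_map_measure he hm.aemeasurable).2 h.1, ?_⟩
  exact (integral_map hm.aemeasurable he).trans h.2

end

end VolatilityProcess

namespace VolatilityProcess

open scoped ENNReal Topology

section

variable {q : ℕ} {n k : ℝ}

/-! ### Comparison of the conditional means -/

theorem isCholesky_scaleFactor (hk : 0 < k) {D : Mat q} (hD : D.PosDef) :
    IsCholesky ((k • D)⁻¹) (scaleFactor k D) :=
  uchol_spec (hD.smul hk).inv

theorem isCholesky_bartlettFactor {P Φ : Mat q} (hP : P.det ≠ 0) (hΦ : Φ.PosDef) :
    IsCholesky ((P⁻¹)ᵀ * Φ * P⁻¹) (bartlettFactor P Φ) :=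
  uchol_spec (posDef_transpose_mul_mul
    (Matrix.isUnit_nonsing_inv_det _ hP.isUnit).ne_zero hΦ)

/-- The difference of the means of `U' Ψ U` and `Ũ' Ũ`. -/
noncomputable def gramDiff (n k : ℝ) (U : Mat q) : Mat q :=
  (n / (n + k)) • (Uᵀ * U) - gramMean n k U

theorem gramDiff_apply (hn : (q : ℝ) - 1 < n) (hk : 0 < k) {U : Mat q}
    (hU : ∀ i j, j < i → U i j = 0) (i j : Fin q) :
    gramDiff n k U i j = (n / (n + k) - 1) * (∑ l ∈ Finset.Iio (min i j), U l i * U l j) +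
      (if i = j then (n / (n + k) - (n - (i : ℝ)) / (n - i + k)) * U i i ^ 2 else
        (n / (n + k) - sqrtMean n k (min i j : Fin q)) *
          (U (min i j) (min i j) * U (min i j) (max i j))) := by
  rw [gramDiff, Matrix.sub_apply, Matrix.smul_apply, gram_upper hU, gramMean_apply hn hk,
    smul_eq_mul]
  split_ifs with h
  · subst h
    rw [min_self, max_self]
    ring
  · ring

/-- x ↦ x/(x + k) is strictly increasing. The first index is excluded because there the two sides
coincide. -/
theorem dof_ratio_lt (hn : (q : ℝ) - 1 < n) (hk : 0 < k) {i : Fin q} (hi : 1 ≤ (i : ℕ)) :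
    (n - (i : ℝ)) / (n - i + k) < n / (n + k) := by
  have h1 := dof_sub_pos hn i
  have h2 : (1 : ℝ) ≤ (i : ℕ) := by exact_mod_cast hi
  rw [div_lt_div_iff₀ (by positivity) (by linarith)]
  nlinarith

theorem gramDiff_eq_diagonal (hn : (q : ℝ) - 1 < n) (hk : 0 < k) {U : Mat q} (hd : U.IsDiag) :
    gramDiff n k U = Matrix.diagonal fun i : Fin q =>
      (n / (n + k) - (n - (i : ℝ)) / (n - i + k)) * U i i ^ 2 := by
  have hU : ∀ i j, j < i → U i j = 0 := fun i j h => hd h.ne'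
  ext i j
  have h0 : ∑ l ∈ Finset.Iio (min i j), U l i * U l j = 0 :=
    Finset.sum_eq_zero fun l hl => by
      rw [Finset.mem_Iio, lt_min_iff] at hl
      rw [hd hl.1.ne, zero_mul]
  rw [gramDiff_apply hn hk hU, h0, mul_zero, zero_add, Matrix.diagonal_apply]
  split_ifs with h
  · rfl
  · rw [hd (fun e => h (by simpa using e) : min i j ≠ max i j), mul_zero, mul_zero]

/-- Two entries suffice. If the (0, 1) entry vanishes then u_01 = 0, because E √η_0 exceeds n/(n+k)
and u_00 > 0. The sum in the (1, 1) entry then disappears and a positive multiple of u_11² is left.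
-/
theorem gramDiff_ne_zero (hn : (q : ℝ) - 1 < n) (hk : 0 < k) (hq : 2 ≤ q) {U : Mat q}
    (hU : ∀ i j, j < i → U i j = 0) (hpos : ∀ i, 0 < U i i) : gramDiff n k U ≠ 0 := by
  intro h
  set i₀ : Fin q := ⟨0, by omega⟩ with hi0
  set i₁ : Fin q := ⟨1, by omega⟩ with hi1
  have hlt : i₀ < i₁ := by rw [Fin.lt_def]; simp [hi0, hi1]
  have hIio : Finset.Iio i₀ = ∅ := by
    rw [Finset.eq_empty_iff_forall_notMem]
    intro l hl
    rw [Finset.mem_Iio, Fin.lt_def] at hl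
    simp [hi0] at hl
  have h01 := congrFun (congrFun h i₀) i₁
  rw [gramDiff_apply hn hk hU, if_neg hlt.ne, min_eq_left hlt.le, max_eq_right hlt.le, hIio,
    Finset.sum_empty, mul_zero, zero_add, Matrix.zero_apply] at h01
  have hs := lt_sqrtMean hn hk i₀
  rw [show ((i₀ : ℕ) : ℝ) = 0 by simp [hi0], sub_zero] at hs
  rw [show ((i₀ : ℕ) : ℝ) = 0 by simp [hi0]] at h01
  have hu : U i₀ i₁ = 0 := by
    rcases mul_eq_zero.1 h01 with h' | h'
    · linarith
    · exact (mul_eq_zero.1 h').resolve_left (hpos i₀).ne'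
  have h11 := congrFun (congrFun h i₁) i₁
  have hsum : ∑ l ∈ Finset.Iio i₁, U l i₁ * U l i₁ = 0 :=
    Finset.sum_eq_zero fun l hl => by
      rw [Finset.mem_Iio, Fin.lt_def] at hl
      have : l = i₀ := by apply Fin.ext; simp [hi0, hi1] at hl ⊢; omega
      rw [this, hu, zero_mul]
  rw [gramDiff_apply hn hk hU, if_pos rfl, min_self, hsum, mul_zero, zero_add,
    Matrix.zero_apply] at h11
  have h1 := dof_ratio_lt hn hk (i := i₁) (by simp [hi1])
  rcases mul_eq_zero.1 h11 with h' | h'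
  · linarith
  · exact (hpos i₁).ne' (by simpa using h')

/-- P need not be diagonal, so the entry is a sum over l of g_l p_li², where g_l is the l-th
diagonal entry of the Gram difference. All g_l are nonnegative (g_0 = 0), and the term l = i is
positive. -/
theorem diag_congruence_gramDiff_pos (hn : (q : ℝ) - 1 < n) (hk : 0 < k) {U P : Mat q}
    (hd : U.IsDiag) (hUpos : ∀ i, 0 < U i i) (hPpos : ∀ i, 0 < P i i) {i : Fin q}
    (hi : 1 ≤ (i : ℕ)) : 0 < (Pᵀ * gramDiff n k U * P) i i := by
  rw [gramDiff_eq_diagonal hn hk hd, Matrix.mul_assoc, Matrix.mul_apply]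
  simp only [Matrix.diagonal_mul, Matrix.transpose_apply]
  refine Finset.sum_pos' (fun l _ => ?_) ⟨i, Finset.mem_univ _, ?_⟩
  · have h0 : 0 ≤ n / (n + k) - (n - (l : ℝ)) / (n - l + k) := by
      rcases Nat.eq_zero_or_pos (l : ℕ) with h | h
      · simp [h]
      · exact (sub_pos.2 (dof_ratio_lt hn hk h)).le
    nlinarith [mul_nonneg h0 (mul_nonneg (sq_nonneg (U l l)) (mul_self_nonneg (P l i)))]
  · have h0 := sub_pos.2 (dof_ratio_lt hn hk hi)
    have h1 := hUpos i
    have h2 := hPpos i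
    positivity

theorem transition_mean_sub (hq : 1 ≤ q) (hn : (q : ℝ) - 1 < n) (hk : IsWishartDof q k) (lam : ℝ)
    {D Φ : Mat q} (hU : ∀ i j, j < i → bartlettFactor (scaleFactor k D) Φ i j = 0) (i j : Fin q) :
    (∫ A, A i j ∂ueTransition lam n k D Φ) -
        ∫ A, A i j ∂bbTransition (n / (n + k)) lam k (n + k) D Φ =
      (lam⁻¹ • ((scaleFactor k D)ᵀ * gramDiff n k (bartlettFactor (scaleFactor k D) Φ) *
        scaleFactor k D)) i j := by
  have hk0 := hk.pos hq
  have hn0 : 0 < n := IsWishartDof.pos hq (Or.inr hn)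
  rw [(ueTransition_mean hq hn hk lam D Φ i j).2,
    (bbTransition_mean hn hk0 lam hU (by positivity) i j).2, gramDiff, Matrix.mul_sub,
    Matrix.sub_mul, smul_sub, Matrix.sub_apply]

/-- The matrix of differences is λ⁻¹P'GP with P invertible, so it can vanish only together with G,
which `gramDiff_ne_zero` rules out. -/
theorem exists_transition_mean_ne (hq : 2 ≤ q) (hn : (q : ℝ) - 1 < n) (hk : IsWishartDof q k)
    {lam : ℝ} (hlam : lam ≠ 0) {D Φ : Mat q} (hD : D.PosDef) (hΦ : Φ.PosDef) :
    ∃ i j, (∫ A, A i j ∂ueTransition lam n k D Φ) ≠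
      ∫ A, A i j ∂bbTransition (n / (n + k)) lam k (n + k) D Φ := by
  have hk0 := hk.pos (by omega)
  have hP := isCholesky_scaleFactor hk0 hD
  have hU := isCholesky_bartlettFactor hP.isUnit_det.ne_zero hΦ
  set P := scaleFactor k D with hPdef
  by_contra! h
  have h0 : lam⁻¹ • (Pᵀ * gramDiff n k (bartlettFactor P Φ) * P) = 0 := by
    ext i j
    rw [← transition_mean_sub (by omega) hn hk lam hU.1 i j, h i j, sub_self, Matrix.zero_apply]
  have h1 := (smul_eq_zero.1 h0).resolve_left (inv_ne_zero hlam)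
  refine gramDiff_ne_zero hn hk0 hq hU.1 hU.2.1 ?_
  have hPu := hP.isUnit_det
  have hPtu : IsUnit (Pᵀ).det := by rwa [Matrix.det_transpose]
  set G := gramDiff n k (bartlettFactor P Φ)
  calc G = (Pᵀ)⁻¹ * (Pᵀ * G * P) * P⁻¹ := by
        rw [Matrix.mul_assoc, Matrix.mul_assoc, Matrix.mul_assoc, Matrix.mul_nonsing_inv _ hPu,
          Matrix.mul_one, ← Matrix.mul_assoc, Matrix.nonsing_inv_mul _ hPtu, Matrix.one_mul]
    _ = 0 := by rw [h1, Matrix.mul_zero, Matrix.zero_mul]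

theorem ueTransition_ne_bbTransition (hq : 2 ≤ q) (hn : (q : ℝ) - 1 < n) (hk : IsWishartDof q k)
    {lam : ℝ} (hlam : lam ≠ 0) {D Φ : Mat q} (hD : D.PosDef) (hΦ : Φ.PosDef) :
    ueTransition lam n k D Φ ≠ bbTransition (n / (n + k)) lam k (n + k) D Φ := by
  obtain ⟨i, j, hij⟩ := exists_transition_mean_ne hq hn hk hlam hD hΦ
  exact fun h => hij (by rw [h])

/-- The comparison of the two state evolutions at a common state and a common scale matrix. -/
theorem transition_comparison (hq : 1 ≤ q) (hn : (q : ℝ) - 1 < n) (hk : IsWishartDof q k)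
    {lam : ℝ} (hlam : 0 < lam) {D Φ P U : Mat q} (hD : D.PosDef) (hΦ : Φ.PosDef)
    (hP : P = scaleFactor k D) (hU : U = bartlettFactor P Φ) :
    (∀ i j,
        Integrable (fun A : Mat q => A i j) (ueTransition lam n k D Φ) ∧
        Integrable (fun A : Mat q => A i j) (bbTransition (n / (n + k)) lam k (n + k) D Φ) ∧
        (∫ A, A i j ∂(ueTransition lam n k D Φ)) -
            (∫ A, A i j ∂(bbTransition (n / (n + k)) lam k (n + k) D Φ)) =
          (lam⁻¹ • (Pᵀ * ((n / (n + k)) • (Uᵀ * U) - gramMean n k U) * P)) i j ∧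
        Integrable (fun η => ((bbFactor U η)ᵀ * bbFactor U η) i j)
          (bbNoise q (n / (n + k)) (n + k)) ∧
        (∫ η, ((bbFactor U η)ᵀ * bbFactor U η) i j ∂(bbNoise q (n / (n + k)) (n + k))) =
          gramMean n k U i j) ∧
      (U.IsDiag → ∀ i : Fin q, 1 ≤ (i : ℕ) →
        (∫ η, ((bbFactor U η)ᵀ * bbFactor U η) i i ∂(bbNoise q (n / (n + k)) (n + k))) =
          (n - ((i : ℝ) + 1) + 1) * U i i ^ 2 / (n - ((i : ℝ) + 1) + 1 + k) ∧
        (n - ((i : ℝ) + 1) + 1) * U i i ^ 2 / (n - ((i : ℝ) + 1) + 1 + k) ≠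
          n * U i i ^ 2 / (n + k) ∧
        (∫ A, A i i ∂(ueTransition lam n k D Φ)) ≠
          ∫ A, A i i ∂(bbTransition (n / (n + k)) lam k (n + k) D Φ)) ∧
      (2 ≤ q →
        (∃ i j, (∫ A, A i j ∂(ueTransition lam n k D Φ)) ≠
          ∫ A, A i j ∂(bbTransition (n / (n + k)) lam k (n + k) D Φ)) ∧
        ueTransition lam n k D Φ ≠ bbTransition (n / (n + k)) lam k (n + k) D Φ) := by
  have hk0 := hk.pos hq
  have hn0 : 0 < n := IsWishartDof.pos hq (Or.inr hn)
  have hnk : n + k ≠ 0 := by positivity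
  have hPc : IsCholesky ((k • D)⁻¹) P := hP ▸ isCholesky_scaleFactor hk0 hD
  have hUc : IsCholesky ((P⁻¹)ᵀ * Φ * P⁻¹) U :=
    hU ▸ isCholesky_bartlettFactor hPc.isUnit_det.ne_zero hΦ
  have hUu : ∀ i j, j < i → bartlettFactor (scaleFactor k D) Φ i j = 0 := by
    rw [← hP, ← hU]; exact hUc.1
  have hsub : ∀ i j, (∫ A, A i j ∂(ueTransition lam n k D Φ)) -
      (∫ A, A i j ∂(bbTransition (n / (n + k)) lam k (n + k) D Φ)) =
      (lam⁻¹ • (Pᵀ * gramDiff n k U * P)) i j := fun i j => by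
    rw [transition_mean_sub hq hn hk lam hUu i j, hU, hP]
  refine ⟨fun i j => ⟨(ueTransition_mean hq hn hk lam D Φ i j).1,
    (bbTransition_mean hn hk0 lam hUu hnk i j).1, hsub i j, ?_⟩, fun hd i hi => ?_,
    fun hq2 => ⟨exists_transition_mean_ne hq2 hn hk hlam.ne' hD hΦ,
      ueTransition_ne_bbTransition hq2 hn hk hlam.ne' hD hΦ⟩⟩
  · rw [bbNoise_matching hnk]
    exact integrable_gram_bbFactor hn hk0 hUc.1 i j
  · have hr := dof_ratio_lt hn hk0 hi
    have hUi := hUc.2.1 i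
    refine ⟨?_, ?_, ?_⟩
    · rw [bbNoise_matching hnk, (integrable_gram_bbFactor hn hk0 hUc.1 i i).2, gramMean,
        Matrix.of_apply, if_pos rfl, min_self, Finset.sum_eq_zero, zero_add]
      intro l hl
      rw [hd (Finset.mem_Iio.1 hl).ne, zero_mul]
    · rw [show n - ((i : ℝ) + 1) + 1 = n - i by ring, mul_div_right_comm, mul_div_right_comm]
      intro h
      exact hr.ne (mul_right_cancel₀ (by positivity) h)
    · intro h
      have h1 := hsub i i
      rw [h, sub_self, Matrix.smul_apply, smul_eq_mul] at h1
      have h2 := diag_congruence_gramDiff_pos hn hk0 hd hUc.2.1 hPc.2.1 hi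
      have : 0 < lam⁻¹ * (Pᵀ * gramDiff n k U * P) i i := by positivity
      linarith

/-! ### Positivity and total mass of the transition laws -/

theorem isProbabilityMeasure_ueTransition (hn : (q : ℝ) - 1 < n) (hk : IsWishartDof q k)
    (lam : ℝ) (D Φ : Mat q) : IsProbabilityMeasure (ueTransition lam n k D Φ) := by
  have := isProbabilityMeasure_matrixBeta (Or.inr hn) hk
  exact Measure.isProbabilityMeasure_map (measurable_congruence _ _).aemeasurable

theorem ae_posDef_ueTransition (hq : 1 ≤ q) (hn : (q : ℝ) - 1 < n) (hk : IsWishartDof q k)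
    {lam : ℝ} (hlam : 0 < lam) {D Φ : Mat q} (hD : D.PosDef) (hΦ : Φ.PosDef) :
    ∀ᵐ A ∂ueTransition lam n k D Φ, A.PosDef := by
  have hP := isCholesky_scaleFactor (hk.pos hq) hD
  have hU := isCholesky_bartlettFactor hP.isUnit_det.ne_zero hΦ
  rw [ueTransition, ae_map_iff (measurable_congruence _ _).aemeasurable (measurableSet_posDef q)]
  filter_upwards [ae_posDef_matrixBeta hn hk] with Ψ hΨ
  refine (posDef_transpose_mul_mul ?_ hΨ).smul (inv_pos.2 hlam)
  rw [Matrix.det_mul]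
  exact mul_ne_zero hU.isUnit_det.ne_zero hP.isUnit_det.ne_zero

theorem measurable_bbState (b : ℝ) (U P : Mat q) :
    Measurable fun η => b⁻¹ • ((bbFactor U η * P)ᵀ * (bbFactor U η * P)) := by
  have hb : Measurable fun η : Fin q → ℝ => bbFactor U η :=
    measurable_bbFactor.comp measurable_prodMk_left
  have hc : Measurable fun X : Mat q => b⁻¹ • ((X * P)ᵀ * (X * P)) :=
    (by fun_prop : Continuous fun X : Mat q => b⁻¹ • ((X * P)ᵀ * (X * P))).measurable
  exact hc.comp hb

theorem isProbabilityMeasure_bbTransition (hn : (q : ℝ) - 1 < n) (hk : 0 < k)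
    (hnk : n + k ≠ 0) (b : ℝ) (D Φ : Mat q) :
    IsProbabilityMeasure (bbTransition (n / (n + k)) b k (n + k) D Φ) := by
  have := isProbabilityMeasure_betaNoise hn hk
  rw [bbTransition, bbNoise_matching hnk]
  exact Measure.isProbabilityMeasure_map (measurable_bbState _ _ _).aemeasurable

theorem ae_posDef_bbTransition (hn : (q : ℝ) - 1 < n) (hk : 0 < k) (hnk : n + k ≠ 0)
    {b : ℝ} (hb : 0 < b) {D Φ : Mat q} (hD : D.PosDef) (hΦ : Φ.PosDef) :
    ∀ᵐ A ∂bbTransition (n / (n + k)) b k (n + k) D Φ, A.PosDef := by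
  have hP := isCholesky_scaleFactor hk hD
  have hU := isCholesky_bartlettFactor hP.isUnit_det.ne_zero hΦ
  rw [bbTransition, bbNoise_matching hnk,
    ae_map_iff (measurable_bbState _ _ _).aemeasurable (measurableSet_posDef q)]
  filter_upwards [ae_pos_betaNoise hn hk] with η hη
  have hV : IsCholesky _ (bbFactor (bartlettFactor (scaleFactor k D) Φ) η) :=
    ⟨bbFactor_upper hU.1 η, fun i => by
      rw [bbFactor, Matrix.of_apply, if_pos rfl]
      exact mul_pos (Real.sqrt_pos.2 (hη i)) (hU.2.1 i), rfl⟩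
  have : (bbFactor (bartlettFactor (scaleFactor k D) Φ) η * scaleFactor k D)ᵀ *
      (bbFactor (bartlettFactor (scaleFactor k D) Φ) η * scaleFactor k D) =
      (scaleFactor k D)ᵀ * ((bbFactor (bartlettFactor (scaleFactor k D) Φ) η)ᵀ *
        bbFactor (bartlettFactor (scaleFactor k D) Φ) η) * scaleFactor k D := by
    rw [Matrix.transpose_mul, Matrix.mul_assoc, Matrix.mul_assoc, Matrix.mul_assoc]
  rw [this]
  exact (posDef_transpose_mul_mul hP.isUnit_det.ne_zero hV.posDef).smul (inv_pos.2 hb)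

end

end VolatilityProcess

namespace VolatilityProcess

open scoped ENNReal

/-! ### Conditional distributions -/

section

variable {Ω α 𝒳 𝒴 : Type*} [MeasurableSpace Ω] [MeasurableSpace α] [MeasurableSpace 𝒳]
  [MeasurableSpace 𝒴] {μ : Measure Ω}

/-- The hypothesis controls the conditional law only along the sample points X ω, which is all that
integrals against the law of X can detect. -/
theorem hasCondDistrib_of_ae_eq [StandardBorelSpace 𝒴] [Nonempty 𝒴] [IsFiniteMeasure μ]
    {X : Ω → 𝒳} {Y : Ω → 𝒴} (hX : Measurable X) (hY : Measurable Y) {κ : Kernel 𝒳 𝒴}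
    [IsSFiniteKernel κ] (h : ∀ᵐ ω ∂μ, condDistrib Y X μ (X ω) = κ (X ω)) :
    HasCondDistrib Y X κ μ where
  aemeasurable := (hX.prodMk hY).aemeasurable
  map_eq := by
    rw [← compProd_map_condDistrib hY.aemeasurable]
    ext s hs
    rw [Measure.compProd_apply hs, Measure.compProd_apply hs,
      lintegral_map (Kernel.measurable_kernel_prodMk_left hs) hX,
      lintegral_map (Kernel.measurable_kernel_prodMk_left hs) hX]
    refine lintegral_congr_ae ?_
    filter_upwards [h] with ω hω
    rw [hω]

theorem condDistrib_ae_eq_of_hasCondDistrib [StandardBorelSpace 𝒴] [Nonempty 𝒴]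
    [IsFiniteMeasure μ] {X : Ω → 𝒳} {Y : Ω → 𝒴} {κ : Kernel 𝒳 𝒴} [IsFiniteKernel κ]
    (h : HasCondDistrib Y X κ μ) : ∀ᵐ x ∂μ.map X, condDistrib Y X μ x = κ x :=
  condDistrib_ae_eq_of_measure_eq_compProd X h.aemeasurable_snd h.map_eq

theorem hasCondDistrib_condDistrib [StandardBorelSpace 𝒴] [Nonempty 𝒴]
    [IsFiniteMeasure μ] {X : Ω → 𝒳} {Y : Ω → 𝒴} (hX : Measurable X) (hY : Measurable Y) :
    HasCondDistrib Y X (condDistrib Y X μ) μ :=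
  hasCondDistrib_of_ae_eq hX hY (.of_forall fun _ => rfl)

theorem hasCondDistrib_compProd [SFinite μ] {X : Ω → α} {Y : Ω → 𝒳} {Z : Ω → 𝒴}
    {κ : Kernel α 𝒳} [IsSFiniteKernel κ] {η : Kernel (α × 𝒳) 𝒴} [IsSFiniteKernel η]
    (h1 : HasCondDistrib Y X κ μ) (h2 : HasCondDistrib Z (fun ω => (X ω, Y ω)) η μ) :
    HasCondDistrib (fun ω => (Y ω, Z ω)) X (κ ⊗ₖ η) μ where
  aemeasurable := h1.aemeasurable_fst.prodMk (h1.aemeasurable_snd.prodMk h2.aemeasurable_snd)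
  map_eq := by
    rw [← Measure.compProd_assoc', ← h1.map_eq, ← h2.map_eq,
      AEMeasurable.map_map_of_aemeasurable MeasurableEquiv.prodAssoc.measurable.aemeasurable
        h2.aemeasurable]
    rfl

theorem ae_of_ae_condDistrib [StandardBorelSpace 𝒴] [Nonempty 𝒴] [IsFiniteMeasure μ]
    {X : Ω → 𝒳} {Y : Ω → 𝒴} (hX : Measurable X) (hY : Measurable Y) {p : 𝒴 → Prop}
    (hp : MeasurableSet {y | p y})
    (h : ∀ᵐ ω ∂μ, ∀ᵐ y ∂condDistrib Y X μ (X ω), p y) : ∀ᵐ ω ∂μ, p (Y ω) := by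
  have h1 : ∀ᵐ ω ∂μ, condDistrib Y X μ (X ω) {y | p y}ᶜ = 0 := h
  have h2 := setLIntegral_preimage_condDistrib (μ := μ) hX hY.aemeasurable hp.compl
    MeasurableSet.univ
  rw [Set.preimage_univ, Measure.restrict_univ, Set.univ_inter, lintegral_congr_ae h1,
    lintegral_zero] at h2
  exact h2.symm

end

/-! ### Bayes' formula with a parameter -/

section

variable {Ω α 𝒳 𝒴 : Type*} [MeasurableSpace Ω] [MeasurableSpace α] [MeasurableSpace 𝒳]
  [MeasurableSpace 𝒴] {μ : Measure Ω}

/-- The observation kernel with density `f x y` with respect to `ν`. -/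
noncomputable def obsKernel (α : Type*) [MeasurableSpace α] (ν : Measure 𝒴) [SFinite ν]
    (f : 𝒳 → 𝒴 → ℝ≥0∞) : Kernel (α × 𝒳) 𝒴 :=
  (Kernel.const (α × 𝒳) ν).withDensity fun p y => f p.2 y

/-- The marginal density `∫ f(x, y) κ(z, dx)` of the observation. -/
noncomputable def marginalDensity (κ : Kernel α 𝒳) (f : 𝒳 → 𝒴 → ℝ≥0∞) (w : 𝒴 × α) : ℝ≥0∞ :=
  ∫⁻ x, f x w.1 ∂κ w.2

/-- The posterior kernel given by Bayes' formula. -/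
noncomputable def bayesKernel (κ : Kernel α 𝒳) [IsSFiniteKernel κ] (f : 𝒳 → 𝒴 → ℝ≥0∞) :
    Kernel (𝒴 × α) 𝒳 :=
  (κ.comap Prod.snd measurable_snd).withDensity fun w x => (marginalDensity κ f w)⁻¹ * f x w.1

variable {κ : Kernel α 𝒳} [IsMarkovKernel κ] {f : 𝒳 → 𝒴 → ℝ≥0∞}
  (hf : Measurable (Function.uncurry f))

include hf

theorem measurable_marginalDensity : Measurable (marginalDensity κ f) := by
  have h : Measurable fun p : (𝒴 × α) × 𝒳 => f p.2 p.1.1 :=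
    hf.comp (measurable_snd.prodMk measurable_fst.fst)
  exact h.lintegral_kernel_prod_right' (κ := κ.comap Prod.snd measurable_snd)

theorem measurable_bayesDensity : Measurable (Function.uncurry fun (w : 𝒴 × α) (x : 𝒳) =>
    (marginalDensity κ f w)⁻¹ * f x w.1) :=
  ((measurable_marginalDensity hf).comp measurable_fst).inv.mul
    (hf.comp (measurable_snd.prodMk measurable_fst.fst))

theorem bayesKernel_apply (w : 𝒴 × α) : bayesKernel κ f w =
    (κ w.2).withDensity fun x => (marginalDensity κ f w)⁻¹ * f x w.1 := by
  rw [bayesKernel, Kernel.withDensity_apply _ (measurable_bayesDensity hf), Kernel.comap_apply]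

theorem isFiniteKernel_bayesKernel : IsFiniteKernel (bayesKernel κ f) := by
  refine ⟨1, ENNReal.one_lt_top, fun w => ?_⟩
  have hfw : Measurable fun x => f x w.1 := hf.comp (measurable_id.prodMk measurable_const)
  rw [bayesKernel_apply hf, withDensity_apply _ .univ, Measure.restrict_univ,
    lintegral_const_mul _ hfw]
  exact ENNReal.inv_mul_le_one _

variable {X : Ω → 𝒳} {Y : Ω → 𝒴} {Z : Ω → α} {ν : Measure 𝒴} [SFinite ν]
  [IsProbabilityMeasure μ] [IsSFiniteKernel (obsKernel α ν f)]

/-- The joint law of (Z, X, Y) has density f(x, y) with respect to the product of ν with the joint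
law of (Z, X); Tonelli's theorem then places the integral over x innermost. -/
theorem lintegral_comp_of_hasCondDistrib_obsKernel (hX : HasCondDistrib X Z κ μ)
    (hY : HasCondDistrib Y (fun ω => (Z ω, X ω)) (obsKernel α ν f) μ)
    {h : (𝒴 × α) × 𝒳 → ℝ≥0∞} (hh : Measurable h) :
    ∫⁻ ω, h ((Y ω, Z ω), X ω) ∂μ =
      ∫⁻ w, ∫⁻ x, f x w.1 * h (w, x) ∂κ w.2 ∂(ν.prod (μ.map Z)) := by
  have hfu : Measurable (Function.uncurry fun (p : α × 𝒳) (y : 𝒴) => f p.2 y) :=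
    hf.comp (measurable_fst.snd.prodMk measurable_snd)
  have hg : Measurable fun p : (α × 𝒳) × 𝒴 => h ((p.2, p.1.1), p.1.2) :=
    hh.comp ((measurable_snd.prodMk measurable_fst.fst).prodMk measurable_fst.snd)
  have hlaw : μ.map (fun ω => ((Z ω, X ω), Y ω)) =
      (((μ.map Z) ⊗ₘ κ).prod ν).withDensity fun p => f p.1.2 p.2 := by
    have hs : IsSFiniteKernel ((Kernel.const (α × 𝒳) ν).withDensity fun p y => f p.2 y) :=
      ‹IsSFiniteKernel (obsKernel α ν f)›
    rw [hY.map_eq, hX.map_eq, obsKernel, Measure.compProd_withDensity hfu, Measure.compProd_const]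
  have hfp : Measurable fun p : (α × 𝒳) × 𝒴 => f p.1.2 p.2 := hfu
  have hm : Measurable fun p : (α × 𝒳) × 𝒴 => f p.1.2 p.2 * h ((p.2, p.1.1), p.1.2) := hfp.mul hg
  have hm2 : Measurable fun p : (𝒴 × α) × 𝒳 => f p.2 p.1.1 * h p :=
    (hf.comp (measurable_snd.prodMk measurable_fst.fst)).mul hh
  have hm3 : Measurable fun w : 𝒴 × α => ∫⁻ x, f x w.1 * h (w, x) ∂κ w.2 :=
    hm2.lintegral_kernel_prod_right' (κ := κ.comap Prod.snd measurable_snd)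
  calc ∫⁻ ω, h ((Y ω, Z ω), X ω) ∂μ
      = ∫⁻ p, h ((p.2, p.1.1), p.1.2) ∂μ.map (fun ω => ((Z ω, X ω), Y ω)) :=
        (lintegral_map' hg.aemeasurable hY.aemeasurable).symm
    _ = ∫⁻ p, f p.1.2 p.2 * h ((p.2, p.1.1), p.1.2) ∂(((μ.map Z) ⊗ₘ κ).prod ν) := by
        rw [hlaw, lintegral_withDensity_eq_lintegral_mul _ hfp hg]; rfl
    _ = ∫⁻ y, ∫⁻ p, f p.2 y * h ((y, p.1), p.2) ∂((μ.map Z) ⊗ₘ κ) ∂ν :=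
        lintegral_prod_symm' _ hm
    _ = ∫⁻ y, ∫⁻ z, ∫⁻ x, f x y * h ((y, z), x) ∂κ z ∂(μ.map Z) ∂ν := by
        refine lintegral_congr fun y => ?_
        have : Measurable fun p : α × 𝒳 => f p.2 y * h ((y, p.1), p.2) :=
          hm2.comp ((measurable_const.prodMk measurable_fst).prodMk measurable_snd)
        exact Measure.lintegral_compProd this
    _ = _ := (lintegral_prod _ hm3.aemeasurable).symm

theorem map_obs_eq_withDensity (hX : HasCondDistrib X Z κ μ)
    (hY : HasCondDistrib Y (fun ω => (Z ω, X ω)) (obsKernel α ν f) μ) :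
    μ.map (fun ω => (Y ω, Z ω)) =
      (ν.prod (μ.map Z)).withDensity (marginalDensity κ f) := by
  refine Measure.ext_of_lintegral _ fun h hh => ?_
  have hYZ : AEMeasurable (fun ω => (Y ω, Z ω)) μ :=
    hY.aemeasurable_snd.prodMk hX.aemeasurable_fst
  have hh' : Measurable fun p : (𝒴 × α) × 𝒳 => h p.1 := hh.comp measurable_fst
  rw [lintegral_map' hh.aemeasurable hYZ, lintegral_withDensity_eq_lintegral_mul _
    (measurable_marginalDensity hf) hh,
    lintegral_comp_of_hasCondDistrib_obsKernel hf hX hY hh']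
  refine lintegral_congr fun w => ?_
  have hfw : Measurable fun x => f x w.1 := hf.comp (measurable_id.prodMk measurable_const)
  change ∫⁻ x, f x w.1 * h w ∂κ w.2 = marginalDensity κ f w * h w
  rw [lintegral_mul_const _ hfw]
  rfl

theorem marginalDensity_ne_zero (hf0 : ∀ x y, f x y ≠ 0) (w : 𝒴 × α) :
    marginalDensity κ f w ≠ 0 := by
  have hfw : Measurable fun x => f x w.1 := hf.comp (measurable_id.prodMk measurable_const)
  intro h
  have h1 := (lintegral_eq_zero_iff hfw).1 h
  have h2 : ∀ᵐ _ ∂κ w.2, False := h1.mono fun x hx => hf0 _ _ hx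
  have h3 := ae_iff.1 h2
  simp at h3

theorem ae_marginalDensity_ne_top (hX : HasCondDistrib X Z κ μ)
    (hY : HasCondDistrib Y (fun ω => (Z ω, X ω)) (obsKernel α ν f) μ) :
    ∀ᵐ w ∂(ν.prod (μ.map Z)), marginalDensity κ f w ≠ ∞ := by
  have hYZ : AEMeasurable (fun ω => (Y ω, Z ω)) μ :=
    hY.aemeasurable_snd.prodMk hX.aemeasurable_fst
  have := Measure.isProbabilityMeasure_map (μ := μ) hYZ
  refine (ae_lt_top (measurable_marginalDensity hf) ?_).mono fun w hw => hw.ne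
  have h1 : μ.map (fun ω => (Y ω, Z ω)) Set.univ = 1 := measure_univ
  rw [map_obs_eq_withDensity hf hX hY, withDensity_apply _ .univ, Measure.restrict_univ] at h1
  rw [h1]
  exact ENNReal.one_ne_top

/-- Bayes' formula. -/
theorem hasCondDistrib_bayesKernel (hf0 : ∀ x y, f x y ≠ 0) (hX : HasCondDistrib X Z κ μ)
    (hY : HasCondDistrib Y (fun ω => (Z ω, X ω)) (obsKernel α ν f) μ) :
    HasCondDistrib X (fun ω => (Y ω, Z ω)) (bayesKernel κ f) μ where
  aemeasurable := (hY.aemeasurable_snd.prodMk hX.aemeasurable_fst).prodMk hX.aemeasurable_snd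
  map_eq := by
    have hfin := isFiniteKernel_bayesKernel (κ := κ) hf
    have hYZ : AEMeasurable (fun ω => ((Y ω, Z ω), X ω)) μ :=
      (hY.aemeasurable_snd.prodMk hX.aemeasurable_fst).prodMk hX.aemeasurable_snd
    refine Measure.ext_of_lintegral _ fun h hh => ?_
    have hi : Measurable fun w => ∫⁻ x, h (w, x) ∂bayesKernel κ f w :=
      hh.lintegral_kernel_prod_right'
    rw [lintegral_map' hh.aemeasurable hYZ, Measure.lintegral_compProd hh,
      map_obs_eq_withDensity hf hX hY, lintegral_withDensity_eq_lintegral_mul _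
        (measurable_marginalDensity hf) hi, lintegral_comp_of_hasCondDistrib_obsKernel hf hX hY hh]
    refine lintegral_congr_ae ?_
    filter_upwards [ae_marginalDensity_ne_top hf hX hY] with w hw
    have hfw : Measurable fun x => f x w.1 := hf.comp (measurable_id.prodMk measurable_const)
    have hhw : Measurable fun x => h (w, x) := hh.comp (measurable_const.prodMk measurable_id)
    have hfh : Measurable fun x => f x w.1 * h (w, x) := hfw.mul hhw
    rw [Pi.mul_apply, bayesKernel_apply hf, lintegral_withDensity_eq_lintegral_mul _
      (hfw.const_mul _) hhw]
    simp only [Pi.mul_apply, mul_assoc]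
    rw [lintegral_const_mul _ hfh, ← mul_assoc,
      ENNReal.mul_inv_cancel (marginalDensity_ne_zero hf hf0 w) hw, one_mul]

/-- The marginal density never vanishes. Together with the converse below, this makes the law of (Y,
Z) equivalent to a product whose first factor does not depend on the state evolution. -/
theorem prod_absolutelyContinuous_map_obs (hf0 : ∀ x y, f x y ≠ 0) (hX : HasCondDistrib X Z κ μ)
    (hY : HasCondDistrib Y (fun ω => (Z ω, X ω)) (obsKernel α ν f) μ) :
    ν.prod (μ.map Z) ≪ μ.map (fun ω => (Y ω, Z ω)) := by
  rw [map_obs_eq_withDensity hf hX hY]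
  exact withDensity_absolutelyContinuous' (measurable_marginalDensity hf).aemeasurable
    (.of_forall fun w => marginalDensity_ne_zero hf hf0 w)

theorem map_obs_absolutelyContinuous_prod (hX : HasCondDistrib X Z κ μ)
    (hY : HasCondDistrib Y (fun ω => (Z ω, X ω)) (obsKernel α ν f) μ) :
    μ.map (fun ω => (Y ω, Z ω)) ≪ ν.prod (μ.map Z) := by
  rw [map_obs_eq_withDensity hf hX hY]
  exact withDensity_absolutelyContinuous _ _

/-- Bayes' formula can be inverted: dividing the posterior by the likelihood leaves the prior times
the inverse marginal density. Priors have mass one, so comparing total masses identifies the two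
constants, and finiteness of one marginal density allows it to be cancelled. -/
theorem eq_of_bayesKernel_eq (hf0 : ∀ x y, f x y ≠ 0) (hft : ∀ x y, f x y ≠ ∞)
    {κ' : Kernel α 𝒳} [IsMarkovKernel κ'] {w : 𝒴 × α}
    (h2 : marginalDensity κ' f w ≠ ∞) (h : bayesKernel κ f w = bayesKernel κ' f w) :
    κ w.2 = κ' w.2 := by
  have hfw : Measurable fun x => f x w.1 := hf.comp (measurable_id.prodMk measurable_const)
  have key : ∀ (κ : Kernel α 𝒳) [IsMarkovKernel κ],
      (bayesKernel κ f w).withDensity (fun x => (f x w.1)⁻¹) =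
        (marginalDensity κ f w)⁻¹ • κ w.2 := by
    intro κ _
    rw [bayesKernel_apply hf]
    have : (fun x => (marginalDensity κ f w)⁻¹ * f x w.1) =
        (fun _ => (marginalDensity κ f w)⁻¹) * fun x => f x w.1 := rfl
    rw [this, withDensity_mul _ measurable_const hfw, withDensity_inv_same hfw
      (.of_forall fun x => hf0 _ _) (.of_forall fun x => hft _ _), withDensity_const]
  have h3 := (key κ).symm.trans ((congrArg (fun m => m.withDensity fun x => (f x w.1)⁻¹) h).trans
    (key κ'))
  have h4 : (marginalDensity κ f w)⁻¹ = (marginalDensity κ' f w)⁻¹ := by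
    have := congrArg (fun m => m Set.univ) h3
    simpa using this
  rw [h4] at h3
  have h5 := congrArg (fun m => marginalDensity κ' f w • m) h3
  simpa [smul_smul, ENNReal.mul_inv_cancel (marginalDensity_ne_zero hf hf0 w) h2] using h5

end

end VolatilityProcess

namespace VolatilityProcess

open scoped ENNReal

/-! ### The transition laws as kernels -/

theorem exists_kernel_map {α β γ : Type*} [MeasurableSpace α] [MeasurableSpace β]
    [MeasurableSpace γ] (ν : Measure β) [SFinite ν] {F : α × β → γ} (hF : Measurable F) :
    ∃ K : Kernel α γ, ∀ a, K a = ν.map fun b => F (a, b) := by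
  refine ⟨(Kernel.id ×ₖ Kernel.const α ν).map F, fun a => ?_⟩
  rw [Kernel.map_apply _ hF, Kernel.prod_apply, Kernel.id_apply, Kernel.const_apply,
    Measure.dirac_prod, Measure.map_map hF measurable_prodMk_left]
  rfl

theorem measurable_mat_smul {q : ℕ} {α : Type*} [MeasurableSpace α] (c : ℝ) {f : α → Mat q}
    (hf : Measurable f) : Measurable fun x => c • f x := by
  have h : Measurable fun X : Mat q => c • X :=
    (by fun_prop : Continuous fun X : Mat q => c • X).measurable
  exact h.comp hf

theorem measurable_mat_add {q : ℕ} {α : Type*} [MeasurableSpace α] {f g : α → Mat q}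
    (hf : Measurable f) (hg : Measurable g) : Measurable fun x => f x + g x :=
  measurable_pair_add.comp (hf.prodMk hg)

section

variable {q : ℕ}

theorem measurable_scaleFactor (k : ℝ) : Measurable (scaleFactor k : Mat q → Mat q) :=
  measurable_uchol.comp (measurable_mat_inv.comp (measurable_mat_smul k measurable_id))

theorem measurable_bartlettFactor {α : Type*} [MeasurableSpace α] {f g : α → Mat q}
    (hf : Measurable f) (hg : Measurable g) : Measurable fun x => bartlettFactor (f x) (g x) := by
  have hi : Measurable fun x => (f x)⁻¹ := measurable_mat_inv.comp hf
  exact measurable_uchol.comp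
    (measurable_mat_mul (measurable_mat_mul (measurable_mat_transpose hi) hg) hi)

theorem exists_kernel_ueTransition (lam n k : ℝ) [SFinite (matrixBeta q (n / 2) (k / 2))] :
    ∃ K : Kernel (Mat q × Mat q) (Mat q), ∀ D Φ, K (D, Φ) = ueTransition lam n k D Φ := by
  have hP : Measurable fun p : (Mat q × Mat q) × Mat q => scaleFactor k p.1.1 :=
    (measurable_scaleFactor k).comp measurable_fst.fst
  have hM := measurable_mat_mul (measurable_bartlettFactor hP measurable_fst.snd) hP
  obtain ⟨K, hK⟩ := exists_kernel_map (matrixBeta q (n / 2) (k / 2)) (measurable_mat_smul lam⁻¹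
    (measurable_mat_mul (measurable_mat_mul (measurable_mat_transpose hM) measurable_snd) hM))
  exact ⟨K, fun D Φ => hK (D, Φ)⟩

theorem exists_kernel_bbTransition (β b k κ : ℝ) [SFinite (bbNoise q β κ)] :
    ∃ K : Kernel (Mat q × Mat q) (Mat q), ∀ D Φ, K (D, Φ) = bbTransition β b k κ D Φ := by
  have hP : Measurable fun p : (Mat q × Mat q) × (Fin q → ℝ) => scaleFactor k p.1.1 :=
    (measurable_scaleFactor k).comp measurable_fst.fst
  have hU := measurable_bartlettFactor hP measurable_fst.snd
  have hM := measurable_mat_mul (measurable_bbFactor.comp (hU.prodMk measurable_snd)) hP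
  obtain ⟨K, hK⟩ := exists_kernel_map (bbNoise q β κ) (measurable_mat_smul b⁻¹
    (measurable_mat_mul (measurable_mat_transpose hM) hM))
  exact ⟨K, fun D Φ => hK (D, Φ)⟩

/-! ### Regular state-space models -/

/-- `D_t` as a function of `(y_1, …, y_t)`. -/
noncomputable def scaleOf (c : ℝ) (D₀ : Mat q) : (t : ℕ) → (Fin t → Mat q) → Mat q
  | 0, _ => D₀
  | t + 1, z => c • scaleOf c D₀ t (fun i => z i.castSucc) + z (Fin.last t)

theorem scaleOf_data {Ω : Type*} (c : ℝ) (D₀ : Mat q) (y : ℕ → Ω → Mat q) (t : ℕ) (ω : Ω) :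
    scaleOf c D₀ t (data y t ω) = scaleMatrix c D₀ (fun s => y s ω) t := by
  induction t with
  | zero => rfl
  | succ t ih =>
    rw [scaleMatrix, ← ih]
    rfl

theorem measurable_scaleOf (c : ℝ) (D₀ : Mat q) (t : ℕ) : Measurable (scaleOf c D₀ t) := by
  induction t with
  | zero => exact measurable_const
  | succ t ih =>
    have h : Measurable fun z : Fin (t + 1) → Mat q => fun i : Fin t => z i.castSucc :=
      measurable_pi_lambda _ fun i => measurable_pi_apply _
    exact measurable_mat_add (measurable_mat_smul c (ih.comp h)) (measurable_pi_apply _)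

/-- Splitting `(y_1, …, y_{t+1})` into `y_{t+1}` and `(y_1, …, y_t)`. -/
noncomputable def splitLast (q t : ℕ) :
    (Fin (t + 1) → Mat q) ≃ᵐ Mat q × (Fin t → Mat q) :=
  MeasurableEquiv.piFinSuccAbove (fun _ => Mat q) (Fin.last t)

theorem splitLast_data {Ω : Type*} (y : ℕ → Ω → Mat q) (t : ℕ) (ω : Ω) :
    splitLast q t (data y (t + 1) ω) = (y (t + 1) ω, data y t ω) := by
  refine Prod.ext rfl (funext fun i => ?_)
  change data y (t + 1) ω ((Fin.last t).succAbove i) = data y t ω i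
  rw [Fin.succAbove_last]
  rfl

theorem splitLast_symm_comp {Ω : Type*} (y : ℕ → Ω → Mat q) (t : ℕ) :
    (splitLast q t).symm ∘ (fun ω => (y (t + 1) ω, data y t ω)) = data y (t + 1) := by
  funext ω
  rw [Function.comp_apply, ← splitLast_data, MeasurableEquiv.symm_apply_apply]

/-- A state-space model whose state evolution is a Markov kernel preserving positive
definiteness. -/
structure IsRegularModel {Ω : Type*} [MeasurableSpace Ω] (μ : Measure Ω) [IsProbabilityMeasure μ]
    (T : ℕ) (k c : ℝ) (D₀ : Mat q) (init : Measure (Mat q))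
    (trans : ℕ → Mat q → Mat q → Measure (Mat q)) (Φ y : ℕ → Ω → Mat q) : Prop where
  model : IsStateSpaceModel μ T k c D₀ init trans Φ y
  dof : IsWishartDof q k
  dof_pos : 0 < k
  discount_pos : 0 < c
  posDef_scale : D₀.PosDef
  ae_posDef_init : ∀ᵐ A ∂init, A.PosDef
  exists_kernel : ∀ t, ∃ K : Kernel (Mat q × Mat q) (Mat q), ∀ D Φ, K (D, Φ) = trans t D Φ
  isProbability : ∀ t D Φ, IsProbabilityMeasure (trans t D Φ)
  ae_posDef_trans : ∀ t D Φ, D.PosDef → Φ.PosDef → ∀ᵐ A ∂trans t D Φ, A.PosDef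

namespace IsRegularModel

variable {Ω : Type*} [MeasurableSpace Ω] {μ : Measure Ω} [IsProbabilityMeasure μ]
  {T : ℕ} {k c : ℝ} {D₀ : Mat q} {init : Measure (Mat q)}
  {trans : ℕ → Mat q → Mat q → Measure (Mat q)} {Φ y : ℕ → Ω → Mat q}

theorem measurable_states (h : IsRegularModel μ T k c D₀ init trans Φ y) (t : ℕ) :
    Measurable (states Φ t) :=
  measurable_pi_lambda _ fun _ => h.model.measurable_state _

theorem measurable_data (h : IsRegularModel μ T k c D₀ init trans Φ y) (t : ℕ) :
    Measurable (data y t) :=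
  measurable_pi_lambda _ fun _ => h.model.measurable_obs _

/-- State and scale matrix go through the induction together, since the transition preserves
positive definiteness only when both have it. The observation may be singular, but adding a
semidefinite matrix to c D_t keeps the sum definite. -/
theorem ae_posDef (h : IsRegularModel μ T k c D₀ init trans Φ y) (t : ℕ) (ht : t ≤ T) :
    ∀ᵐ ω ∂μ, (Φ t ω).PosDef ∧ (scaleMatrix c D₀ (fun s => y s ω) t).PosDef := by
  induction t with
  | zero =>
    have h0 : ∀ᵐ A ∂μ.map (Φ 0), A.PosDef := by rw [h.model.law_init]; exact h.ae_posDef_init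
    filter_upwards [ae_of_ae_map (h.model.measurable_state 0).aemeasurable h0] with ω hω
      using ⟨hω, h.posDef_scale⟩
  | succ t ih =>
    have ih := ih (Nat.le_of_succ_le ht)
    have h1 : ∀ᵐ ω ∂μ, (Φ (t + 1) ω).PosDef := by
      refine ae_of_ae_condDistrib ((h.measurable_states t).prodMk (h.measurable_data t))
        (h.model.measurable_state (t + 1)) (measurableSet_posDef q) ?_
      filter_upwards [h.model.law_state t ht, ih] with ω hω hpd
      rw [hω]
      exact h.ae_posDef_trans t _ _ hpd.2 hpd.1
    have h2 : ∀ᵐ ω ∂μ, (y (t + 1) ω).PosSemidef := by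
      refine ae_of_ae_condDistrib ((h.measurable_states (t + 1)).prodMk (h.measurable_data t))
        (h.model.measurable_obs (t + 1)) (measurableSet_posSemidef q) ?_
      filter_upwards [h.model.law_obs t ht] with ω hω
      rw [hω]
      exact ae_posSemidef_wishart h.dof _
    filter_upwards [ih, h1, h2] with ω h0 h1 h2
    exact ⟨h1, (h0.2.smul h.discount_pos).add_posSemidef h2⟩

/-- The evolution kernel of `Φ_{t+1}` given `(y_1, …, y_t)` and `Φ_t`. -/
noncomputable def evolution (h : IsRegularModel μ T k c D₀ init trans Φ y) (t : ℕ) :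
    Kernel ((Fin t → Mat q) × Mat q) (Mat q) :=
  (h.exists_kernel t).choose.comap (fun p => (scaleOf c D₀ t p.1, p.2))
    (((measurable_scaleOf c D₀ t).comp measurable_fst).prodMk measurable_snd)

theorem evolution_apply (h : IsRegularModel μ T k c D₀ init trans Φ y) (t : ℕ)
    (p : (Fin t → Mat q) × Mat q) : h.evolution t p = trans t (scaleOf c D₀ t p.1) p.2 := by
  rw [evolution, Kernel.comap_apply]
  exact (h.exists_kernel t).choose_spec _ _

theorem isMarkovKernel_evolution (h : IsRegularModel μ T k c D₀ init trans Φ y) (t : ℕ) :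
    IsMarkovKernel (h.evolution t) :=
  ⟨fun p => by rw [evolution_apply]; exact h.isProbability _ _ _⟩

/-- Given the whole past, the law of the next state depends only on Φ_t and on D_t, a function of
the data. A conditional law that factors through a coarser variable is also the conditional law
given that variable. -/
theorem hasCondDistrib_state (h : IsRegularModel μ T k c D₀ init trans Φ y) {t : ℕ} (ht : t < T) :
    HasCondDistrib (Φ (t + 1)) (fun ω => (data y t ω, Φ t ω)) (h.evolution t) μ := by
  have hK := h.isMarkovKernel_evolution t
  have hg : Measurable fun p : (Fin (t + 1) → Mat q) × (Fin t → Mat q) => (p.2, p.1 (Fin.last t)) :=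
    measurable_snd.prodMk ((measurable_pi_apply _).comp measurable_fst)
  have h1 : HasCondDistrib (Φ (t + 1)) (fun ω => (states Φ t ω, data y t ω))
      ((h.evolution t).comap _ hg) μ := by
    refine hasCondDistrib_of_ae_eq ((h.measurable_states t).prodMk (h.measurable_data t))
      (h.model.measurable_state (t + 1)) ?_
    filter_upwards [h.model.law_state t ht] with ω hω
    rw [hω, Kernel.comap_apply, evolution_apply, scaleOf_data]
    rfl
  exact h1.comp_right

/-- The conditional law of the next state given the current state and the data so far. -/
theorem ae_condDistrib_state (h : IsRegularModel μ T k c D₀ init trans Φ y) {t : ℕ} (ht : t < T) :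
    ∀ᵐ ω ∂μ, condDistrib (Φ (t + 1)) (fun ω' => (Φ t ω', data y t ω')) μ (Φ t ω, data y t ω) =
      trans t (scaleMatrix c D₀ (fun s => y s ω) t) (Φ t ω) := by
  have hK := h.isMarkovKernel_evolution t
  have h1 := (h.hasCondDistrib_state ht).measurableEquiv_comp_right MeasurableEquiv.prodComm
  have h2 := ae_of_ae_map (((h.model.measurable_state t).prodMk (h.measurable_data t)).aemeasurable)
    (condDistrib_ae_eq_of_hasCondDistrib h1)
  filter_upwards [h2] with ω hω
  refine hω.trans ?_
  rw [Kernel.comap_apply, evolution_apply, ← scaleOf_data]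
  rfl

end IsRegularModel

/-! ### The observation density and the posterior of the last two states -/

open Classical in
/-- The density of the observation `y_{t+1}` given the states `x = (Φ_t, Φ_{t+1})`, with respect to
the standard Wishart distribution. -/
noncomputable def obsDensity (k : ℝ) (x : Mat q × Mat q) (y : Mat q) : ℝ≥0∞ :=
  if x.2.PosDef then ENNReal.ofReal (wishartRatio k ((k • x.2)⁻¹) y) else 1

theorem measurable_obsDensity (k : ℝ) :
    Measurable (Function.uncurry (obsDensity k : Mat q × Mat q → Mat q → ℝ≥0∞)) := by
  classical
  have hs : Measurable fun p : (Mat q × Mat q) × Mat q => (k • p.1.2)⁻¹ :=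
    measurable_mat_inv.comp (measurable_mat_smul k measurable_fst.snd)
  have hr : Measurable fun p : (Mat q × Mat q) × Mat q => wishartRatio k ((k • p.1.2)⁻¹) p.2 :=
    (measurable_wishartRatio_uncurry k).comp (hs.prodMk measurable_snd)
  exact Measurable.ite (measurable_fst.snd (measurableSet_posDef q)) hr.ennreal_ofReal
    measurable_const

/-- The value 1 assigned off the positive-definite cone makes this hold everywhere; almost surely
the states never leave the cone, so the choice does not affect the model. -/
theorem obsDensity_ne_zero {k : ℝ} (hk : 0 < k) (x : Mat q × Mat q) (y : Mat q) :
    obsDensity k x y ≠ 0 := by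
  unfold obsDensity
  split_ifs with h
  · rw [Ne, ENNReal.ofReal_eq_zero, not_le]
    exact wishartRatio_pos k (h.smul hk).inv y
  · exact one_ne_zero

theorem obsDensity_ne_top (k : ℝ) (x : Mat q × Mat q) (y : Mat q) : obsDensity k x y ≠ ∞ := by
  unfold obsDensity
  split_ifs
  · exact ENNReal.ofReal_ne_top
  · exact ENNReal.one_ne_top

theorem isSFiniteKernel_obsKernel (α : Type*) [MeasurableSpace α] (ν : Measure (Mat q)) [SFinite ν]
    (k : ℝ) : IsSFiniteKernel (obsKernel α ν (obsDensity k)) := by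
  unfold obsKernel
  exact Kernel.IsSFiniteKernel.withDensity _ fun _ _ => obsDensity_ne_top k _ _

theorem obsKernel_obsDensity {α : Type*} [MeasurableSpace α] {k : ℝ} (hk : IsWishartDof q k)
    (hk0 : 0 < k) [SFinite (wishart k (1 : Mat q))] {p : α × (Mat q × Mat q)} (hp : p.2.2.PosDef) :
    obsKernel α (wishart k 1) (obsDensity k) p = wishart k ((k • p.2.2)⁻¹) := by
  have hm : Measurable (Function.uncurry fun (p : α × (Mat q × Mat q)) (y : Mat q) =>
      obsDensity k p.2 y) :=
    (measurable_obsDensity k).comp (measurable_fst.snd.prodMk measurable_snd)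
  rw [obsKernel, Kernel.withDensity_apply _ hm, Kernel.const_apply,
    wishart_eq_withDensity hk (hp.smul hk0).inv]
  congr 1
  funext y
  rw [obsDensity, if_pos hp]

namespace IsRegularModel

variable {Ω : Type*} [MeasurableSpace Ω] {μ : Measure Ω} [IsProbabilityMeasure μ]
  {T : ℕ} {k c : ℝ} {D₀ : Mat q} {init : Measure (Mat q)}
  {trans : ℕ → Mat q → Mat q → Measure (Mat q)} {Φ y : ℕ → Ω → Mat q}

theorem isProbabilityMeasure_obs (h : IsRegularModel μ T k c D₀ init trans Φ y) :
    IsProbabilityMeasure (wishart k (1 : Mat q)) :=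
  isProbabilityMeasure_wishart h.dof Matrix.PosDef.one

/-- The parameter for Bayes' formula is the pair of consecutive states, although the likelihood
involves only the second: the law of the pair is what carries the transition. -/
theorem hasCondDistrib_obs [SFinite (wishart k (1 : Mat q))]
    (h : IsRegularModel μ T k c D₀ init trans Φ y) {t : ℕ} (ht : t < T) :
    HasCondDistrib (y (t + 1)) (fun ω => (data y t ω, (Φ t ω, Φ (t + 1) ω)))
      (obsKernel (Fin t → Mat q) (wishart k 1) (obsDensity k)) μ := by
  have hK := isSFiniteKernel_obsKernel (Fin t → Mat q) (wishart k (1 : Mat q)) k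
  have hg : Measurable fun p : (Fin (t + 2) → Mat q) × (Fin t → Mat q) =>
      (p.2, (p.1 (Fin.last t).castSucc, p.1 (Fin.last (t + 1)))) :=
    measurable_snd.prodMk (((measurable_pi_apply _).comp measurable_fst).prodMk
      ((measurable_pi_apply _).comp measurable_fst))
  have h1 : HasCondDistrib (y (t + 1)) (fun ω => (states Φ (t + 1) ω, data y t ω))
      ((obsKernel (Fin t → Mat q) (wishart k 1) (obsDensity k)).comap _ hg) μ := by
    refine hasCondDistrib_of_ae_eq ((h.measurable_states (t + 1)).prodMk (h.measurable_data t))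
      (h.model.measurable_obs (t + 1)) ?_
    filter_upwards [h.model.law_obs t ht, h.ae_posDef (t + 1) ht] with ω hω hpd
    rw [hω, Kernel.comap_apply]
    exact (obsKernel_obsDensity (p := (data y t ω, (Φ t ω, Φ (t + 1) ω))) h.dof h.dof_pos
      hpd.1).symm
  exact h1.comp_right

/-- The conditional law of `(Φ_t, Φ_{t+1})` given `(y_1, …, y_t)`. -/
noncomputable def predictive (h : IsRegularModel μ T k c D₀ init trans Φ y) (t : ℕ) :
    Kernel (Fin t → Mat q) (Mat q × Mat q) :=
  condDistrib (Φ t) (data y t) μ ⊗ₖ h.evolution t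

theorem isMarkovKernel_predictive (h : IsRegularModel μ T k c D₀ init trans Φ y) (t : ℕ) :
    IsMarkovKernel (h.predictive t) := by
  have := h.isMarkovKernel_evolution t
  unfold predictive
  infer_instance

theorem hasCondDistrib_predictive (h : IsRegularModel μ T k c D₀ init trans Φ y) {t : ℕ}
    (ht : t < T) :
    HasCondDistrib (fun ω => (Φ t ω, Φ (t + 1) ω)) (data y t) (h.predictive t) μ := by
  have := h.isMarkovKernel_evolution t
  exact hasCondDistrib_compProd
    (hasCondDistrib_condDistrib (h.measurable_data t) (h.model.measurable_state t))
    (h.hasCondDistrib_state ht)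

theorem ae_data_posDef (h : IsRegularModel μ T k c D₀ init trans Φ y) {t : ℕ} (ht : t < T) :
    ∀ᵐ z ∂μ.map (data y t), (scaleOf c D₀ t z).PosDef ∧
      ∀ᵐ A ∂condDistrib (Φ t) (data y t) μ z, A.PosDef := by
  have hpd := h.ae_posDef t ht.le
  have hm := ((h.measurable_data t).prodMk (h.model.measurable_state t)).aemeasurable (μ := μ)
  have h1 : ∀ᵐ p ∂μ.map (fun ω => (data y t ω, Φ t ω)), p.2.PosDef := by
    have hset : MeasurableSet {p : (Fin t → Mat q) × Mat q | p.2.PosDef} :=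
      measurable_snd (measurableSet_posDef q)
    rw [ae_map_iff hm hset]
    exact hpd.mono fun ω hω => hω.1
  rw [← compProd_map_condDistrib (h.model.measurable_state t).aemeasurable] at h1
  have h2 : ∀ᵐ z ∂μ.map (data y t), (scaleOf c D₀ t z).PosDef := by
    have hset : MeasurableSet {z : Fin t → Mat q | (scaleOf c D₀ t z).PosDef} :=
      measurable_scaleOf c D₀ t (measurableSet_posDef q)
    rw [ae_map_iff (h.measurable_data t).aemeasurable hset]
    filter_upwards [hpd] with ω hω
    rw [scaleOf_data]
    exact hω.2
  filter_upwards [h2, Measure.ae_ae_of_ae_compProd h1] with z h2 h3 using ⟨h2, h3⟩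

theorem map_data_succ (h : IsRegularModel μ T k c D₀ init trans Φ y) (t : ℕ) :
    μ.map (data y (t + 1)) =
      (μ.map fun ω => (y (t + 1) ω, data y t ω)).map (splitLast q t).symm := by
  rw [Measure.map_map (splitLast q t).symm.measurable
    ((h.model.measurable_obs (t + 1)).prodMk (h.measurable_data t)), splitLast_symm_comp]

/-- Any two regular models with the same observation equation have equivalent data laws. -/
theorem map_data_absolutelyContinuous {Ω' : Type*} [MeasurableSpace Ω'] {μ' : Measure Ω'}
    [IsProbabilityMeasure μ'] {c' : ℝ} {D₀' : Mat q} {init' : Measure (Mat q)}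
    {trans' : ℕ → Mat q → Mat q → Measure (Mat q)} {Φ' y' : ℕ → Ω' → Mat q}
    (h : IsRegularModel μ T k c D₀ init trans Φ y)
    (h' : IsRegularModel μ' T k c' D₀' init' trans' Φ' y') (t : ℕ) (ht : t ≤ T) :
    μ.map (data y t) ≪ μ'.map (data y' t) := by
  induction t with
  | zero =>
    have := Measure.isProbabilityMeasure_map (μ := μ') (h'.measurable_data 0).aemeasurable
    refine Measure.AbsolutelyContinuous.mk fun s _ hs => ?_
    rcases s.eq_empty_or_nonempty with rfl | hne
    · exact measure_empty
    · rw [Subsingleton.eq_univ_of_nonempty hne, measure_univ] at hs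
      exact absurd hs one_ne_zero
  | succ t ih =>
    have hν := h.isProbabilityMeasure_obs
    have hs := isSFiniteKernel_obsKernel (Fin t → Mat q) (wishart k (1 : Mat q)) k
    have hp := h.isMarkovKernel_predictive t
    have hp' := h'.isMarkovKernel_predictive t
    rw [h.map_data_succ, h'.map_data_succ]
    refine Measure.AbsolutelyContinuous.map ?_ (splitLast q t).symm.measurable
    -- In each model the law of the new observation and the past data is equivalent to Wishart(k, I)
    -- times the law of the past. The first factor is common, so the comparison reduces to the
    -- pasts.
    refine (map_obs_absolutelyContinuous_prod (measurable_obsDensity k)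
      (h.hasCondDistrib_predictive ht) (h.hasCondDistrib_obs ht)).trans ?_
    refine Measure.AbsolutelyContinuous.trans ?_ (prod_absolutelyContinuous_map_obs
      (measurable_obsDensity k) (obsDensity_ne_zero h.dof_pos)
      (h'.hasCondDistrib_predictive ht) (h'.hasCondDistrib_obs ht))
    exact Measure.AbsolutelyContinuous.rfl.prod (ih (Nat.le_of_succ_le ht))

/-- The marginal of the smoothed posterior on the last two states, by Bayes' formula. -/
theorem ae_map_smoothedPosterior (h : IsRegularModel μ T k c D₀ init trans Φ y) {t : ℕ}
    (ht : t < T) [IsSFiniteKernel (h.predictive t)] :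
    ∀ᵐ d ∂μ.map (data y (t + 1)),
      (smoothedPosterior μ (t + 1) Φ y d).map
          (fun s => (s (Fin.last t).castSucc, s (Fin.last (t + 1)))) =
        bayesKernel (h.predictive t) (obsDensity k) (splitLast q t d) ∧
      marginalDensity (h.predictive t) (obsDensity k) (splitLast q t d) ≠ ∞ ∧
      (scaleOf c D₀ t (splitLast q t d).2).PosDef ∧
      ∀ᵐ A ∂condDistrib (Φ t) (data y t) μ (splitLast q t d).2, A.PosDef := by
  have hν := h.isProbabilityMeasure_obs
  have hs := isSFiniteKernel_obsKernel (Fin t → Mat q) (wishart k (1 : Mat q)) k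
  have hp := h.isMarkovKernel_predictive t
  have hfin := isFiniteKernel_bayesKernel (κ := h.predictive t) (measurable_obsDensity k)
  have hX := h.hasCondDistrib_predictive ht
  have hY := h.hasCondDistrib_obs ht
  set g : (Fin (t + 2) → Mat q) → Mat q × Mat q :=
    fun s => (s (Fin.last t).castSucc, s (Fin.last (t + 1))) with hg
  have hgm : Measurable g := (measurable_pi_apply _).prodMk (measurable_pi_apply _)
  -- Reindexing the conditioning variable from (y_{t+1}, past) to the full data vector makes Bayes'
  -- formula comparable with the smoothed posterior.
  have h1 := (hasCondDistrib_bayesKernel (measurable_obsDensity k)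
    (obsDensity_ne_zero h.dof_pos) hX hY).measurableEquiv_comp_right (splitLast q t).symm
  rw [splitLast_symm_comp] at h1
  have h2 := condDistrib_ae_eq_of_hasCondDistrib h1
  have h3 : ∀ᵐ d ∂μ.map (data y (t + 1)), condDistrib (g ∘ states Φ (t + 1)) (data y (t + 1)) μ d =
      (condDistrib (states Φ (t + 1)) (data y (t + 1)) μ).map g d :=
    condDistrib_comp (μ := μ) (data y (t + 1)) (h.measurable_states (t + 1)).aemeasurable hgm
  have hmap : (μ.map (data y (t + 1))).map (splitLast q t) =
      μ.map fun ω => (y (t + 1) ω, data y t ω) := by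
    rw [h.map_data_succ, MeasurableEquiv.map_map_symm]
  have hmeas := (splitLast q t).measurable.aemeasurable (μ := μ.map (data y (t + 1)))
  have h4 : ∀ᵐ w ∂(μ.map (data y (t + 1))).map (splitLast q t),
      marginalDensity (h.predictive t) (obsDensity k) w ≠ ∞ := by
    rw [hmap]
    exact (map_obs_absolutelyContinuous_prod (measurable_obsDensity k) hX hY).ae_le
      (ae_marginalDensity_ne_top (measurable_obsDensity k) hX hY)
  have h5 : ∀ᵐ w ∂(μ.map (data y (t + 1))).map (splitLast q t), (scaleOf c D₀ t w.2).PosDef ∧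
      ∀ᵐ A ∂condDistrib (Φ t) (data y t) μ w.2, A.PosDef := by
    rw [hmap]
    exact (map_obs_absolutelyContinuous_prod (measurable_obsDensity k) hX hY).ae_le
      (Measure.quasiMeasurePreserving_snd.ae (h.ae_data_posDef ht))
  filter_upwards [h2, h3, ae_of_ae_map hmeas h4, ae_of_ae_map hmeas h5] with d h2 h3 h4 h5
  refine ⟨?_, h4, h5⟩
  rw [Kernel.map_apply _ hgm] at h3
  exact h3.symm.trans h2

/-- Models with the same observation equation and the same scale matrices, but everywhere different
state evolutions, have different smoothed posteriors for almost all data. -/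
theorem ae_smoothedPosterior_ne {Ω' : Type*} [MeasurableSpace Ω'] {μ' : Measure Ω'}
    [IsProbabilityMeasure μ'] {init' : Measure (Mat q)}
    {trans' : ℕ → Mat q → Mat q → Measure (Mat q)} {Φ' y' : ℕ → Ω' → Mat q}
    (h : IsRegularModel μ T k c D₀ init trans Φ y)
    (h' : IsRegularModel μ' T k c D₀ init' trans' Φ' y')
    (hne : ∀ t D A, D.PosDef → A.PosDef → trans t D A ≠ trans' t D A) (hT : 1 ≤ T) :
    ∀ᵐ d ∂μ.map (data y T), smoothedPosterior μ T Φ y d ≠ smoothedPosterior μ' T Φ' y' d := by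
  -- The transition into the final state is the one examined: no data come after it, so the
  -- posterior of the last two states is a single Bayes update.
  obtain ⟨t, rfl⟩ : ∃ t, T = t + 1 := ⟨T - 1, by omega⟩
  have ht := Nat.lt_succ_self t
  have hp := h.isMarkovKernel_predictive t
  have hp' := h'.isMarkovKernel_predictive t
  have he := h.isMarkovKernel_evolution t
  have he' := h'.isMarkovKernel_evolution t
  -- The facts about the second model hold almost surely under its own data law; absolute continuity
  -- transfers them to that of the first.
  filter_upwards [h.ae_map_smoothedPosterior ht,
    (h.map_data_absolutelyContinuous h' (t + 1) le_rfl).ae_le (h'.ae_map_smoothedPosterior ht)]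
    with d hd hd' heq
  rw [heq] at hd
  have h1 := eq_of_bayesKernel_eq (measurable_obsDensity k) (obsDensity_ne_zero h.dof_pos)
    (obsDensity_ne_top k) hd'.2.1 (hd.1.symm.trans hd'.1)
  set z := (splitLast q t d).2 with hz
  rw [predictive, predictive, Kernel.compProd_apply_eq_compProd_sectR,
    Kernel.compProd_apply_eq_compProd_sectR] at h1
  -- The recovered joint laws are filtered law followed by transition. Their first marginals
  -- identify the filtered laws, after which uniqueness of disintegration identifies the transitions
  -- at almost every state.
  have h2 : condDistrib (Φ t) (data y t) μ z = condDistrib (Φ' t) (data y' t) μ' z := by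
    have := congrArg Measure.fst h1
    rwa [Measure.fst_compProd, Measure.fst_compProd] at this
  rw [← h2] at h1
  have h3 := Kernel.ae_eq_of_compProd_eq h1
  -- The filtered law is a probability measure, so some positive-definite state lies in the set of
  -- full measure; there the evolutions differ by hypothesis.
  obtain ⟨A, hA, hA'⟩ := (h3.and hd.2.2.2).exists
  rw [Kernel.sectR_apply, Kernel.sectR_apply, evolution_apply, evolution_apply] at hA
  exact hne t _ _ hd.2.2.1 hA' hA

end IsRegularModel

end

end VolatilityProcess

/-! ### The two processes as regular models, and the theorem -/

namespace VolatilityProcess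

section

variable {q : ℕ} {n k lam : ℝ} {T : ℕ} {D₀ : Mat q} {Ω : Type*} [MeasurableSpace Ω]
  {μ : Measure Ω} [IsProbabilityMeasure μ] {Φ y : ℕ → Ω → Mat q}

theorem ae_posDef_init (hn : (q : ℝ) - 1 < n) (hk : 0 < k) (D : Mat q) :
    ∀ᵐ A ∂wishart (n + k) D, A.PosDef :=
  ae_posDef_wishart (by linarith) _

theorem IsUhligExtended.isRegularModel (hq : 1 ≤ q) (hn : (q : ℝ) - 1 < n)
    (hk : IsWishartDof q k) (hlam : 0 < lam) (hD : D₀.PosDef)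
    (h : IsUhligExtended μ T lam n k D₀ Φ y) :
    IsRegularModel μ T k lam D₀ (wishart (n + k) ((k • D₀)⁻¹))
      (fun _ D A => ueTransition lam n k D A) Φ y where
  model := h
  dof := hk
  dof_pos := hk.pos hq
  discount_pos := hlam
  posDef_scale := hD
  ae_posDef_init := ae_posDef_init hn (hk.pos hq) _
  exists_kernel _ := by
    have := isProbabilityMeasure_matrixBeta (Or.inr hn) hk
    exact exists_kernel_ueTransition lam n k
  isProbability _ D A := isProbabilityMeasure_ueTransition hn hk lam D A
  ae_posDef_trans _ _ _ hD hA := ae_posDef_ueTransition hq hn hk hlam hD hA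

theorem IsBetaBartlett.isRegularModel (hq : 1 ≤ q) (hn : (q : ℝ) - 1 < n)
    (hk : IsWishartDof q k) (hlam : 0 < lam) (hD : D₀.PosDef)
    (h : IsBetaBartlett μ T (n / (n + k)) lam k (n + k) D₀ Φ y) :
    IsRegularModel μ T k lam D₀ (wishart (n + k) ((k • D₀)⁻¹))
      (fun t D A => bbTransition (n / (n + k)) lam k (bbDof (n / (n + k)) k (n + k) t) D A)
      Φ y := by
  have hk0 := hk.pos hq
  have hn0 : 0 < n := IsWishartDof.pos hq (Or.inr hn)
  have hnk : n + k ≠ 0 := by positivity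
  refine ⟨h, hk, hk0, hlam, hD, ae_posDef_init hn hk0 _, fun t => ?_, fun t D A => ?_,
    fun t D A hD hA => ?_⟩
  · have := isProbabilityMeasure_betaNoise hn hk0
    rw [bbDof_matching hnk]
    have : SFinite (bbNoise q (n / (n + k)) (n + k)) := by
      rw [bbNoise_matching hnk]; infer_instance
    exact exists_kernel_bbTransition _ _ _ _
  · rw [bbDof_matching hnk]
    exact isProbabilityMeasure_bbTransition hn hk0 hnk lam D A
  · rw [bbDof_matching hnk]
    exact ae_posDef_bbTransition hn hk0 hnk hlam hD hA

end

end VolatilityProcess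

theorem mainTheorem2 {q : ℕ} (hq : 1 ≤ q) (T : ℕ)
    -- hyperparameters of the Uhlig extended process
    (lam n k : ℝ) (DU : Mat q) (hlam : 0 < lam ∧ lam < 1) (hn : (q : ℝ) - 1 < n)
    (hk : (∃ m : ℕ, 0 < m ∧ m < q ∧ k = m) ∨ (q : ℝ) - 1 < k) (hDU : DU.PosDef)
    -- hyperparameters of the beta-Bartlett process, and the matching condition
    (k₀ β b : ℝ) (DB : Mat q)
    (hk₀ : k₀ = n + k) (hβ : β = n / (n + k)) (hb : b = lam) (hD : DB = DU)
    -- the two processes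
    {Ω Ω' : Type*} [MeasurableSpace Ω] [MeasurableSpace Ω']
    (μU : Measure Ω) [IsProbabilityMeasure μU] (μB : Measure Ω') [IsProbabilityMeasure μB]
    (ΦU yU : ℕ → Ω → Mat q) (ΦB yB : ℕ → Ω' → Mat q)
    (hU : IsUhligExtended μU T lam n k DU ΦU yU)
    (hB : IsBetaBartlett μB T β b k k₀ DB ΦB yB) :
    -- the conditional laws of the next state, given the current state and the data so far
    (∀ t < T,
      (∀ᵐ ω ∂μU, condDistrib (ΦU (t + 1)) (fun ω' => (ΦU t ω', data yU t ω')) μU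
          (ΦU t ω, data yU t ω) =
        ueTransition lam n k (scaleMatrix lam DU (fun s => yU s ω) t) (ΦU t ω)) ∧
      (∀ᵐ ω ∂μB, condDistrib (ΦB (t + 1)) (fun ω' => (ΦB t ω', data yB t ω')) μB
          (ΦB t ω, data yB t ω) =
        bbTransition β b k (bbDof β k k₀ t) (scaleMatrix b DB (fun s => yB s ω) t) (ΦB t ω))) ∧
    -- the difference of the conditional means at a common state `Φ` and common `D`
    (∀ (t : ℕ) (D Φ P U : Mat q), D.PosDef → Φ.PosDef → P = scaleFactor k D →
      U = bartlettFactor P Φ →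
      (∀ i j,
        Integrable (fun A : Mat q => A i j) (ueTransition lam n k D Φ) ∧
        Integrable (fun A : Mat q => A i j) (bbTransition β b k (bbDof β k k₀ t) D Φ) ∧
        (∫ A, A i j ∂(ueTransition lam n k D Φ)) -
            (∫ A, A i j ∂(bbTransition β b k (bbDof β k k₀ t) D Φ)) =
          (lam⁻¹ • (Pᵀ * ((n / (n + k)) • (Uᵀ * U) - gramMean n k U) * P)) i j ∧
        Integrable (fun η => ((bbFactor U η)ᵀ * bbFactor U η) i j)
          (bbNoise q β (bbDof β k k₀ t)) ∧
        (∫ η, ((bbFactor U η)ᵀ * bbFactor U η) i j ∂(bbNoise q β (bbDof β k k₀ t))) =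
          gramMean n k U i j) ∧
      -- the case of diagonal `U`
      (U.IsDiag → ∀ i : Fin q, 1 ≤ (i : ℕ) →
        (∫ η, ((bbFactor U η)ᵀ * bbFactor U η) i i ∂(bbNoise q β (bbDof β k k₀ t))) =
          (n - ((i : ℝ) + 1) + 1) * U i i ^ 2 / (n - ((i : ℝ) + 1) + 1 + k) ∧
        (n - ((i : ℝ) + 1) + 1) * U i i ^ 2 / (n - ((i : ℝ) + 1) + 1 + k) ≠
          n * U i i ^ 2 / (n + k) ∧
        (∫ A, A i i ∂(ueTransition lam n k D Φ)) ≠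
          ∫ A, A i i ∂(bbTransition β b k (bbDof β k k₀ t) D Φ)) ∧
      -- the conditional means, hence the transition laws, always differ in dimension at least two
      (2 ≤ q →
        (∃ i j, (∫ A, A i j ∂(ueTransition lam n k D Φ)) ≠
          ∫ A, A i j ∂(bbTransition β b k (bbDof β k k₀ t) D Φ)) ∧
        ueTransition lam n k D Φ ≠ bbTransition β b k (bbDof β k k₀ t) D Φ)) ∧
    -- the joint smoothed posteriors differ, for almost all data under either model
    (2 ≤ q → 1 ≤ T →
      (∀ᵐ yobs ∂(μU.map (data yU T)),
        smoothedPosterior μU T ΦU yU yobs ≠ smoothedPosterior μB T ΦB yB yobs) ∧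
      (∀ᵐ yobs ∂(μB.map (data yB T)),
        smoothedPosterior μU T ΦU yU yobs ≠ smoothedPosterior μB T ΦB yB yobs)) := by
  subst hk₀ hβ hb hD
  have hn0 : 0 < n := IsWishartDof.pos hq (Or.inr hn)
  have hk0 : 0 < k := IsWishartDof.pos hq hk
  have hnk : n + k ≠ 0 := by positivity
  have rU := hU.isRegularModel hq hn hk hlam.1 hDU
  have rB := hB.isRegularModel hq hn hk hlam.1 hDU
  refine ⟨fun t ht => ⟨rU.ae_condDistrib_state ht, rB.ae_condDistrib_state ht⟩,
    fun t D Φ P U hD hΦ hP hU => ?_, fun hq2 hT => ?_⟩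
  · rw [bbDof_matching hnk]
    exact transition_comparison hq hn hk hlam.1 hD hΦ hP hU
  -- After the substitutions the common discount factor λ is called b.
  · have hne : ∀ (t : ℕ) (D A : Mat q), D.PosDef → A.PosDef → ueTransition b n k D A ≠
        bbTransition (n / (n + k)) b k (bbDof (n / (n + k)) k (n + k) t) D A :=
      fun t D A hD hA => by
        rw [bbDof_matching hnk]
        exact ueTransition_ne_bbTransition hq2 hn hk hlam.1.ne' hD hA
    refine ⟨rU.ae_smoothedPosterior_ne rB hne hT, ?_⟩
    filter_upwards [rB.ae_smoothedPosterior_ne rU (fun t D A hD hA => (hne t D A hD hA).symm) hT]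
      with d hd using hd.symm
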